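/- Let $m\ge 2$, $n\ge 1$, let $I\subseteq\mathbb R$ be an interval with non-empty interior (open, half-open or closed), and let $\gamma\colon I\to\mathbb R^{m+n}$ be a smooth regular curve that is an embedding (a homeomorphism onto its image). Let $\mathscr D=(\mathscr D_t)_{t\in I}$ be a smooth distribution of $m$-dimensional linear subspaces of $\mathbb R^{m+n}$ along $\gamma$ with $\dot\gamma(t)\in\mathscr D_t$ for all $t$, let $\pi^\top,\pi^\perp$ be the orthogonal projections onto $\mathscr D$ and $\mathscr D^\perp$, and let $\overline D_t=d/dt$ be the Euclidean covariant derivative along $\gamma$. An $m$-dimensional embedded submanifold $M$ of $\mathbb R^{m+n}$, possibly with boundary, with second fundamental form $\alpha$, is called *developable* if the nullity space $\Delta_p=\{x\in T_pM:\alpha(x,\cdot)=0\}$ has dimension $m-1$ for every $p\in M$ and $T_p\partial M=\Delta_p$ for every $p\in\partial M$ (so that the boundary, if any, consists of rulings). A *solution* of the geometric Cauchy problem along $(\gamma,\mathscr D)$ is an $m$-dimensional developable submanifold $M$ containing $\gamma(I)$ such that $T_{\gamma(t)}M=\mathscr D_t$ for all $t\in I$, where $\partial M$ occurs only at the end points of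 $\gamma$: for $t\in I$, $\gamma(t)\in\partial M$ if and only if $t$ is an end point of $I$, and every connected component of $\partial M$ contains $\gamma(t)$ for some end point $t\in I$. (So $\partial M=\emptyset$ if $I$ is open.) For $t\in I$ let $\rho_t\colon\mathscr D_t^\perp\to\mathscr D_t$ be the linear map $\nu\mapsto\pi^\top(\overline D_t\nu)$, where $\nu$ is extended to a smooth section of $\mathscr D^\perp$ (the result does not depend on the extension). Assume that $\pi^\perp(\overline D_t\dot\gamma)$ is never zero. Then a solution exists if and only if $\rho_t$ has rank one for every $t\in I$. Moreover: (i) If $M_1$ and $M_2$ are solutions, there is an open set $U\supseteq\gamma(I)$ of $\mathbb R^{m+n}$ such that $M_1\cap U=M_2\cap U$. (ii) Near $\gamma(I)$ a solution $M$ is $\gamma+\mathscr D\cap(\operatorname{Im}\rho)^\perp$: there are an open set $U\supseteq\gamma(I)$ and a continuous function $\varepsilon\colon I\to(0,\infty)$ such that $$M\cap U=\{\gamma(t)+x : t\in I,\ x\in\mathscr D_t\cap(\operatorname{Im}\rho_t)^\perp,\ |x|<\varepsilon(t)\}.$$ (iii) Suppose that $I$ is compact and $\gamma$ has unit speed. There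 exist a smooth orthonormal frame $(E_1,\dots,E_m)$ of $\mathscr D$ with $E_1=\dot\gamma$, and a smooth section $N$ of $\mathscr D^\perp$ such that $\pi^\top(\overline D_tN)$ never vanishes. For any such frame and section put, for $j=1,\dots,m-1$, $$X_j=(\overline D_tE_{j+1}\cdot N)\,E_1-(\overline D_tE_1\cdot N)\,E_{j+1},\qquad \sigma(t,u)=\gamma(t)+\sum_{j=1}^{m-1}u^jX_j(t).$$ If $M$ is a solution then, for all sufficiently small $\varepsilon>0$, the restriction of $\sigma$ to $I\times(-\varepsilon,\varepsilon)^{m-1}$ is a smooth embedding, its image is a solution, and there is an open set $U\supseteq\gamma(I)$ such that $M\cap U$ equals this image. -/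

import Mathlib

open scoped ContDiff

namespace DevCauchy

/-- Euclidean space `ℝ^d`. -/
abbrev Euc (d : ℕ) : Type := EuclideanSpace ℝ (Fin d)

/-! ### Smooth fields and distributions along a curve -/

/-- `f` is smooth on the subset `I` of the line: it is the restriction to `I` of a map that is
smooth on an open set containing `I`. -/
def SmoothAlong {F : Type*} [NormedAddCommGroup F] [NormedSpace ℝ F]
    (I : Set ℝ) (f : ℝ → F) : Prop :=
  ∃ (O : Set ℝ) (g : ℝ → F), IsOpen O ∧ I ⊆ O ∧ ContDiffOn ℝ ∞ g O ∧ Set.EqOn f g I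

/-- The Euclidean covariant derivative of a vector field along a curve defined on `I`
(one-sided at the end points that belong to `I`). -/
noncomputable def covDeriv {d : ℕ} (I : Set ℝ) (V : ℝ → Euc d) (t : ℝ) : Euc d :=
  derivWithin V I t

/-- `D` is a smooth distribution of rank `m` along a curve defined on `I`: a rank `m` subbundle
of the trivial bundle `I × ℝ^d`, spanned locally by smooth (orthonormal) frames. -/
def IsDistribution {d : ℕ} (m : ℕ) (I : Set ℝ) (D : ℝ → Submodule ℝ (Euc d)) : Prop :=
  ∀ t₀ ∈ I, ∃ (O : Set ℝ) (e : Fin m → ℝ → Euc d), IsOpen O ∧ t₀ ∈ O ∧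
    (∀ i, SmoothAlong (I ∩ O) (e i)) ∧
    ∀ t ∈ I ∩ O, Orthonormal ℝ (fun i => e i t) ∧
      Submodule.span ℝ (Set.range fun i => e i t) = D t

/-- `V` is a smooth section over `I` of the orthogonal distribution of `D`. -/
def IsNormalSection {d : ℕ} (I : Set ℝ) (D : ℝ → Submodule ℝ (Euc d)) (V : ℝ → Euc d) : Prop :=
  SmoothAlong I V ∧ ∀ t ∈ I, V t ∈ (D t)ᗮ

/-- The linear map `ρ_t : D_tᗮ → D_t`, sending `ν` to the tangential part of the covariant
derivative at `t` of a section of the orthogonal distribution that extends `ν`. The extension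
used is `s ↦ π^⊥_s ν`; any other gives the same value, see `rho_apply_eq`. -/
noncomputable def rho {d : ℕ} (I : Set ℝ) (D : ℝ → Submodule ℝ (Euc d)) (t : ℝ) :
    (D t)ᗮ →L[ℝ] D t :=
  (D t).orthogonalProjectionOnto ∘L
    (derivWithin (fun s => (D s)ᗮ.starProjection) I t ∘L (D t)ᗮ.subtypeL)

/-- The image of `ρ_t`, as a subspace of `ℝ^d`. -/
noncomputable def rhoImage {d : ℕ} (I : Set ℝ) (D : ℝ → Submodule ℝ (Euc d)) (t : ℝ) :
    Submodule ℝ (Euc d) :=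
  (LinearMap.range (rho I D t).toLinearMap).map (D t).subtype

/-- The rank of `ρ_t`. -/
noncomputable def rhoRank {d : ℕ} (I : Set ℝ) (D : ℝ → Submodule ℝ (Euc d)) (t : ℝ) : ℕ :=
  Module.finrank ℝ (LinearMap.range (rho I D t).toLinearMap)

theorem SmoothAlong.differentiableWithinAt {F : Type*} [NormedAddCommGroup F] [NormedSpace ℝ F]
    {I : Set ℝ} {f : ℝ → F} (h : SmoothAlong I f) {t : ℝ} (ht : t ∈ I) :
    DifferentiableWithinAt ℝ f I t := by
  obtain ⟨O, g, hO, hsub, hg, hfg⟩ := h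
  have h1 : DifferentiableAt ℝ g t :=
    (hg.differentiableOn (by simp)).differentiableAt (hO.mem_nhds (hsub ht))
  exact h1.differentiableWithinAt.congr hfg (hfg ht)

theorem IsDistribution.differentiableWithinAt_starProjection {d m : ℕ} {I : Set ℝ}
    {D : ℝ → Submodule ℝ (Euc d)} (hD : IsDistribution m I D) {t : ℝ} (ht : t ∈ I) :
    DifferentiableWithinAt ℝ (fun s => (D s)ᗮ.starProjection) I t := by
  obtain ⟨O, e, hO, htO, he, hspan⟩ := hD t ht
  have key : ∀ s ∈ I ∩ O, (D s)ᗮ.starProjection =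
      ContinuousLinearMap.id ℝ (Euc d) -
        ∑ i, (innerSL ℝ (e i s)).smulRight (e i s) := by
    intro s hs
    obtain ⟨ho, hsp⟩ := hspan s hs
    ext1 x
    have hP : (D s).starProjection x = ∑ i, (inner ℝ (e i s) x) • e i s := by
      apply Submodule.eq_starProjection_of_mem_orthogonal
      · rw [← hsp]
        exact Submodule.sum_mem _ fun i _ =>
          Submodule.smul_mem _ _ (Submodule.subset_span ⟨i, rfl⟩)
      · rw [← hsp, Submodule.mem_orthogonal]
        intro u hu
        induction hu using Submodule.span_induction with
        | mem u hu =>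
          obtain ⟨j, rfl⟩ := hu
          simp only [inner_sub_right, inner_sum, inner_smul_right]
          rw [Finset.sum_eq_single j]
          · rw [real_inner_self_eq_norm_sq, ho.1 j]; simp
          · intro i _ hij
            rw [ho.2 (Ne.symm hij), mul_zero]
          · simp
        | zero => simp
        | add u v _ _ hu hv => rw [inner_add_left, hu, hv, add_zero]
        | smul c u _ hu => rw [inner_smul_left, hu, mul_zero]
    rw [Submodule.starProjection_orthogonal_val, hP]
    simp
  have hdiff : DifferentiableWithinAt ℝ (fun s => ContinuousLinearMap.id ℝ (Euc d) -
        ∑ i, (innerSL ℝ (e i s)).smulRight (e i s)) (I ∩ O) t := by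
    have hd := fun i => (he i).differentiableWithinAt (t := t) ⟨ht, htO⟩
    have hs : ∀ i, DifferentiableWithinAt ℝ
        (fun s => (innerSL ℝ (e i s)).smulRight (e i s)) (I ∩ O) t := fun i => by
      have h1 : DifferentiableWithinAt ℝ (fun s => innerSL ℝ (e i s)) (I ∩ O) t :=
        ((innerSL ℝ).differentiable.differentiableAt).comp_differentiableWithinAt t (hd i)
      have hb := isBoundedBilinearMap_smulRight (𝕜 := ℝ) (E := Euc d) (F := Euc d)
      exact (hb.differentiableAt (innerSL ℝ (e i t), e i t)).comp_differentiableWithinAt t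
        (h1.prodMk (hd i))
    exact (differentiableWithinAt_const _).sub (DifferentiableWithinAt.fun_sum fun i _ => hs i)
  exact (hdiff.congr key (key t ⟨ht, htO⟩)).mono_of_mem_nhdsWithin
    (Filter.inter_mem self_mem_nhdsWithin (mem_nhdsWithin_of_mem_nhds (hO.mem_nhds htO)))

/-- `ρ_t` is computed by any smooth section of the orthogonal distribution. -/
theorem rho_apply_eq {d m : ℕ} {I : Set ℝ} {D : ℝ → Submodule ℝ (Euc d)}
    (hD : IsDistribution m I D) (hI : UniqueDiffOn ℝ I) {V : ℝ → Euc d}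
    (hV : IsNormalSection I D V) {t : ℝ} (ht : t ∈ I) :
    rho I D t ⟨V t, hV.2 t ht⟩ = (D t).orthogonalProjectionOnto (covDeriv I V t) := by
  have hP := (hD.differentiableWithinAt_starProjection ht).hasDerivWithinAt
  have hV' := (hV.1.differentiableWithinAt ht).hasDerivWithinAt
  have h1 := hP.clm_apply hV'
  have h2 : Set.EqOn V (fun s => (D s)ᗮ.starProjection (V s)) I := fun s hs =>
    (Submodule.starProjection_eq_self_iff.2 (hV.2 s hs)).symm
  have h3 := (h1.congr h2 (h2 ht)).derivWithin (hI t ht)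
  unfold covDeriv
  rw [h3, map_add]
  have h4 : (D t).orthogonalProjectionOnto ((D t)ᗮ.starProjection (derivWithin V I t)) = 0 :=
    Submodule.orthogonalProjectionOnto_apply_of_mem_orthogonal
      (Submodule.starProjection_apply_mem _ _)
  rw [h4, add_zero]
  rfl

/-! ### Submanifolds of Euclidean space -/

/-- `Φ` is a smooth diffeomorphism between open subsets of `ℝ^d`. -/
def IsSmoothChart {d : ℕ} (Φ : OpenPartialHomeomorph (Euc d) (Euc d)) : Prop :=
  ContDiffOn ℝ ∞ Φ Φ.source ∧ ContDiffOn ℝ ∞ Φ.symm Φ.target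

/-- Near `p`, and up to a diffeomorphism, `M` is the coordinate plane `ℝ^m × 0`. -/
def IsInteriorPoint {d : ℕ} (m : ℕ) (M : Set (Euc d)) (p : Euc d) : Prop :=
  p ∈ M ∧ ∃ Φ : OpenPartialHomeomorph (Euc d) (Euc d), IsSmoothChart Φ ∧ p ∈ Φ.source ∧
    ∀ q ∈ Φ.source, q ∈ M ↔ ∀ i : Fin d, m ≤ i.val → Φ q i = 0

/-- Near `p`, and up to a diffeomorphism, `M` is the half plane `{x₀ ≥ 0}` of the coordinate plane
`ℝ^m × 0`, and `p` lies on its edge `{x₀ = 0}`. -/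
def IsBoundaryPoint {d : ℕ} (m : ℕ) (M : Set (Euc d)) (p : Euc d) : Prop :=
  p ∈ M ∧ ∃ Φ : OpenPartialHomeomorph (Euc d) (Euc d), IsSmoothChart Φ ∧ p ∈ Φ.source ∧
    (∀ i : Fin d, i.val = 0 → Φ p i = 0) ∧
    ∀ q ∈ Φ.source, q ∈ M ↔
      (∀ i : Fin d, m ≤ i.val → Φ q i = 0) ∧ ∀ i : Fin d, i.val = 0 → 0 ≤ Φ q i

/-- `M` is an `m`-dimensional smooth embedded submanifold of `ℝ^d`, possibly with boundary
(used for `1 ≤ m ≤ d`). -/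
def IsSubmanifold {d : ℕ} (m : ℕ) (M : Set (Euc d)) : Prop :=
  ∀ p ∈ M, IsInteriorPoint m M p ∨ IsBoundaryPoint m M p

/-- The boundary of the `m`-dimensional submanifold `M`. -/
def bdry {d : ℕ} (m : ℕ) (M : Set (Euc d)) : Set (Euc d) :=
  {p | IsBoundaryPoint m M p}

/-- The tangent space of `M` at `p`, as a linear subspace of `ℝ^d`. (At a boundary point the
tangent directions only fill a half space of it, whence the span.) -/
noncomputable def tangentSpaceAt {d : ℕ} (M : Set (Euc d)) (p : Euc d) : Submodule ℝ (Euc d) :=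
  Submodule.span ℝ (tangentConeAt ℝ M p)

/-- `Y` is (a smooth ambient extension of) a tangent vector field of `M`. -/
def IsTangentField {d : ℕ} (M : Set (Euc d)) (Y : Euc d → Euc d) : Prop :=
  ContDiff ℝ ∞ Y ∧ ∀ q ∈ M, Y q ∈ tangentSpaceAt M q

/-- The second fundamental form `α(x, Y)` of `M` at `p`, for `x` tangent at `p` and `Y` a tangent
field: the normal part of the derivative of `Y` in the direction `x` (Gauss formula). -/
noncomputable def secondFundamentalForm {d : ℕ} (M : Set (Euc d)) (p x : Euc d)
    (Y : Euc d → Euc d) : Euc d :=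
  (tangentSpaceAt M p)ᗮ.starProjection (fderiv ℝ Y p x)

/-- The nullity space `{x ∈ T_pM | α(x, ·) = 0}`. -/
noncomputable def nullitySpace {d : ℕ} (M : Set (Euc d)) (p : Euc d) : Submodule ℝ (Euc d) where
  carrier := {x | x ∈ tangentSpaceAt M p ∧
    ∀ Y, IsTangentField M Y → secondFundamentalForm M p x Y = 0}
  add_mem' := fun {x y} hx hy => ⟨add_mem hx.1 hy.1, fun Y hY => by
    have h1 := hx.2 Y hY
    have h2 := hy.2 Y hY
    simp only [secondFundamentalForm] at h1 h2 ⊢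
    rw [map_add, map_add, h1, h2, add_zero]⟩
  zero_mem' := ⟨zero_mem _, fun Y _ => by simp [secondFundamentalForm]⟩
  smul_mem' := fun c x hx => ⟨Submodule.smul_mem _ c hx.1, fun Y hY => by
    have h1 := hx.2 Y hY
    simp only [secondFundamentalForm] at h1 ⊢
    rw [map_smul, map_smul, h1, smul_zero]⟩

/-- `M` is an `m`-dimensional developable submanifold: the relative nullity index is `m - 1` at
every point and, if `M` has a boundary, the boundary is tangent to the nullity distribution
(so that it consists of rulings and every ruling is open in an affine subspace). -/
def IsDevelopable {d : ℕ} (m : ℕ) (M : Set (Euc d)) : Prop :=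
  IsSubmanifold m M ∧
  (∀ p ∈ M, Module.finrank ℝ (nullitySpace M p) = m - 1) ∧
  ∀ p ∈ bdry m M, tangentSpaceAt (bdry m M) p = nullitySpace M p

/-! ### The geometric Cauchy problem -/

/-- `M` solves the geometric Cauchy problem for `m`-dimensional developable submanifolds along
`(γ, D)`: it contains `γ` and its tangent bundle along `γ` is `D`. A boundary of `M` is allowed
only at the end points of `γ`: the curve meets the boundary exactly at those end points of `I`
that belong to `I`, and each connected component of the boundary contains such a point. In
particular `M` has no boundary when `I` is open. -/
def IsSolution {d : ℕ} (m : ℕ) (I : Set ℝ) (γ : ℝ → Euc d) (D : ℝ → Submodule ℝ (Euc d))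
    (M : Set (Euc d)) : Prop :=
  IsDevelopable m M ∧
  (∀ t ∈ I, γ t ∈ M ∧ tangentSpaceAt M (γ t) = D t) ∧
  (∀ t ∈ I, γ t ∈ bdry m M ↔ t ∈ frontier I) ∧
  ∀ p ∈ bdry m M, ∃ t ∈ I ∩ frontier I, p ∈ connectedComponentIn (bdry m M) (γ t)

/-! ### The explicit parametrization -/

/-- `E` is a smooth orthonormal frame of `D` whose first member is the velocity of `γ`. -/
def IsAdaptedFrame {d m : ℕ} (I : Set ℝ) (γ : ℝ → Euc d) (D : ℝ → Submodule ℝ (Euc d))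
    (E : Fin m → ℝ → Euc d) : Prop :=
  (∀ i, SmoothAlong I (E i)) ∧
  ∀ t ∈ I, Orthonormal ℝ (fun i => E i t) ∧
    Submodule.span ℝ (Set.range fun i => E i t) = D t ∧
    ∀ i, i.val = 0 → E i t = covDeriv I γ t

/-- `N` is a smooth section of the orthogonal distribution such that the tangential part of its
covariant derivative never vanishes. -/
def IsAdmissibleNormal {d : ℕ} (I : Set ℝ) (D : ℝ → Submodule ℝ (Euc d)) (N : ℝ → Euc d) : Prop :=
  IsNormalSection I D N ∧ ∀ t ∈ I, (D t).starProjection (covDeriv I N t) ≠ 0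

/-- `X_j = (D_t E_{j+1} · N) E_1 - (D_t E_1 · N) E_{j+1}` (the indices of the frame start from `0`
here, so that `E_1` is `E 0`). -/
noncomputable def rulingField {d m : ℕ} (I : Set ℝ) (E : Fin m → ℝ → Euc d) (N : ℝ → Euc d)
    (j : Fin (m - 1)) (t : ℝ) : Euc d :=
  let E₁ := E ⟨0, by have := j.isLt; omega⟩
  let E' := E ⟨j.val + 1, by have := j.isLt; omega⟩
  (inner ℝ (covDeriv I E' t) (N t)) • E₁ t - (inner ℝ (covDeriv I E₁ t) (N t)) • E' t

/-- `σ(t, u) = γ(t) + ∑ u^j X_j(t)`. -/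
noncomputable def sigma {d k : ℕ} (γ : ℝ → Euc d) (X : Fin k → ℝ → Euc d)
    (z : ℝ × (Fin k → ℝ)) : Euc d :=
  γ z.1 + ∑ j, z.2 j • X j z.1

/-- The domain `I × (-ε, ε)^k`. -/
def box (k : ℕ) (I : Set ℝ) (ε : ℝ) : Set (ℝ × (Fin k → ℝ)) :=
  {z | z.1 ∈ I ∧ ∀ j, z.2 j ∈ Set.Ioo (-ε) ε}

/-- `f` restricts to a smooth embedding of `A` (used for convex sets `A` with interior points):
it is smooth on `A`, has injective differential there, and is a homeomorphism onto its image. -/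
def IsSmoothEmbeddingOn {G F : Type*} [NormedAddCommGroup G] [NormedSpace ℝ G]
    [NormedAddCommGroup F] [NormedSpace ℝ F] (f : G → F) (A : Set G) : Prop :=
  ContDiffOn ℝ ∞ f A ∧ (∀ z ∈ A, Function.Injective (fderivWithin ℝ f A z)) ∧
    Topology.IsEmbedding (A.domRestrict f)

end DevCauchy

namespace DevCauchy

open Set Filter Topology

/-! ### Smooth functions near a point of an interval -/

/-! Differentiating the product of a normal section with a section `X` of `D` shows that `ρ` is
minus the adjoint of `X ↦ π^⊥(X')` (`inner_rho`). Applied to `ν = π^⊥(γ'')` and `X = γ'` this gives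
`⟨ρ ν, γ'⟩ = -|ν|² < 0`. So `ρ` is never zero and the velocity is transversal to `Δ = D ∩ (Im ρ)^⊥`,
called `ruling` below.

Necessity of rank one. Near `γ(t)` a solution lies in the graph of a smooth map over its tangent
space, encoded by `G` (`IsGraphAt`). Nullity directions are killed by `D²G`, so a nullity vector
extends along `γ` to a section of `D` with zero derivative, and adjointness puts it in `Δ`. The
nullity has dimension `m - 1` and `Δ` has dimension `m - rank ρ` with `rank ρ ≥ 1`; hence the rank
is one and `Δ` is the nullity (`IsSolution.rank_and_nullity`).

Existence. If the rank is one, derivatives of sections of `Δ` stay in `D`. Hence the ruled map `(t,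
x) ↦ γ(t) + x` on `Δ` has tangent space `D t` along the whole ruling through `γ(t)`, wherever it is
an immersion. Constancy of the tangent space along rulings makes them nullity directions, and
`π^⊥(γ'') ≠ 0` excludes further ones (`IsRuledPatch.isSolution`). A thin neighbourhood of the zero
section is embedded because `γ` is (`CauchyData.exists_tube`).

Uniqueness. The kernel of a Hessian of rank one is parallel along itself, by the symmetry of third
derivatives (`HessianRankOne`). Therefore a solution contains the segments that leave `γ` in nullity
directions. Near an end point of `γ` such a segment cannot cross the boundary, which lies in a
ruling itself (`IsSolution.rulings_near_of_frontier`). Being an `m`-dimensional graph, the solution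
has no other points near the curve (`IsSolution.exists_tube`). So all solutions agree with the image
of any thin neighbourhood of the zero section. The explicit parametrization is one more such image,
since the fields `X_j` form a basis of `Δ`. -/

theorem exists_contDiff_eventuallyEq {E F : Type*} [NormedAddCommGroup E] [NormedSpace ℝ E]
    [FiniteDimensional ℝ E] [NormedAddCommGroup F] [NormedSpace ℝ F] {f : E → F} {U : Set E}
    (hU : IsOpen U) (hf : ContDiffOn ℝ ∞ f U) {x : E} (hx : x ∈ U) :
    ∃ g : E → F, ContDiff ℝ ∞ g ∧ g =ᶠ[𝓝 x] f ∧ (∀ y, ∃ c : ℝ, g y = c • f y) ∧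
      ∀ y ∉ U, g y = 0 := by
  obtain ⟨r, hr, hrU⟩ := Metric.isOpen_iff.1 hU x hx
  -- Multiplication by a bump function keeps the values proportional to those of `f`, so that a
  -- local tangent field can be cut off without leaving the tangent spaces.
  let χ : ContDiffBump x := ⟨r / 4, r / 2, by positivity, by linarith⟩
  have hcl : tsupport χ ⊆ U := by
    rw [χ.tsupport_eq]
    exact (Metric.closedBall_subset_ball (by simp only [χ]; linarith)).trans hrU
  refine ⟨fun y => χ y • f y, ?_, ?_, fun y => ⟨χ y, rfl⟩, fun y hy => ?_⟩
  · rw [contDiff_iff_contDiffAt]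
    intro y
    by_cases hy : y ∈ U
    · exact χ.contDiffAt.smul ((hf y hy).contDiffAt (hU.mem_nhds hy))
    · have hy' : y ∉ tsupport χ := fun h => hy (hcl h)
      have h0 : (fun y => χ y • f y) =ᶠ[𝓝 y] fun _ => 0 := by
        filter_upwards [notMem_tsupport_iff_eventuallyEq.1 hy'] with z hz
        simp [hz]
      exact contDiffAt_const.congr_of_eventuallyEq h0
  · filter_upwards [χ.eventuallyEq_one] with y hy
    simp [hy]
  · have h0 : χ y = 0 := image_eq_zero_of_notMem_tsupport fun h => hy (hcl h)
    simp [h0]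

/-- `f` coincides, on `I` and near `t`, with a smooth function on the line. -/
def SmoothNear {F : Type*} [NormedAddCommGroup F] [NormedSpace ℝ F]
    (I : Set ℝ) (f : ℝ → F) (t : ℝ) : Prop :=
  ∃ g : ℝ → F, ContDiff ℝ ∞ g ∧ f =ᶠ[𝓝[I] t] g

section SmoothNear

variable {F G : Type*} [NormedAddCommGroup F] [NormedSpace ℝ F]
  [NormedAddCommGroup G] [NormedSpace ℝ G] {I : Set ℝ} {t : ℝ}

theorem SmoothAlong.smoothNear_of_inter {f : ℝ → F} {O : Set ℝ} (hO : IsOpen O)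
    (h : SmoothAlong (I ∩ O) f) (ht : t ∈ I ∩ O) : SmoothNear I f t := by
  obtain ⟨O', g, hO', hsub, hg, hfg⟩ := h
  obtain ⟨g', hg', hgg', -, -⟩ := exists_contDiff_eventuallyEq hO' hg (hsub ht)
  refine ⟨g', hg', ?_⟩
  filter_upwards [self_mem_nhdsWithin, nhdsWithin_le_nhds (hO.mem_nhds ht.2),
    nhdsWithin_le_nhds hgg'] with s hs hsO hgs
  rw [hgs, hfg ⟨hs, hsO⟩]

theorem SmoothAlong.smoothNear {f : ℝ → F} (h : SmoothAlong I f) (ht : t ∈ I) :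
    SmoothNear I f t := by
  refine SmoothAlong.smoothNear_of_inter isOpen_univ (O := univ) ?_ ⟨ht, mem_univ _⟩
  rwa [inter_univ]

protected theorem SmoothNear.congr {f f' : ℝ → F} (h : SmoothNear I f t) (h' : f' =ᶠ[𝓝[I] t] f) :
    SmoothNear I f' t := by
  obtain ⟨g, hg, hfg⟩ := h
  exact ⟨g, hg, h'.trans hfg⟩

protected theorem SmoothNear.comp {f : ℝ → F} (h : SmoothNear I f t) (ht : t ∈ I) {φ : F → G} {U : Set F}
    (hU : IsOpen U) (hφ : ContDiffOn ℝ ∞ φ U) (hf : f t ∈ U) :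
    SmoothNear I (fun s => φ (f s)) t := by
  obtain ⟨g, hg, hfg⟩ := h
  have hgt : g t ∈ U := by rwa [← hfg.self_of_nhdsWithin ht]
  obtain ⟨g', hg', hgg', -, -⟩ := exists_contDiff_eventuallyEq (hU.preimage hg.continuous)
    (hφ.comp hg.contDiffOn (fun s hs => hs)) hgt
  refine ⟨g', hg', ?_⟩
  filter_upwards [hfg, nhdsWithin_le_nhds hgg'] with s hs hs'
  rw [hs', hs]; rfl

protected theorem SmoothNear.comp_contDiff {f : ℝ → F} (h : SmoothNear I f t) {φ : F → G}
    (hφ : ContDiff ℝ ∞ φ) : SmoothNear I (fun s => φ (f s)) t := by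
  obtain ⟨g, hg, hfg⟩ := h
  exact ⟨fun s => φ (g s), hφ.comp hg, hfg.fun_comp φ⟩

theorem smoothNear_const (c : F) : SmoothNear I (fun _ => c) t :=
  ⟨fun _ => c, contDiff_const, .rfl⟩

protected theorem SmoothNear.prodMk {f : ℝ → F} {f' : ℝ → G} (h : SmoothNear I f t)
    (h' : SmoothNear I f' t) : SmoothNear I (fun s => (f s, f' s)) t := by
  obtain ⟨g, hg, hfg⟩ := h
  obtain ⟨g', hg', hfg'⟩ := h'
  exact ⟨fun s => (g s, g' s), hg.prodMk hg', hfg.prodMk hfg'⟩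

protected theorem SmoothNear.add {f f' : ℝ → F} (h : SmoothNear I f t) (h' : SmoothNear I f' t) :
    SmoothNear I (fun s => f s + f' s) t :=
  (h.prodMk h').comp_contDiff (φ := fun p : F × F => p.1 + p.2) (by fun_prop)

protected theorem SmoothNear.sub {f f' : ℝ → F} (h : SmoothNear I f t) (h' : SmoothNear I f' t) :
    SmoothNear I (fun s => f s - f' s) t :=
  (h.prodMk h').comp_contDiff (φ := fun p : F × F => p.1 - p.2) (by fun_prop)

protected theorem SmoothNear.neg {f : ℝ → F} (h : SmoothNear I f t) :
    SmoothNear I (fun s => - f s) t :=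
  h.comp_contDiff (φ := fun p : F => -p) (by fun_prop)

protected theorem SmoothNear.smul {f : ℝ → ℝ} {f' : ℝ → F} (h : SmoothNear I f t)
    (h' : SmoothNear I f' t) : SmoothNear I (fun s => f s • f' s) t :=
  (h.prodMk h').comp_contDiff (φ := fun p : ℝ × F => p.1 • p.2) (by fun_prop)

protected theorem SmoothNear.sum {ι : Type*} {s : Finset ι} {f : ι → ℝ → F}
    (h : ∀ i ∈ s, SmoothNear I (f i) t) : SmoothNear I (fun r => ∑ i ∈ s, f i r) t := by
  classical
  induction s using Finset.induction_on with
  | empty => simpa using smoothNear_const (0 : F)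
  | insert i s hi ih =>
    simp only [Finset.sum_insert hi]
    exact (h i (by simp)).add (ih fun j hj => h j (by simp [hj]))

protected theorem SmoothNear.inner {d : ℕ} {f f' : ℝ → Euc d} (h : SmoothNear I f t)
    (h' : SmoothNear I f' t) : SmoothNear I (fun s => inner ℝ (f s) (f' s)) t :=
  (h.prodMk h').comp_contDiff (φ := fun p : Euc d × Euc d => inner ℝ p.1 p.2)
    (contDiff_fst.inner ℝ contDiff_snd)

protected theorem SmoothNear.inv {f : ℝ → ℝ} (h : SmoothNear I f t) (ht : t ∈ I) (h0 : f t ≠ 0) :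
    SmoothNear I (fun s => (f s)⁻¹) t :=
  h.comp ht (φ := fun x => x⁻¹) isOpen_compl_singleton
    (fun _ hx => (contDiffAt_inv ℝ hx).contDiffWithinAt) h0

protected theorem SmoothNear.norm {d : ℕ} {f : ℝ → Euc d} (h : SmoothNear I f t) (ht : t ∈ I)
    (h0 : f t ≠ 0) : SmoothNear I (fun s => ‖f s‖) t :=
  h.comp ht (φ := fun x => ‖x‖) isOpen_compl_singleton
    (fun _ hx => (contDiffAt_norm ℝ hx).contDiffWithinAt) h0

protected theorem SmoothNear.differentiableWithinAt {f : ℝ → F} (h : SmoothNear I f t) (ht : t ∈ I) :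
    DifferentiableWithinAt ℝ f I t := by
  obtain ⟨g, hg, hfg⟩ := h
  exact ((hg.differentiable (by simp)) t).differentiableWithinAt.congr_of_eventuallyEq hfg
    (hfg.self_of_nhdsWithin ht)

protected theorem SmoothNear.continuousWithinAt {f : ℝ → F} (h : SmoothNear I f t) (ht : t ∈ I) :
    ContinuousWithinAt f I t :=
  (h.differentiableWithinAt ht).continuousWithinAt

/-- Unique differentiability, also at the end points of `I`, identifies the derivative within `I`
with that of any smooth extension, at all nearby points of `I`. Iterated covariant derivatives are
thus derivatives of one extension. -/
theorem eventually_derivWithin_eq_deriv (hI : UniqueDiffOn ℝ I) {f g : ℝ → F}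
    (hg : ContDiff ℝ ∞ g) (hfg : f =ᶠ[𝓝[I] t] g) :
    derivWithin f I =ᶠ[𝓝[I] t] deriv g := by
  filter_upwards [eventually_eventually_nhdsWithin.2 hfg, self_mem_nhdsWithin] with s hs hsI
  rw [Filter.EventuallyEq.derivWithin_eq hs (hs.self_of_nhdsWithin hsI)]
  exact ((hg.differentiable (by simp)) s).derivWithin (hI s hsI)

protected theorem SmoothNear.derivWithin (hI : UniqueDiffOn ℝ I) {f : ℝ → F} (h : SmoothNear I f t) :
    SmoothNear I (fun s => derivWithin f I s) t := by
  obtain ⟨g, hg, hfg⟩ := h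
  refine ⟨deriv g, ?_, eventually_derivWithin_eq_deriv hI hg hfg⟩
  have h1 : ContDiff ℝ (∞ + 1) g := hg
  exact (contDiff_succ_iff_deriv.1 h1).2.2

protected theorem SmoothNear.covDeriv {d : ℕ} (hI : UniqueDiffOn ℝ I) {f : ℝ → Euc d}
    (h : SmoothNear I f t) : SmoothNear I (covDeriv I f) t :=
  h.derivWithin hI

protected theorem SmoothNear.exists_extension (hI : UniqueDiffOn ℝ I) {f : ℝ → F} (h : SmoothNear I f t) :
    ∃ g : ℝ → F, ContDiff ℝ ∞ g ∧ ∀ᶠ s in 𝓝[I] t, f s = g s ∧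
      HasDerivWithinAt f (deriv g s) I s ∧ derivWithin f I s = deriv g s := by
  obtain ⟨g, hg, hfg⟩ := h
  refine ⟨g, hg, ?_⟩
  filter_upwards [eventually_derivWithin_eq_deriv hI hg hfg, hfg,
    eventually_eventually_nhdsWithin.2 hfg, self_mem_nhdsWithin] with s h1 h2 h3 h4
  refine ⟨h2, ?_, h1⟩
  exact ((hg.differentiable (by simp)) s).hasDerivAt.hasDerivWithinAt.congr_of_eventuallyEq h3 h2

end SmoothNear

end DevCauchy

namespace DevCauchy

open Set Filter Topology

/-! ### The curve, the distribution and the map `ρ` -/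

/-- The data of the geometric Cauchy problem, with `π^⊥(γ'')` nowhere zero. -/
structure CauchyData {d : ℕ} (m : ℕ) (I : Set ℝ) (γ : ℝ → Euc d)
    (D : ℝ → Submodule ℝ (Euc d)) : Prop where
  ordConnected : I.OrdConnected
  interior_nonempty : (interior I).Nonempty
  smooth : SmoothAlong I γ
  isEmbedding : Topology.IsEmbedding (I.domRestrict γ)
  distribution : IsDistribution m I D
  velocity_mem : ∀ t ∈ I, covDeriv I γ t ∈ D t
  curvature : ∀ t ∈ I, (D t)ᗮ.starProjection (covDeriv I (covDeriv I γ) t) ≠ 0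

/-- The normal part of the acceleration. -/
noncomputable def normalAcc {d : ℕ} (I : Set ℝ) (γ : ℝ → Euc d)
    (D : ℝ → Submodule ℝ (Euc d)) (t : ℝ) : Euc d :=
  (D t)ᗮ.starProjection (covDeriv I (covDeriv I γ) t)

/-- The value of `ρ` at the normal part of the acceleration. -/
noncomputable def conormal {d : ℕ} (I : Set ℝ) (γ : ℝ → Euc d)
    (D : ℝ → Submodule ℝ (Euc d)) (t : ℝ) : Euc d :=
  (D t).starProjection (covDeriv I (normalAcc I γ D) t)

/-- The ruling direction `D_t ∩ (Im ρ_t)ᗮ`. -/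
noncomputable def ruling {d : ℕ} (I : Set ℝ) (D : ℝ → Submodule ℝ (Euc d)) (t : ℝ) :
    Submodule ℝ (Euc d) :=
  D t ⊓ (rhoImage I D t)ᗮ

theorem starProjection_eq_sum {d m : ℕ} {e : Fin m → Euc d} (he : Orthonormal ℝ e)
    {K : Submodule ℝ (Euc d)} (hK : Submodule.span ℝ (range e) = K) (x : Euc d) :
    K.starProjection x = ∑ i, (inner ℝ (e i) x) • e i := by
  apply Submodule.eq_starProjection_of_mem_orthogonal
  · rw [← hK]
    exact Submodule.sum_mem _ fun i _ =>
      Submodule.smul_mem _ _ (Submodule.subset_span ⟨i, rfl⟩)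
  · rw [← hK, Submodule.mem_orthogonal]
    intro u hu
    induction hu using Submodule.span_induction with
    | mem u hu =>
      obtain ⟨j, rfl⟩ := hu
      rw [inner_sub_right, he.inner_right_fintype, sub_self]
    | zero => simp
    | add u v _ _ hu hv => rw [inner_add_left, hu, hv, add_zero]
    | smul c u _ hu => rw [inner_smul_left, hu, mul_zero]

section

variable {d m : ℕ} {I : Set ℝ} {γ : ℝ → Euc d} {D : ℝ → Submodule ℝ (Euc d)} {t : ℝ}

theorem IsDistribution.finrank_eq (hD : IsDistribution m I D) (ht : t ∈ I) :
    Module.finrank ℝ (D t) = m := by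
  obtain ⟨O, e, -, htO, -, he⟩ := hD t ht
  obtain ⟨h1, h2⟩ := he t ⟨ht, htO⟩
  rw [← h2, finrank_span_eq_card h1.linearIndependent, Fintype.card_fin]

theorem IsDistribution.exists_frame (hD : IsDistribution m I D) (ht : t ∈ I) :
    ∃ e : Fin m → ℝ → Euc d, (∀ i, SmoothNear I (e i) t) ∧
      ∀ᶠ s in 𝓝[I] t, Orthonormal ℝ (fun i => e i s) ∧
        Submodule.span ℝ (Set.range fun i => e i s) = D s := by
  obtain ⟨O, e, hO, htO, hs, he⟩ := hD t ht
  refine ⟨e, fun i => (hs i).smoothNear_of_inter hO ⟨ht, htO⟩, ?_⟩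
  filter_upwards [self_mem_nhdsWithin, nhdsWithin_le_nhds (hO.mem_nhds htO)] with s h1 h2
  exact he s ⟨h1, h2⟩

protected theorem SmoothNear.starProjection (hD : IsDistribution m I D) (ht : t ∈ I)
    {v : ℝ → Euc d} (hv : SmoothNear I v t) :
    SmoothNear I (fun s => (D s).starProjection (v s)) t := by
  obtain ⟨e, hs, he⟩ := hD.exists_frame ht
  refine SmoothNear.congr (SmoothNear.sum (s := Finset.univ) fun i _ =>
    ((hs i).inner hv).smul (hs i)) ?_
  filter_upwards [he] with s hs
  exact starProjection_eq_sum hs.1 hs.2 _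

protected theorem SmoothNear.starProjection_orthogonal (hD : IsDistribution m I D) (ht : t ∈ I)
    {v : ℝ → Euc d} (hv : SmoothNear I v t) :
    SmoothNear I (fun s => (D s)ᗮ.starProjection (v s)) t := by
  simp only [Submodule.starProjection_orthogonal_val]
  exact hv.sub (hv.starProjection hD ht)

/-- `ρ` is minus the adjoint of the normal part of the covariant derivative. -/
theorem inner_rho (hI : UniqueDiffOn ℝ I) (hD : IsDistribution m I D) (ht : t ∈ I)
    {X : ℝ → Euc d} (hX : DifferentiableWithinAt ℝ X I t) (hXD : ∀ᶠ s in 𝓝[I] t, X s ∈ D s)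
    (ν : (D t)ᗮ) :
    inner ℝ (rho I D t ν : Euc d) (X t) = - inner ℝ (ν : Euc d) (covDeriv I X t) := by
  have hP := (hD.differentiableWithinAt_starProjection ht).hasDerivWithinAt
  have hV := hP.clm_apply (hasDerivWithinAt_const t I (ν : Euc d))
  have h1 := (hV.inner ℝ hX.hasDerivWithinAt).derivWithin (hI t ht)
  -- The projections of the fixed vector `ν` form a normal section, whose product with `X` vanishes
  -- near `t`. The formula is the derivative of this identity.
  have h2 : (fun s => inner ℝ ((D s)ᗮ.starProjection (ν : Euc d)) (X s)) =ᶠ[𝓝[I] t]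
      fun _ => (0 : ℝ) := by
    filter_upwards [hXD] with s hs
    exact Submodule.inner_left_of_mem_orthogonal hs (Submodule.starProjection_apply_mem _ _)
  rw [h2.derivWithin_eq (h2.self_of_nhdsWithin ht), derivWithin_fun_const] at h1
  have h3 : (rho I D t ν : Euc d) = (D t).starProjection
      (derivWithin (fun s => (D s)ᗮ.starProjection) I t ν) := rfl
  have hXt := hXD.self_of_nhdsWithin ht
  rw [h3, Submodule.inner_starProjection_left_eq_right,
    Submodule.starProjection_eq_self_iff.2 hXt]
  rw [Submodule.starProjection_eq_self_iff.2 ν.2] at h1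
  simp only [map_zero, add_zero, Pi.zero_apply] at h1
  unfold covDeriv
  linarith

theorem mem_ruling_iff {x : Euc d} : x ∈ ruling I D t ↔
    x ∈ D t ∧ ∀ ν : (D t)ᗮ, inner ℝ (rho I D t ν : Euc d) x = 0 := by
  unfold ruling rhoImage
  rw [Submodule.mem_inf, Submodule.mem_orthogonal]
  refine and_congr_right fun _ => ⟨fun h ν => h _ ⟨_, ⟨ν, rfl⟩, rfl⟩, ?_⟩
  rintro h _ ⟨_, ⟨ν, rfl⟩, rfl⟩
  exact h ν

theorem ruling_le : ruling I D t ≤ D t := inf_le_left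

/-- The velocity of a section of `D` that is a ruling direction at `t` is tangent to `D`. -/
theorem covDeriv_mem_of_mem_ruling (hI : UniqueDiffOn ℝ I) (hD : IsDistribution m I D)
    (ht : t ∈ I) {X : ℝ → Euc d} (hX : DifferentiableWithinAt ℝ X I t)
    (hXD : ∀ᶠ s in 𝓝[I] t, X s ∈ D s) (hXt : X t ∈ ruling I D t) : covDeriv I X t ∈ D t := by
  rw [← Submodule.orthogonal_orthogonal (D t), Submodule.mem_orthogonal]
  intro ν hν
  have := inner_rho hI hD ht hX hXD ⟨ν, hν⟩
  rw [(mem_ruling_iff.1 hXt).2] at this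
  simp only at this
  linarith

/-- Differentiating `V = P^⊥ V` leaves a second term that is normal. Differentiability at `t` is
enough here, unlike in `rho_apply_eq`; this suits `normalAcc`, whose smoothness is known only
locally. -/
theorem rho_apply_eq_of_differentiableWithinAt (hI : UniqueDiffOn ℝ I)
    (hD : IsDistribution m I D) (ht : t ∈ I) {V : ℝ → Euc d}
    (hV : DifferentiableWithinAt ℝ V I t) (hVD : ∀ s ∈ I, V s ∈ (D s)ᗮ) :
    (rho I D t ⟨V t, hVD t ht⟩ : Euc d) = (D t).starProjection (covDeriv I V t) := by
  have h1 := (hD.differentiableWithinAt_starProjection ht).hasDerivWithinAt.clm_apply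
    hV.hasDerivWithinAt
  have h2 : Set.EqOn V (fun s => (D s)ᗮ.starProjection (V s)) I := fun s hs =>
    (Submodule.starProjection_eq_self_iff.2 (hVD s hs)).symm
  have h3 := (h1.congr h2 (h2 ht)).derivWithin (hI t ht)
  have h4 : (D t).starProjection ((D t)ᗮ.starProjection (derivWithin V I t)) = 0 :=
    (Submodule.starProjection_apply_eq_zero_iff _).2 (Submodule.starProjection_apply_mem _ _)
  unfold covDeriv
  rw [h3, map_add, h4, add_zero]
  rfl

namespace CauchyData

theorem uniqueDiffOn (h : CauchyData m I γ D) : UniqueDiffOn ℝ I :=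
  uniqueDiffOn_convex h.ordConnected.convex h.interior_nonempty

theorem smoothNear_velocity (h : CauchyData m I γ D) (ht : t ∈ I) :
    SmoothNear I (covDeriv I γ) t :=
  (h.smooth.smoothNear ht).covDeriv h.uniqueDiffOn

theorem smoothNear_normalAcc (h : CauchyData m I γ D) (ht : t ∈ I) :
    SmoothNear I (normalAcc I γ D) t :=
  ((h.smoothNear_velocity ht).covDeriv h.uniqueDiffOn).starProjection_orthogonal
    h.distribution ht

theorem smoothNear_conormal (h : CauchyData m I γ D) (ht : t ∈ I) :
    SmoothNear I (conormal I γ D) t :=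
  ((h.smoothNear_normalAcc ht).covDeriv h.uniqueDiffOn).starProjection h.distribution ht

theorem inner_normal_acceleration (h : CauchyData m I γ D) (ht : t ∈ I) {V : ℝ → Euc d}
    (hV : DifferentiableWithinAt ℝ V I t) (hVD : ∀ s ∈ I, V s ∈ (D s)ᗮ) :
    inner ℝ ((D t).starProjection (covDeriv I V t)) (covDeriv I γ t) =
      - inner ℝ (V t) (covDeriv I (covDeriv I γ) t) := by
  rw [← rho_apply_eq_of_differentiableWithinAt h.uniqueDiffOn h.distribution ht hV hVD]
  exact inner_rho h.uniqueDiffOn h.distribution ht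
    ((h.smoothNear_velocity ht).differentiableWithinAt ht)
    (by filter_upwards [self_mem_nhdsWithin] using h.velocity_mem) _

theorem conormal_mem (t : ℝ) : conormal I γ D t ∈ D t :=
  Submodule.starProjection_apply_mem _ _

theorem normalAcc_mem (t : ℝ) : normalAcc I γ D t ∈ (D t)ᗮ :=
  Submodule.starProjection_apply_mem _ _

theorem conormal_mem_rhoImage (h : CauchyData m I γ D) (ht : t ∈ I) :
    conormal I γ D t ∈ rhoImage I D t := by
  unfold conormal
  rw [← rho_apply_eq_of_differentiableWithinAt h.uniqueDiffOn h.distribution ht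
    ((h.smoothNear_normalAcc ht).differentiableWithinAt ht) fun s _ => normalAcc_mem s]
  exact ⟨_, ⟨_, rfl⟩, rfl⟩

/-- By adjointness the product is `-|π^⊥(γ'')|²`. This sign is the source of transversality: `ρ`
does not vanish and the velocity is not a ruling direction. -/
theorem inner_conormal_velocity_neg (h : CauchyData m I γ D) (ht : t ∈ I) :
    inner ℝ (conormal I γ D t) (covDeriv I γ t) < 0 := by
  unfold conormal
  rw [h.inner_normal_acceleration ht ((h.smoothNear_normalAcc ht).differentiableWithinAt ht)
    fun s _ => normalAcc_mem s]
  have h1 := h.curvature t ht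
  have : inner ℝ (normalAcc I γ D t) (covDeriv I (covDeriv I γ) t) =
      ‖normalAcc I γ D t‖ ^ 2 := by
    rw [← real_inner_self_eq_norm_sq]
    unfold normalAcc
    rw [Submodule.inner_starProjection_left_eq_right, Submodule.inner_starProjection_left_eq_right,
      Submodule.starProjection_eq_self_iff.2 (Submodule.starProjection_apply_mem _ _)]
  rw [this]
  have : 0 < ‖normalAcc I γ D t‖ := norm_pos_iff.2 h1
  nlinarith

theorem conormal_ne_zero (h : CauchyData m I γ D) (ht : t ∈ I) : conormal I γ D t ≠ 0 := by
  intro h0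
  have := h.inner_conormal_velocity_neg ht
  simp [h0] at this

theorem finrank_rhoImage (I : Set ℝ) (D : ℝ → Submodule ℝ (Euc d)) (t : ℝ) :
    Module.finrank ℝ (rhoImage I D t) = rhoRank I D t :=
  Submodule.finrank_map_subtype_eq _ _

theorem rhoImage_eq_span (hr : rhoRank I D t = 1)
    {v : Euc d} (hv : v ∈ rhoImage I D t) (hv0 : v ≠ 0) :
    rhoImage I D t = Submodule.span ℝ {v} := by
  symm
  apply Submodule.eq_of_le_of_finrank_eq
  · rwa [Submodule.span_singleton_le_iff_mem]
  · rw [finrank_span_singleton hv0, finrank_rhoImage, hr]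

theorem mem_ruling_iff_inner (hr : rhoRank I D t = 1)
    {v : Euc d} (hv : v ∈ rhoImage I D t) (hv0 : v ≠ 0) {x : Euc d} :
    x ∈ ruling I D t ↔ x ∈ D t ∧ inner ℝ v x = 0 := by
  unfold ruling
  rw [Submodule.mem_inf, rhoImage_eq_span hr hv hv0,
    Submodule.mem_orthogonal_singleton_iff_inner_right]

theorem rhoImage_le : rhoImage I D t ≤ D t := by
  rintro _ ⟨y, -, rfl⟩
  exact y.2

theorem finrank_rhoImage_add_finrank_ruling (h : CauchyData m I γ D) (ht : t ∈ I) :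
    rhoRank I D t + Module.finrank ℝ (ruling I D t) = m := by
  rw [← finrank_rhoImage, ← h.distribution.finrank_eq ht, ruling, inf_comm]
  exact Submodule.finrank_add_inf_finrank_orthogonal rhoImage_le

theorem one_le_rhoRank (h : CauchyData m I γ D) (ht : t ∈ I) : 1 ≤ rhoRank I D t := by
  rw [← finrank_rhoImage, Nat.one_le_iff_ne_zero, Ne, Submodule.finrank_eq_zero]
  intro h0
  have := h.conormal_mem_rhoImage ht
  rw [h0, Submodule.mem_bot] at this
  exact h.conormal_ne_zero ht this

theorem velocity_notMem_ruling (h : CauchyData m I γ D) (ht : t ∈ I) :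
    covDeriv I γ t ∉ ruling I D t := by
  intro h1
  have h2 := (Submodule.mem_orthogonal _ _).1 h1.2 _ (h.conormal_mem_rhoImage ht)
  exact (h.inner_conormal_velocity_neg ht).ne h2

theorem continuousOn_curve (h : CauchyData m I γ D) : ContinuousOn γ I := fun _ ht =>
  (h.smooth.differentiableWithinAt ht).continuousWithinAt

/-- The curve is an embedding: parameters are close if the points are. -/
theorem exists_dist_lt (h : CauchyData m I γ D) (ht : t ∈ I) {δ : ℝ} (hδ : 0 < δ) :
    ∃ η > 0, ∀ s ∈ I, ‖γ s - γ t‖ < η → |s - t| < δ := by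
  have h1 := h.isEmbedding.isInducing.nhds_eq_comap ⟨t, ht⟩
  have h2 : {s : I | |(s : ℝ) - t| < δ} ∈ 𝓝 (⟨t, ht⟩ : I) := by
    have : Continuous fun s : I => |(s : ℝ) - t| := by fun_prop
    exact this.continuousAt.eventually_lt continuousAt_const (by simpa using hδ)
  rw [h1, mem_comap] at h2
  obtain ⟨V, hV, hVs⟩ := h2
  obtain ⟨η, hη, hηV⟩ := Metric.mem_nhds_iff.1 hV
  refine ⟨η, hη, fun s hs hst => ?_⟩
  have : (⟨s, hs⟩ : I) ∈ I.domRestrict γ ⁻¹' V := hηV (by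
    rw [Metric.mem_ball, dist_eq_norm]; exact hst)
  exact hVs this

end CauchyData

end

end DevCauchy

/-! ### Orthonormal frames with a prescribed first member -/

namespace DevCauchy

open Set Filter Topology

section

variable {d m : ℕ} {I : Set ℝ} {γ : ℝ → Euc d} {D : ℝ → Submodule ℝ (Euc d)} {t : ℝ}

theorem span_range_eq_of_orthonormal {K : Submodule ℝ (Euc d)} (hK : Module.finrank ℝ K = m)
    {e : Fin m → Euc d} (he : Orthonormal ℝ e) (h : ∀ i, e i ∈ K) :
    Submodule.span ℝ (range e) = K := by
  apply Submodule.eq_of_le_of_finrank_eq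
  · rw [Submodule.span_le]
    rintro _ ⟨i, rfl⟩
    exact h i
  · rw [hK, finrank_span_eq_card he.linearIndependent, Fintype.card_fin]

/-- The reflection exchanging the unit vectors `a` and `b`. -/
noncomputable def unitReflection (a b x : Euc d) : Euc d :=
  x - ((1 - inner ℝ a b)⁻¹ * inner ℝ (a - b) x) • (a - b)

theorem unitReflection_apply_right {a b : Euc d} (hb : ‖b‖ = 1) (hab : inner ℝ a b ≠ (1 : ℝ)) :
    unitReflection a b b = a := by
  have h1 : inner ℝ (a - b) b = -(1 - inner ℝ a b) := by
    rw [inner_sub_left, real_inner_self_eq_norm_sq, hb]; ring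
  have h2 : 1 - inner ℝ a b ≠ 0 := sub_ne_zero.2 hab.symm
  rw [unitReflection, h1, mul_neg, inv_mul_cancel₀ h2]
  module

/-- For unit vectors `|a - b|² = 2 (1 - ⟨a, b⟩)`, so the coefficient is that of the orthogonal
reflection in the hyperplane perpendicular to `a - b`. -/
theorem inner_unitReflection {a b : Euc d} (ha : ‖a‖ = 1) (hb : ‖b‖ = 1)
    (hab : inner ℝ a b ≠ (1 : ℝ)) (x y : Euc d) :
    inner ℝ (unitReflection a b x) (unitReflection a b y) = inner ℝ x y := by
  have h2 : 1 - inner ℝ a b ≠ 0 := sub_ne_zero.2 hab.symm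
  have h3 : inner ℝ (a - b) (a - b) = 2 * (1 - inner ℝ a b) := by
    rw [real_inner_self_eq_norm_sq, norm_sub_sq_real, ha, hb]; ring
  simp only [unitReflection]
  generalize hv : a - b = v at *
  generalize 1 - inner ℝ a b = k at *
  rw [inner_sub_left, inner_sub_right, inner_sub_right, inner_smul_left, inner_smul_left,
    inner_smul_right, inner_smul_right, h3, real_inner_comm v x]
  simp only [RCLike.conj_to_real]
  field_simp
  ring

/-- Locally there is a smooth orthonormal frame of a distribution whose first member is a given
unit section. -/
theorem IsDistribution.exists_frame_of_unit_section (hD : IsDistribution m I D) (hm : 0 < m)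
    (ht : t ∈ I) {a : ℝ → Euc d} (ha : SmoothNear I a t) (haD : ∀ s ∈ I, a s ∈ D s)
    (ha1 : ∀ s ∈ I, ‖a s‖ = 1) :
    ∃ F : Fin m → ℝ → Euc d, (∀ i, ContDiff ℝ ∞ (F i)) ∧
      ∀ᶠ s in 𝓝[I] t, Orthonormal ℝ (fun i => F i s) ∧
        Submodule.span ℝ (Set.range fun i => F i s) = D s ∧ F ⟨0, hm⟩ s = a s := by
  -- Changing the sign of the whole frame if necessary keeps its first vector away from `a`, so that
  -- the reflection exchanging the two is smooth.
  obtain ⟨e, hes, he⟩ : ∃ e : Fin m → ℝ → Euc d, (∀ i, SmoothNear I (e i) t) ∧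
      (∀ᶠ s in 𝓝[I] t, Orthonormal ℝ (fun i => e i s) ∧ ∀ i, e i s ∈ D s) ∧
      inner ℝ (a t) (e ⟨0, hm⟩ t) ≤ (0 : ℝ) := by
    obtain ⟨e, hes, he⟩ := hD.exists_frame ht
    rcases le_total (inner ℝ (a t) (e ⟨0, hm⟩ t)) (0 : ℝ) with h | h
    · refine ⟨e, hes, ?_, h⟩
      filter_upwards [he] with s hs
      refine ⟨hs.1, fun i => ?_⟩
      rw [← hs.2]
      exact Submodule.subset_span ⟨i, rfl⟩
    · refine ⟨fun i s => - e i s, fun i => (hes i).neg, ?_, by simpa using h⟩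
      filter_upwards [he] with s hs
      refine ⟨?_, fun i => ?_⟩
      · rw [orthonormal_iff_ite]
        intro i j
        rw [inner_neg_neg]
        exact orthonormal_iff_ite.1 hs.1 i j
      · rw [← hs.2]
        exact Submodule.neg_mem _ (Submodule.subset_span ⟨i, rfl⟩)
  obtain ⟨he, h0⟩ := he
  let i₀ : Fin m := ⟨0, hm⟩
  have hk : SmoothNear I (fun s => 1 - inner ℝ (a s) (e i₀ s)) t :=
    (smoothNear_const 1).sub (ha.inner (hes i₀))
  have hk0 : (1 - inner ℝ (a t) (e i₀ t) : ℝ) ≠ 0 := by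
    have : inner ℝ (a t) (e i₀ t) ≤ (0 : ℝ) := h0
    linarith
  have hR : ∀ i, SmoothNear I (fun s => unitReflection (a s) (e i₀ s) (e i s)) t := by
    intro i
    refine (hes i).sub (SmoothNear.smul ?_ (ha.sub (hes i₀)))
    exact (hk.inv ht hk0).smul ((ha.sub (hes i₀)).inner (hes i))
  choose F hF hFR using hR
  refine ⟨F, hF, ?_⟩
  have hk1 := (hk.continuousWithinAt ht).eventually_ne hk0
  filter_upwards [self_mem_nhdsWithin, he, eventually_all.2 hFR, hk1] with s hsI hs hFs hks
  have hab : inner ℝ (a s) (e i₀ s) ≠ (1 : ℝ) := fun h => hks (by rw [h]; ring)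
  have hon : Orthonormal ℝ fun i => F i s := by
    rw [orthonormal_iff_ite]
    intro i j
    rw [← hFs, ← hFs, inner_unitReflection (ha1 s hsI) (hs.1.1 i₀) hab]
    exact orthonormal_iff_ite.1 hs.1 i j
  refine ⟨hon, span_range_eq_of_orthonormal (hD.finrank_eq hsI) hon fun i => ?_, ?_⟩
  -- The reflection adds multiples of `a - e₀`, which belongs to `D`.
  · rw [← hFs]
    exact Submodule.sub_mem _ (hs.2 i)
      (Submodule.smul_mem _ _ (Submodule.sub_mem _ (haD s hsI) (hs.2 i₀)))
  · rw [← hFs]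
    exact unitReflection_apply_right (hs.1.1 i₀) hab

/-- The unit vector in the direction of the image of `ρ`. -/
noncomputable def unitConormal {d : ℕ} (I : Set ℝ) (γ : ℝ → Euc d)
    (D : ℝ → Submodule ℝ (Euc d)) (t : ℝ) : Euc d :=
  ‖conormal I γ D t‖⁻¹ • conormal I γ D t

namespace CauchyData

theorem norm_unitConormal (h : CauchyData m I γ D) (ht : t ∈ I) :
    ‖unitConormal I γ D t‖ = 1 := by
  rw [unitConormal, norm_smul, norm_inv, norm_norm,
    inv_mul_cancel₀ (norm_ne_zero_iff.2 (h.conormal_ne_zero ht))]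

theorem smoothNear_unitConormal (h : CauchyData m I γ D) (ht : t ∈ I) :
    SmoothNear I (unitConormal I γ D) t :=
  (((h.smoothNear_conormal ht).norm ht (h.conormal_ne_zero ht)).inv ht
    (norm_ne_zero_iff.2 (h.conormal_ne_zero ht))).smul (h.smoothNear_conormal ht)

theorem unitConormal_mem (t : ℝ) : unitConormal I γ D t ∈ D t :=
  Submodule.smul_mem _ _ (conormal_mem t)

theorem unitConormal_mem_rhoImage (h : CauchyData m I γ D) (ht : t ∈ I) :
    unitConormal I γ D t ∈ rhoImage I D t :=
  Submodule.smul_mem _ _ (h.conormal_mem_rhoImage ht)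

theorem unitConormal_ne_zero (h : CauchyData m I γ D) (ht : t ∈ I) :
    unitConormal I γ D t ≠ 0 := by
  rw [← norm_ne_zero_iff, h.norm_unitConormal ht]
  exact one_ne_zero

theorem inner_unitConormal_velocity_neg (h : CauchyData m I γ D) (ht : t ∈ I) :
    inner ℝ (unitConormal I γ D t) (covDeriv I γ t) < 0 := by
  rw [unitConormal, inner_smul_left]
  exact mul_neg_of_pos_of_neg (inv_pos.2 (norm_pos_iff.2 (h.conormal_ne_zero ht)))
    (h.inner_conormal_velocity_neg ht)

theorem mem_ruling_iff_unitConormal (h : CauchyData m I γ D) (ht : t ∈ I)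
    (hr : rhoRank I D t = 1) {x : Euc d} :
    x ∈ ruling I D t ↔ x ∈ D t ∧ inner ℝ (unitConormal I γ D t) x = 0 :=
  mem_ruling_iff_inner hr (h.unitConormal_mem_rhoImage ht) (h.unitConormal_ne_zero ht)

end CauchyData

end

end DevCauchy

namespace DevCauchy

open Set Filter Topology

/-! ### Inverse function theorem, tangent spaces and charts -/

theorem exists_openPartialHomeomorph_of_injective {E : Type*} [NormedAddCommGroup E]
    [NormedSpace ℝ E] [FiniteDimensional ℝ E] {f : E → E} {U : Set E} (hU : IsOpen U)
    (hf : ContDiffOn ℝ ∞ f U) {x : E} (hx : x ∈ U) (hinj : Function.Injective (fderiv ℝ f x)) :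
    ∃ Ψ : OpenPartialHomeomorph E E, ContDiffOn ℝ ∞ Ψ Ψ.source ∧
      ContDiffOn ℝ ∞ Ψ.symm Ψ.target ∧ x ∈ Ψ.source ∧ Ψ.source ⊆ U ∧ ∀ y, Ψ y = f y := by
  let e : E ≃L[ℝ] E :=
    (LinearEquiv.ofInjectiveEndo (fderiv ℝ f x : E →ₗ[ℝ] E) hinj).toContinuousLinearEquiv
  have hfx : ContDiffAt ℝ ∞ f x := (hf x hx).contDiffAt (hU.mem_nhds hx)
  have he : HasFDerivAt f (e : E →L[ℝ] E) x := by
    have : (e : E →L[ℝ] E) = fderiv ℝ f x := by ext y; rfl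
    rw [this]
    exact (hfx.differentiableAt (by simp)).hasFDerivAt
  let Ψ₀ := hfx.toOpenPartialHomeomorph f he (by simp)
  -- The domain is cut down to the points with invertible derivative, which makes the inverse smooth
  -- on the whole target and not only at the image of `x`.
  let W : Set E := U ∩ fderiv ℝ f ⁻¹' range ((↑) : (E ≃L[ℝ] E) → E →L[ℝ] E)
  have hW : IsOpen W :=
    (hf.continuousOn_fderiv_of_isOpen hU (by simp)).isOpen_inter_preimage hU
      (ContinuousLinearEquiv.isOpen (E := E) (F := E))
  have hxW : x ∈ W := ⟨hx, e, he.fderiv.symm⟩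
  have hxs : x ∈ Ψ₀.source := hfx.mem_toOpenPartialHomeomorph_source he (by simp)
  refine ⟨Ψ₀.restrOpen W hW, ?_, ?_, ⟨hxs, hxW⟩, fun y hy => hy.2.1, fun y => rfl⟩
  · exact hf.mono fun y hy => hy.2.1
  · intro y hy
    have hy' := (Ψ₀.restrOpen W hW).map_target hy
    obtain ⟨hyU, e', he'⟩ := hy'.2
    have hd : ContDiffAt ℝ ∞ f (Ψ₀.symm y) := (hf _ hyU).contDiffAt (hU.mem_nhds hyU)
    refine ((Ψ₀.restrOpen W hW).contDiffAt_symm (f₀' := e') hy ?_ ?_).contDiffWithinAt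
    · rw [he']
      exact (hd.differentiableAt (by simp)).hasFDerivAt
    · exact hd

/-- Differentials map tangent cones into tangent cones, and the tangent cone of a single point is
zero. -/
theorem fderiv_apply_eq_zero_of_mem_tangentConeAt {E F : Type*} [NormedAddCommGroup E]
    [NormedSpace ℝ E] [NormedAddCommGroup F] [NormedSpace ℝ F] {f : E → F} {S : Set E} {p v : E}
    (hf : DifferentiableAt ℝ f p) (h0 : ∀ᶠ q in 𝓝[S] p, f q = 0) (hp : f p = 0)
    (hv : v ∈ tangentConeAt ℝ S p) : fderiv ℝ f p v = 0 := by
  obtain ⟨U, hU, hUS⟩ := mem_nhdsWithin_iff_exists_mem_nhds_inter.1 h0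
  rw [← tangentConeAt_inter_nhds hU] at hv
  have h1 := (hf.hasFDerivAt.hasFDerivWithinAt (s := S ∩ U)).mapsTo_tangent_cone hv
  have h2 : f '' (S ∩ U) ⊆ {0} := by
    rintro _ ⟨q, hq, rfl⟩
    exact hUS ⟨hq.2, hq.1⟩
  have h3 := tangentConeAt_mono (𝕜 := ℝ) (x := f p) h2 h1
  have h4 : ¬ AccPt (f p) (𝓟 ({0} : Set F)) := by
    rw [hp, accPt_iff_frequently_nhdsNE, not_frequently]
    filter_upwards [self_mem_nhdsWithin] with y hy hy'
    exact hy hy'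
  exact tangentConeAt_subset_zero h4 h3

section

variable {d m : ℕ}

/-- The coordinate plane `ℝ^m × 0`. -/
def coordPlane (d m : ℕ) : Submodule ℝ (Euc d) where
  carrier := {x | ∀ i : Fin d, m ≤ i.val → x i = 0}
  add_mem' := fun {x y} hx hy i hi => by simp [hx i hi, hy i hi]
  zero_mem' := fun i _ => by simp
  smul_mem' := fun c x hx i hi => by simp [hx i hi]

/-- The edge `{x₀ = 0}` of the half plane. -/
def coordEdge (d m : ℕ) : Submodule ℝ (Euc d) where
  carrier := {x | (∀ i : Fin d, m ≤ i.val → x i = 0) ∧ ∀ i : Fin d, i.val = 0 → x i = 0}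
  add_mem' := fun {x y} hx hy =>
    ⟨fun i hi => by simp [hx.1 i hi, hy.1 i hi], fun i hi => by simp [hx.2 i hi, hy.2 i hi]⟩
  zero_mem' := ⟨fun i _ => by simp, fun i _ => by simp⟩
  smul_mem' := fun c x hx => ⟨fun i hi => by simp [hx.1 i hi], fun i hi => by simp [hx.2 i hi]⟩

/-- The half plane `{x₀ ≥ 0}` of the coordinate plane. -/
def coordHalfPlane (d m : ℕ) : Set (Euc d) :=
  {x | (∀ i : Fin d, m ≤ i.val → x i = 0) ∧ ∀ i : Fin d, i.val = 0 → 0 ≤ x i}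

theorem tangentSpaceAt_submodule (K : Submodule ℝ (Euc d)) {x : Euc d} (hx : x ∈ K) :
    tangentSpaceAt (K : Set (Euc d)) x = K := by
  apply le_antisymm
  · unfold tangentSpaceAt
    rw [Submodule.span_le]
    intro v hv
    have h1 : ∀ y ∈ K, Kᗮ.starProjection y = 0 := fun y hy => by
      rwa [Submodule.starProjection_apply_eq_zero_iff, Submodule.orthogonal_orthogonal]
    have := fderiv_apply_eq_zero_of_mem_tangentConeAt (f := Kᗮ.starProjection)
      Kᗮ.starProjection.differentiableAt (by filter_upwards [self_mem_nhdsWithin] using h1)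
      (h1 x hx) hv
    rwa [ContinuousLinearMap.fderiv, Submodule.starProjection_apply_eq_zero_iff,
      Submodule.orthogonal_orthogonal] at this
  · intro v hv
    apply Submodule.subset_span
    have := mem_tangentConeAt_of_segment_subset (s := (K : Set (Euc d))) (x := x) (y := x + v)
      (K.convex.segment_subset hx (K.add_mem hx hv))
    simpa using this

theorem coordHalfPlane_convex : Convex ℝ (coordHalfPlane d m) := by
  intro x hx y hy a b ha hb _
  refine ⟨fun i hi => by simp [hx.1 i hi, hy.1 i hi], fun i hi => ?_⟩
  have h1 := hx.2 i hi
  have h2 := hy.2 i hi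
  simp only [PiLp.add_apply, PiLp.smul_apply, smul_eq_mul]
  positivity

theorem tangentSpaceAt_coordHalfPlane (hm : 0 < m) {x : Euc d} (hx : x ∈ coordHalfPlane d m) :
    tangentSpaceAt (coordHalfPlane d m) x = coordPlane d m := by
  apply le_antisymm
  · rw [← tangentSpaceAt_submodule (coordPlane d m) (x := x) hx.1]
    exact Submodule.span_mono (tangentConeAt_mono fun y hy => hy.1)
  · intro v hv
    -- At the edge only half of the directions belong to the tangent cone. The vector `v` is the
    -- difference of `v + c` and `c`, which both point into the half plane.
    let c : Euc d := WithLp.toLp 2 fun i => if i.val = 0 then |v i| else 0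
    have key : ∀ w ∈ coordHalfPlane d m, w ∈ tangentSpaceAt (coordHalfPlane d m) x := by
      intro w hw
      apply Submodule.subset_span
      have := mem_tangentConeAt_of_segment_subset (s := coordHalfPlane d m) (x := x) (y := x + w)
        (coordHalfPlane_convex.segment_subset hx
          ⟨fun i hi => by simp [hx.1 i hi, hw.1 i hi],
            fun i hi => add_nonneg (hx.2 i hi) (hw.2 i hi)⟩)
      simpa using this
    have h1 : c ∈ coordHalfPlane d m := by
      refine ⟨fun i hi => ?_, fun i hi => ?_⟩
      · simp only [c]
        rw [if_neg (by omega)]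
      · simp [c, hi]
    have h2 : v + c ∈ coordHalfPlane d m := by
      refine ⟨fun i hi => by simp [hv i hi, h1.1 i hi], fun i hi => ?_⟩
      simp only [c, PiLp.add_apply, hi, if_true]
      linarith [neg_abs_le (v i)]
    have := Submodule.sub_mem _ (key _ h2) (key _ h1)
    simpa using this

theorem IsSmoothChart.fderiv_symm_comp {Φ : OpenPartialHomeomorph (Euc d) (Euc d)}
    (hΦ : IsSmoothChart Φ) {p : Euc d} (hp : p ∈ Φ.source) :
    (∀ x, fderiv ℝ Φ.symm (Φ p) (fderiv ℝ Φ p x) = x) ∧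
      ∀ x, fderiv ℝ Φ p (fderiv ℝ Φ.symm (Φ p) x) = x := by
  have h1 : HasFDerivAt Φ (fderiv ℝ Φ p) p :=
    (((hΦ.1 p hp).contDiffAt (Φ.open_source.mem_nhds hp)).differentiableAt (by simp)).hasFDerivAt
  have hp' := Φ.map_source hp
  have h2 : HasFDerivAt Φ.symm (fderiv ℝ Φ.symm (Φ p)) (Φ p) :=
    (((hΦ.2 _ hp').contDiffAt (Φ.open_target.mem_nhds hp')).differentiableAt
      (by simp)).hasFDerivAt
  have h3 : HasFDerivAt (Φ.symm ∘ Φ) (ContinuousLinearMap.id ℝ (Euc d)) p :=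
    (hasFDerivAt_id p).congr_of_eventuallyEq (Φ.eventually_left_inverse hp)
  have h1' : HasFDerivAt Φ (fderiv ℝ Φ p) (Φ.symm (Φ p)) := by rwa [Φ.left_inv hp]
  have h4 : HasFDerivAt (Φ ∘ Φ.symm) (ContinuousLinearMap.id ℝ (Euc d)) (Φ p) :=
    (hasFDerivAt_id _).congr_of_eventuallyEq (Φ.eventually_right_inverse hp')
  constructor
  · intro x
    exact DFunLike.congr_fun ((h2.comp p h1).unique h3) x
  · intro x
    exact DFunLike.congr_fun ((h1'.comp (Φ p) h2).unique h4) x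

theorem IsSmoothChart.symm {Φ : OpenPartialHomeomorph (Euc d) (Euc d)} (hΦ : IsSmoothChart Φ) :
    IsSmoothChart Φ.symm := ⟨hΦ.2, hΦ.1⟩

theorem IsSmoothChart.differentiableAt {Φ : OpenPartialHomeomorph (Euc d) (Euc d)}
    (hΦ : IsSmoothChart Φ) {p : Euc d} (hp : p ∈ Φ.source) : DifferentiableAt ℝ Φ p :=
  ((hΦ.1 p hp).contDiffAt (Φ.open_source.mem_nhds hp)).differentiableAt (by simp)

theorem IsSmoothChart.restrOpen {Φ : OpenPartialHomeomorph (Euc d) (Euc d)}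
    (hΦ : IsSmoothChart Φ) {W : Set (Euc d)} (hW : IsOpen W) :
    IsSmoothChart (Φ.restrOpen W hW) := by
  refine ⟨hΦ.1.mono fun q hq => hq.1, hΦ.2.mono fun q hq => ?_⟩
  rw [OpenPartialHomeomorph.restrOpen_toPartialEquiv] at hq
  exact hq.1

theorem IsSmoothChart.mapsTo_tangentConeAt {Φ : OpenPartialHomeomorph (Euc d) (Euc d)}
    (hΦ : IsSmoothChart Φ) {p : Euc d} (hp : p ∈ Φ.source) {S Q : Set (Euc d)}
    (hSQ : ∀ q ∈ Φ.source, q ∈ S → Φ q ∈ Q) {v : Euc d} (hv : v ∈ tangentConeAt ℝ S p) :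
    fderiv ℝ Φ p v ∈ tangentConeAt ℝ Q (Φ p) := by
  rw [← tangentConeAt_inter_nhds (Φ.open_source.mem_nhds hp)] at hv
  have h1 := ((hΦ.differentiableAt hp).hasFDerivAt.hasFDerivWithinAt
    (s := S ∩ Φ.source)).mapsTo_tangent_cone hv
  refine tangentConeAt_mono ?_ h1
  rintro _ ⟨q, hq, rfl⟩
  exact hSQ q hq.2 hq.1

/-- Tangent spaces are computed in charts. -/
theorem IsSmoothChart.tangentSpaceAt_eq {Φ : OpenPartialHomeomorph (Euc d) (Euc d)}
    (hΦ : IsSmoothChart Φ) {p : Euc d} (hp : p ∈ Φ.source) {S Q : Set (Euc d)}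
    (hSQ : ∀ q ∈ Φ.source, q ∈ S ↔ Φ q ∈ Q) :
    tangentSpaceAt S p =
      (tangentSpaceAt Q (Φ p)).map (fderiv ℝ Φ.symm (Φ p) : Euc d →ₗ[ℝ] Euc d) := by
  obtain ⟨h1, h2⟩ := hΦ.fderiv_symm_comp hp
  unfold tangentSpaceAt
  rw [Submodule.map_span]
  apply le_antisymm
  · apply Submodule.span_mono
    intro v hv
    exact ⟨_, hΦ.mapsTo_tangentConeAt hp (fun q hq => (hSQ q hq).1) hv, h1 v⟩
  · apply Submodule.span_mono
    rintro _ ⟨v, hv, rfl⟩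
    have h3 := hΦ.symm.mapsTo_tangentConeAt (p := Φ p) (Φ.map_source hp) (S := Q) (Q := S)
      (fun q hq hqQ => by
        have hq' := Φ.map_target hq
        rw [hSQ _ hq']
        have : Φ (Φ.symm q) = q := Φ.right_inv hq
        rwa [this]) hv
    rwa [Φ.left_inv hp] at h3

/-- An interior point is not a boundary point. -/
theorem IsInteriorPoint.not_isBoundaryPoint (hm : 0 < m) (hmd : m ≤ d) {M : Set (Euc d)}
    {p : Euc d} (hi : IsInteriorPoint m M p) : ¬ IsBoundaryPoint m M p := by
  rintro ⟨hpM, Φ, hΦ, hp, hp0, hΦM⟩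
  obtain ⟨-, Φ', hΦ', hp', hΦM'⟩ := hi
  let i₀ : Fin d := ⟨0, by omega⟩
  have hT : tangentSpaceAt M p =
      (coordPlane d m).map (fderiv ℝ Φ.symm (Φ p) : Euc d →ₗ[ℝ] Euc d) := by
    rw [hΦ.tangentSpaceAt_eq hp (Q := coordHalfPlane d m) hΦM,
      tangentSpaceAt_coordHalfPlane hm ((hΦM p hp).1 hpM)]
  have hT' : tangentSpaceAt M p =
      (coordPlane d m).map (fderiv ℝ Φ'.symm (Φ' p) : Euc d →ₗ[ℝ] Euc d) := by
    rw [hΦ'.tangentSpaceAt_eq hp' (Q := coordPlane d m) hΦM',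
      tangentSpaceAt_submodule (coordPlane d m) ((hΦM' p hp').1 hpM)]
  -- A tangent vector whose first coordinate in the boundary chart is one. The interior chart yields
  -- a two-sided curve in `M` with this velocity, and on it the first coordinate has a minimum at
  -- `p`: a contradiction.
  obtain ⟨v, hv, hv0⟩ : ∃ v ∈ tangentSpaceAt M p, fderiv ℝ Φ p v i₀ = 1 := by
    refine ⟨fderiv ℝ Φ.symm (Φ p) (EuclideanSpace.single i₀ 1), ?_, ?_⟩
    · rw [hT]
      refine ⟨_, fun i hi => ?_, rfl⟩
      have : i ≠ i₀ := by rintro rfl; simp only [i₀] at hi; omega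
      simp [this]
    · rw [(hΦ.fderiv_symm_comp hp).2]
      simp
  rw [hT'] at hv
  obtain ⟨u, hu, rfl⟩ := hv
  have hp't := Φ'.map_source hp'
  have hline : HasDerivAt (fun s : ℝ => Φ' p + s • u) u 0 := by
    simpa using ((hasDerivAt_id (0 : ℝ)).smul_const u).const_add (Φ' p)
  have hc : HasDerivAt (fun s : ℝ => Φ'.symm (Φ' p + s • u)) (fderiv ℝ Φ'.symm (Φ' p) u) 0 := by
    have h1 : HasFDerivAt Φ'.symm (fderiv ℝ Φ'.symm (Φ' p)) (Φ' p + (0 : ℝ) • u) := by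
      rw [zero_smul, add_zero]
      exact (hΦ'.symm.differentiableAt hp't).hasFDerivAt
    exact h1.comp_hasDerivAt (0 : ℝ) hline
  have hc0 : Φ'.symm (Φ' p + (0 : ℝ) • u) = p := by
    rw [zero_smul, add_zero, Φ'.left_inv hp']
  have hh : HasDerivAt (fun s : ℝ => Φ (Φ'.symm (Φ' p + s • u)))
      (fderiv ℝ Φ p (fderiv ℝ Φ'.symm (Φ' p) u)) 0 := by
    have h1 : HasFDerivAt Φ (fderiv ℝ Φ p) (Φ'.symm (Φ' p + (0 : ℝ) • u)) := by
      rw [hc0]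
      exact (hΦ.differentiableAt hp).hasFDerivAt
    exact h1.comp_hasDerivAt (0 : ℝ) hc
  have hh0 := (EuclideanSpace.proj (𝕜 := ℝ) i₀).hasFDerivAt.comp_hasDerivAt (0 : ℝ) hh
  have hmin : IsLocalMin (EuclideanSpace.proj (𝕜 := ℝ) i₀ ∘
      fun s : ℝ => Φ (Φ'.symm (Φ' p + s • u))) 0 := by
    have e1 : ∀ᶠ s in 𝓝 (0 : ℝ), Φ' p + s • u ∈ Φ'.target := by
      apply hline.continuousAt.eventually_mem
      simpa using Φ'.open_target.mem_nhds hp't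
    have e2 : ∀ᶠ s in 𝓝 (0 : ℝ), Φ'.symm (Φ' p + s • u) ∈ Φ.source := by
      apply hc.continuousAt.eventually_mem
      rw [hc0]
      exact Φ.open_source.mem_nhds hp
    filter_upwards [e1, e2] with s hs1 hs2
    simp only [Function.comp_apply, hc0]
    change Φ p i₀ ≤ Φ (Φ'.symm (Φ' p + s • u)) i₀
    rw [hp0 i₀ rfl]
    refine ((hΦM _ hs2).1 ?_).2 i₀ rfl
    rw [hΦM' _ (Φ'.map_target hs1), Φ'.right_inv hs1]
    exact (coordPlane d m).add_mem ((hΦM' p hp').1 hpM) ((coordPlane d m).smul_mem s hu)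
  have : fderiv ℝ Φ p (fderiv ℝ Φ'.symm (Φ' p) u) i₀ = 0 := hmin.hasDerivAt_eq_zero hh0
  rw [ContinuousLinearMap.coe_coe, this] at hv0
  exact zero_ne_one hv0

/-- A boundary chart is also a chart of the boundary. -/
theorem mem_bdry_iff_of_chart (hm : 0 < m) (hmd : m ≤ d) {M : Set (Euc d)}
    {Φ : OpenPartialHomeomorph (Euc d) (Euc d)} (hΦ : IsSmoothChart Φ)
    (hΦM : ∀ q ∈ Φ.source, q ∈ M ↔ Φ q ∈ coordHalfPlane d m) {q : Euc d} (hq : q ∈ Φ.source) :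
    q ∈ bdry m M ↔ Φ q ∈ coordEdge d m := by
  let i₀ : Fin d := ⟨0, by omega⟩
  constructor
  · intro hqb
    have hqM := (hΦM q hq).1 hqb.1
    refine ⟨hqM.1, fun i hi => ?_⟩
    obtain rfl : i = i₀ := Fin.ext hi
    by_contra hne
    have hpos : 0 < Φ q i₀ := lt_of_le_of_ne (hqM.2 i₀ rfl) (Ne.symm hne)
    -- Where the first coordinate is positive the half plane agrees locally with the plane, so that
    -- `q` would also be an interior point.
    let W : Set (Euc d) := Φ.source ∩ Φ ⁻¹' {x | 0 < x i₀}
    have hW : IsOpen W := Φ.isOpen_inter_preimage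
      (isOpen_lt continuous_const (EuclideanSpace.proj (𝕜 := ℝ) i₀).continuous)
    refine IsInteriorPoint.not_isBoundaryPoint hm hmd
      ⟨hqb.1, Φ.restrOpen W hW, hΦ.restrOpen hW, ⟨hq, hq, hpos⟩, fun q' hq' => ?_⟩ hqb
    change q' ∈ M ↔ ∀ i : Fin d, m ≤ i.val → Φ q' i = 0
    rw [hΦM q' hq'.1]
    refine ⟨fun h => h.1, fun h => ⟨h, fun i hi => ?_⟩⟩
    obtain rfl : i = i₀ := Fin.ext hi
    exact hq'.2.2.le
  · intro h
    exact ⟨(hΦM q hq).2 ⟨h.1, fun i hi => (h.2 i hi).ge⟩, Φ, hΦ, hq, h.2, hΦM⟩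

/-- Nullity is tested against tangent fields defined on the whole space. A cut-off provides one with
a prescribed germ. -/
theorem exists_tangentField {M V : Set (Euc d)} (hV : IsOpen V) {Y₀ : Euc d → Euc d}
    (hY₀ : ContDiffOn ℝ ∞ Y₀ V) (hM : ∀ q ∈ M ∩ V, Y₀ q ∈ tangentSpaceAt M q) {p : Euc d}
    (hp : p ∈ V) : ∃ Y, IsTangentField M Y ∧ Y =ᶠ[𝓝 p] Y₀ := by
  obtain ⟨Y, hY, hYp, hc, h0⟩ := exists_contDiff_eventuallyEq hV hY₀ hp
  refine ⟨Y, ⟨hY, fun q hq => ?_⟩, hYp⟩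
  by_cases hqV : q ∈ V
  · obtain ⟨c, hc⟩ := hc q
    rw [hc]
    exact Submodule.smul_mem _ _ (hM q ⟨hq, hqV⟩)
  · rw [h0 q hqV]
    exact zero_mem _

end

end DevCauchy

namespace DevCauchy

open Set Filter Topology

/-! ### Graph representation of a submanifold -/

/-- Near `p`, the set `M` consists of fixed points of the smooth map `G`, which factors through
the orthogonal projection onto `T` and is a section of it: `M` lies in a graph over `T`. -/
structure IsGraphAt {d : ℕ} (M : Set (Euc d)) (T : Submodule ℝ (Euc d)) (G : Euc d → Euc d)
    (B V : Set (Euc d)) (p : Euc d) : Prop where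
  isOpen_domain : IsOpen B
  isOpen_nhd : IsOpen V
  mem : p ∈ M
  mem_nhd : p ∈ V
  nhd_subset : V ⊆ B
  smooth : ContDiffOn ℝ ∞ G B
  saturated : ∀ y ∈ B, ∀ z, T.starProjection z = T.starProjection y → z ∈ B ∧ G z = G y
  proj : ∀ y ∈ B, T.starProjection (G y) = T.starProjection y
  fix : ∀ q ∈ M ∩ V, G q = q
  tangent : ∀ y ∈ B, G y ∈ M →
    tangentSpaceAt M (G y) = LinearMap.range (fderiv ℝ G y : Euc d →ₗ[ℝ] Euc d)

variable {d m : ℕ}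

theorem finrank_map_of_injective (f : Euc d →ₗ[ℝ] Euc d) (hf : Function.Injective f)
    (K : Submodule ℝ (Euc d)) : Module.finrank ℝ (K.map f) = Module.finrank ℝ K :=
  (Submodule.equivMapOfInjective f hf K).finrank_eq.symm

theorem two_le_smooth : minSmoothness ℝ 2 ≤ (∞ : WithTop ℕ∞) := by
  rw [minSmoothness_of_isRCLikeNormedField]
  exact WithTop.coe_le_coe.2 le_top

theorem hasFDerivAt_apply_const {E F H : Type*} [NormedAddCommGroup E] [NormedSpace ℝ E]
    [NormedAddCommGroup F] [NormedSpace ℝ F] [NormedAddCommGroup H] [NormedSpace ℝ H]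
    {L : H → E →L[ℝ] F} {L' : H →L[ℝ] E →L[ℝ] F} {y : H} (h : HasFDerivAt L L' y) (v : E) :
    HasFDerivAt (fun y => L y v) (L'.flip v) y :=
  (ContinuousLinearMap.apply ℝ F v).hasFDerivAt.comp y h

/-- `G y` is the point over the projection of `y` to the tangent space whose chart image lies in the
coordinate plane. The set `Q` is the plane or the half plane; in the latter case `M` fills only part
of the graph. -/
theorem exists_isGraphAt {M : Set (Euc d)} {p : Euc d} (hpM : p ∈ M)
    {Φ : OpenPartialHomeomorph (Euc d) (Euc d)} (hΦ : IsSmoothChart Φ) (hp : p ∈ Φ.source)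
    {Q : Set (Euc d)} (hQ : ∀ x ∈ Q, x ∈ coordPlane d m ∧ tangentSpaceAt Q x = coordPlane d m)
    (hM : ∀ q ∈ Φ.source, q ∈ M ↔ Φ q ∈ Q) :
    ∃ G B V, IsGraphAt M (tangentSpaceAt M p) G B V p ∧ V ⊆ Φ.source ∧
      ∀ y ∈ B, G y ∈ Φ.source ∧ Φ (G y) ∈ coordPlane d m := by
  have htan : ∀ q ∈ Φ.source, q ∈ M → tangentSpaceAt M q =
      (coordPlane d m).map (fderiv ℝ Φ.symm (Φ q) : Euc d →ₗ[ℝ] Euc d) := fun q hq hqM => by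
    rw [hΦ.tangentSpaceAt_eq hq hM, (hQ _ ((hM q hq).1 hqM)).2]
  have hinj : ∀ q ∈ Φ.source, Function.Injective (fderiv ℝ Φ.symm (Φ q)) := fun q hq =>
    Function.LeftInverse.injective (hΦ.fderiv_symm_comp hq).2
  set T := tangentSpaceAt M p with hT
  set N := (coordPlane d m)ᗮ.starProjection with hN
  have hN0 : ∀ x, N x = 0 ↔ x ∈ coordPlane d m := fun x => by
    rw [hN, Submodule.starProjection_apply_eq_zero_iff, Submodule.orthogonal_orthogonal]
  have hNN : ∀ x, N (N x) = N x := fun x =>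
    Submodule.starProjection_eq_self_iff.2 (Submodule.starProjection_apply_mem _ _)
  set b := fderiv ℝ Φ.symm (Φ p) with hb
  have hTb : ∀ x, x ∈ T ↔ ∃ u ∈ coordPlane d m, b u = x := fun x => by
    rw [hT, htan p hp hpM]; exact Submodule.mem_map
  -- On the preimage of the coordinate plane `Θ` is the projection to `T`. The second term adds the
  -- normal chart coordinates, carried back by `b`, and turns `Θ` into a local diffeomorphism.
  let Θ : Euc d → Euc d := fun q => T.starProjection q + b (N (Φ q))
  have hΘ : ContDiffOn ℝ ∞ Θ Φ.source :=
    T.starProjection.contDiff.contDiffOn.add (b.contDiff.comp_contDiffOn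
      (N.contDiff.comp_contDiffOn hΦ.1))
  have hDΘ : ∀ x, fderiv ℝ Θ p x = T.starProjection x + b (N (fderiv ℝ Φ p x)) := by
    have h1 := (hΦ.differentiableAt hp).hasFDerivAt
    have h2 := T.starProjection.hasFDerivAt (x := p) |>.add
      (b.hasFDerivAt.comp p (N.hasFDerivAt.comp p h1))
    intro x
    exact DFunLike.congr_fun (HasFDerivAt.fderiv h2) x
  have hDinj : Function.Injective (fderiv ℝ Θ p) := by
    rw [injective_iff_map_eq_zero]
    intro x hx
    rw [hDΘ] at hx
    obtain ⟨h1, h2⟩ := hΦ.fderiv_symm_comp hp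
    -- Applying `N ∘ dΦ` isolates the normal term: `dΦ` maps `T` to the coordinate plane and inverts
    -- `b`.
    have h3 : N (fderiv ℝ Φ p (T.starProjection x)) = 0 := by
      obtain ⟨u, hu, hux⟩ := (hTb _).1 (Submodule.starProjection_apply_mem T x)
      rw [← hux, hb, h2, hN0]
      exact hu
    have h4 : N (fderiv ℝ Φ p x) = 0 := by
      have := congrArg (fun v => N (fderiv ℝ Φ p v)) hx
      simp only [map_add, map_zero, h3, zero_add] at this
      rwa [hb, h2, hNN] at this
    have h5 : x ∈ T := (hTb x).2 ⟨fderiv ℝ Φ p x, (hN0 _).1 h4, h1 x⟩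
    rw [h4, map_zero, add_zero, Submodule.starProjection_eq_self_iff.2 h5] at hx
    exact hx
  obtain ⟨Ψ, -, hΨs, hpΨ, hΨsub, hΨ⟩ :=
    exists_openPartialHomeomorph_of_injective Φ.open_source hΘ hp hDinj
  let B : Set (Euc d) := T.starProjection ⁻¹' Ψ.target
  let G : Euc d → Euc d := fun y => Ψ.symm (T.starProjection y)
  have hBo : IsOpen B := Ψ.open_target.preimage T.starProjection.continuous
  have hGs : ∀ y ∈ B, G y ∈ Ψ.source := fun y hy => Ψ.map_target hy
  have hΘM : ∀ q ∈ Ψ.source, q ∈ M → Ψ q = T.starProjection q := fun q hq hqM => by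
    have : N (Φ q) = 0 := (hN0 _).2 (hQ _ ((hM q (hΨsub hq)).1 hqM)).1
    rw [hΨ]
    simp only [Θ]
    rw [this, map_zero, add_zero]
  -- From `Θ (G y) = P_T y` the normal term lies in `T`, the image of the coordinate plane under the
  -- injective map `b`. Its coordinates are then both in the plane and orthogonal to it.
  have hGeq : ∀ y ∈ B, N (Φ (G y)) = 0 ∧ T.starProjection (G y) = T.starProjection y := by
    intro y hy
    have h1 : T.starProjection (G y) + b (N (Φ (G y))) = T.starProjection y := by
      rw [← Ψ.right_inv (x := T.starProjection y) hy, hΨ]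
    have h2 : b (N (Φ (G y))) ∈ T := by
      rw [← eq_sub_iff_add_eq'] at h1
      rw [h1]
      exact Submodule.sub_mem _ (Submodule.starProjection_apply_mem _ _)
        (Submodule.starProjection_apply_mem _ _)
    obtain ⟨u, hu, hub⟩ := (hTb _).1 h2
    have h3 := hinj p hp hub
    have h4 : N (Φ (G y)) = 0 := by
      rw [← hNN, hN0, ← h3]
      exact hu
    exact ⟨h4, by rwa [h4, map_zero, add_zero] at h1⟩
  have hsm : ContDiffOn ℝ ∞ G B :=
    hΨs.comp T.starProjection.contDiff.contDiffOn fun y hy => hy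
  have hG : IsGraphAt M T G B (Ψ.source ∩ B) p := by
    refine ⟨hBo, Ψ.open_source.inter hBo, hpM, ⟨hpΨ, ?_⟩, fun q hq => hq.2, hsm, ?_, 
      fun y hy => (hGeq y hy).2, ?_, ?_⟩
    · change T.starProjection p ∈ Ψ.target
      rw [← hΘM p hpΨ hpM]
      exact Ψ.map_source hpΨ
    · intro y hy z hz
      refine ⟨?_, ?_⟩
      · change T.starProjection z ∈ Ψ.target
        rw [hz]; exact hy
      · simp only [G, hz]
    · rintro q ⟨hqM, hq, -⟩
      simp only [G]
      rw [← hΘM q hq hqM, Ψ.left_inv hq]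
    · intro y hy hyM
      rw [htan _ (hΨsub (hGs y hy)) hyM]
      symm
      have hGd : HasFDerivAt G (fderiv ℝ G y) y :=
        (((hsm y hy).contDiffAt (hBo.mem_nhds hy)).differentiableAt (by simp)).hasFDerivAt
      have hd : HasFDerivAt (fun y => N (Φ (G y)))
          (N ∘L (fderiv ℝ Φ (G y)) ∘L (fderiv ℝ G y)) y :=
        N.hasFDerivAt.comp y
          (((hΦ.differentiableAt (hΨsub (hGs y hy))).hasFDerivAt).comp y hGd)
      have h0 : (fun y => N (Φ (G y))) =ᶠ[𝓝 y] fun _ => 0 := by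
        filter_upwards [hBo.mem_nhds hy] with z hz using (hGeq z hz).1
      have h1 := hd.unique ((hasFDerivAt_const (0 : Euc d) y).congr_of_eventuallyEq h0)
      have hp1 : HasFDerivAt (fun y => T.starProjection (G y))
          (T.starProjection ∘L fderiv ℝ G y) y := T.starProjection.hasFDerivAt.comp y hGd
      have hp0 : (fun y => T.starProjection (G y)) =ᶠ[𝓝 y] T.starProjection := by
        filter_upwards [hBo.mem_nhds hy] with z hz using (hGeq z hz).2
      have h2 := hp1.unique (T.starProjection.hasFDerivAt.congr_of_eventuallyEq hp0)
      apply Submodule.eq_of_le_of_finrank_le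
      · rintro _ ⟨x, rfl⟩
        have := DFunLike.congr_fun h1 x
        simp only [ContinuousLinearMap.comp_apply, zero_apply] at this
        exact ⟨_, (hN0 _).1 this, (hΦ.fderiv_symm_comp (hΨsub (hGs y hy))).1 _⟩
      · have e1 : Module.finrank ℝ ((coordPlane d m).map
            (fderiv ℝ Φ.symm (Φ (G y)) : Euc d →ₗ[ℝ] Euc d)) = Module.finrank ℝ T := by
          rw [hT, htan p hp hpM,
            finrank_map_of_injective _ (hinj _ (hΨsub (hGs y hy))),
            finrank_map_of_injective _ (hinj _ hp)]
        rw [e1]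
        -- The image of `dG` projects onto `T`, which bounds its dimension from below.
        have h3 : T ≤ (LinearMap.range (fderiv ℝ G y : Euc d →ₗ[ℝ] Euc d)).map
            (T.starProjection : Euc d →ₗ[ℝ] Euc d) := by
          intro x hx
          refine ⟨fderiv ℝ G y x, ⟨x, rfl⟩, ?_⟩
          have := DFunLike.congr_fun h2 x
          rw [Submodule.starProjection_eq_self_iff.2 hx] at this
          exact this
        exact (Submodule.finrank_mono h3).trans (Submodule.finrank_map_le _ _)
  exact ⟨G, B, _, hG, fun q hq => hΨsub hq.1, fun y hy =>
    ⟨hΨsub (hGs y hy), (hN0 _).1 (hGeq y hy).1⟩⟩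

namespace IsGraphAt

variable {M : Set (Euc d)} {T : Submodule ℝ (Euc d)} {G : Euc d → Euc d} {B V : Set (Euc d)}
  {p : Euc d}

theorem contDiffAt (h : IsGraphAt M T G B V p) {y : Euc d} (hy : y ∈ B) :
    ContDiffAt ℝ ∞ G y := (h.smooth y hy).contDiffAt (h.isOpen_domain.mem_nhds hy)

theorem hasFDerivAt (h : IsGraphAt M T G B V p) {y : Euc d} (hy : y ∈ B) :
    HasFDerivAt G (fderiv ℝ G y) y :=
  ((h.contDiffAt hy).differentiableAt (by simp)).hasFDerivAt

theorem contDiffOn_fderiv (h : IsGraphAt M T G B V p) : ContDiffOn ℝ ∞ (fderiv ℝ G) B :=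
  h.smooth.fderiv_of_isOpen h.isOpen_domain (by simp)

theorem hasFDerivAt_fderiv (h : IsGraphAt M T G B V p) {y : Euc d} (hy : y ∈ B) :
    HasFDerivAt (fderiv ℝ G) (fderiv ℝ (fderiv ℝ G) y) y :=
  (((h.contDiffOn_fderiv y hy).contDiffAt (h.isOpen_domain.mem_nhds hy)).differentiableAt
    (by simp)).hasFDerivAt

theorem fderiv_fderiv_comm (h : IsGraphAt M T G B V p) {y : Euc d} (hy : y ∈ B) (u v : Euc d) :
    fderiv ℝ (fderiv ℝ G) y u v = fderiv ℝ (fderiv ℝ G) y v u :=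
  (h.contDiffAt hy).isSymmSndFDerivAt two_le_smooth u v

theorem proj_fderiv (h : IsGraphAt M T G B V p) {y : Euc d} (hy : y ∈ B) (v : Euc d) :
    T.starProjection (fderiv ℝ G y v) = T.starProjection v := by
  have hp1 : HasFDerivAt (fun y => T.starProjection (G y))
      (T.starProjection ∘L fderiv ℝ G y) y := T.starProjection.hasFDerivAt.comp y (h.hasFDerivAt hy)
  have hp0 : (fun y => T.starProjection (G y)) =ᶠ[𝓝 y] T.starProjection := by
    filter_upwards [h.isOpen_domain.mem_nhds hy] with z hz using h.proj z hz
  exact DFunLike.congr_fun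
    (hp1.unique (T.starProjection.hasFDerivAt.congr_of_eventuallyEq hp0)) v

/-- `G` is constant on the fibres of the projection, hence so are its derivatives. This relates them
at `y` to those at the point `G y` of the graph. -/
theorem fderiv_translate (h : IsGraphAt M T G B V p) {y z : Euc d} (hy : y ∈ B)
    (hz : T.starProjection z = T.starProjection y) : fderiv ℝ G z = fderiv ℝ G y := by
  have h1 : (fun x => G (x + (y - z))) =ᶠ[𝓝 z] G := by
    filter_upwards [h.isOpen_domain.mem_nhds (h.saturated y hy z hz).1] with x hx
    refine (h.saturated x hx _ ?_).2
    rw [map_add, map_sub, hz, sub_self, add_zero]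
  rw [← h1.fderiv_eq, fderiv_comp_add_right, add_sub_cancel]

theorem fderiv_fderiv_translate (h : IsGraphAt M T G B V p) {y z : Euc d} (hy : y ∈ B)
    (hz : T.starProjection z = T.starProjection y) :
    fderiv ℝ (fderiv ℝ G) z = fderiv ℝ (fderiv ℝ G) y := by
  have h1 : (fun x => fderiv ℝ G (x + (y - z))) =ᶠ[𝓝 z] fderiv ℝ G := by
    filter_upwards [h.isOpen_domain.mem_nhds (h.saturated y hy z hz).1] with x hx
    refine h.fderiv_translate hx ?_
    rw [map_add, map_sub, hz, sub_self, add_zero]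
  rw [← h1.fderiv_eq, fderiv_comp_add_right, add_sub_cancel]

theorem fderiv_apply_eq_zero (h : IsGraphAt M T G B V p) {y z : Euc d} (hy : y ∈ B)
    (hz : T.starProjection z = 0) : fderiv ℝ G y z = 0 := by
  have h1 : HasDerivAt (fun s : ℝ => G (y + s • z)) (fderiv ℝ G y z) 0 := by
    have h2 : HasDerivAt (fun s : ℝ => y + s • z) z 0 := by
      simpa using ((hasDerivAt_id (0 : ℝ)).smul_const z).const_add y
    have h3 : HasFDerivAt G (fderiv ℝ G y) (y + (0 : ℝ) • z) := by
      simpa using h.hasFDerivAt hy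
    exact h3.comp_hasDerivAt (0 : ℝ) h2
  have h2 : (fun s : ℝ => G (y + s • z)) = fun _ => G y := by
    ext1 s
    exact (h.saturated y hy _ (by rw [map_add, map_smul, hz, smul_zero, add_zero])).2
  rw [h2] at h1
  exact h1.unique (hasDerivAt_const _ _)

theorem fderiv_fderiv_apply_eq_zero (h : IsGraphAt M T G B V p) {y z : Euc d} (hy : y ∈ B)
    (hz : T.starProjection z = 0) (v : Euc d) : fderiv ℝ (fderiv ℝ G) y v z = 0 := by
  have h1 : HasFDerivAt (fun y => fderiv ℝ G y z)
      ((fderiv ℝ (fderiv ℝ G) y).flip z) y := hasFDerivAt_apply_const (h.hasFDerivAt_fderiv hy) z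
  have h0 : (fun y => fderiv ℝ G y z) =ᶠ[𝓝 y] fun _ => 0 := by
    filter_upwards [h.isOpen_domain.mem_nhds hy] with x hx using h.fderiv_apply_eq_zero hx hz
  exact DFunLike.congr_fun
    (h1.unique ((hasFDerivAt_const (0 : Euc d) y).congr_of_eventuallyEq h0)) v

theorem proj_fderiv_fderiv (h : IsGraphAt M T G B V p) {y : Euc d} (hy : y ∈ B)
    (u v : Euc d) : T.starProjection (fderiv ℝ (fderiv ℝ G) y u v) = 0 := by
  have h1 : HasFDerivAt (fun y => T.starProjection (fderiv ℝ G y v))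
      (T.starProjection ∘L (fderiv ℝ (fderiv ℝ G) y).flip v) y :=
    T.starProjection.hasFDerivAt.comp y (hasFDerivAt_apply_const (h.hasFDerivAt_fderiv hy) v)
  have h0 : (fun y => T.starProjection (fderiv ℝ G y v)) =ᶠ[𝓝 y]
      fun _ => T.starProjection v := by
    filter_upwards [h.isOpen_domain.mem_nhds hy] with x hx using h.proj_fderiv hx v
  exact DFunLike.congr_fun
    (h1.unique ((hasFDerivAt_const _ y).congr_of_eventuallyEq h0)) u

theorem tangentSpaceAt_eq (h : IsGraphAt M T G B V p) {q : Euc d} (hq : q ∈ M ∩ V) :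
    tangentSpaceAt M q = LinearMap.range (fderiv ℝ G q : Euc d →ₗ[ℝ] Euc d) := by
  have h1 := h.tangent q (h.nhd_subset hq.2)
  rw [h.fix q hq] at h1
  exact h1 hq.1

/-- A tangent vector is of the form `dG u`, and `dG u - u` is vertical, hence killed by `dG`: the
differential is idempotent with image the tangent space. -/
theorem fderiv_apply_of_mem (h : IsGraphAt M T G B V p) {q x : Euc d} (hq : q ∈ M ∩ V)
    (hx : x ∈ tangentSpaceAt M q) : fderiv ℝ G q x = x := by
  rw [h.tangentSpaceAt_eq hq] at hx
  obtain ⟨u, rfl⟩ := hx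
  have hB := h.nhd_subset hq.2
  change fderiv ℝ G q (fderiv ℝ G q u) = fderiv ℝ G q u
  rw [← sub_eq_zero, ← map_sub]
  apply h.fderiv_apply_eq_zero hB
  rw [map_sub, h.proj_fderiv hB, sub_self]

/-- Directions of nullity annihilate the Hessian. -/
theorem fderiv_fderiv_eq_zero_of_mem_nullity (h : IsGraphAt M T G B V p) {q x : Euc d}
    (hq : q ∈ M ∩ V) (hx : x ∈ nullitySpace M q) (v : Euc d) :
    fderiv ℝ (fderiv ℝ G) q x v = 0 := by
  have hB := h.nhd_subset hq.2
  -- The fields `dG(·) v` are tangent. Nullity makes their derivative along `x` tangent as well,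
  -- whereas its projection to `T` is zero; a graph has no nonzero vertical tangent vector.
  obtain ⟨Y, hY, hYq⟩ := exists_tangentField (M := M) (Y₀ := fun y => fderiv ℝ G y v)
    h.isOpen_nhd ((h.contDiffOn_fderiv.mono h.nhd_subset).clm_apply contDiffOn_const)
    (fun q' hq' => by rw [h.tangentSpaceAt_eq hq']; exact ⟨v, rfl⟩) hq.2
  have h1 := hx.2 Y hY
  rw [secondFundamentalForm, hYq.fderiv_eq, Submodule.starProjection_apply_eq_zero_iff,
    Submodule.orthogonal_orthogonal] at h1
  have h2 : fderiv ℝ (fun y => fderiv ℝ G y v) q x = fderiv ℝ (fderiv ℝ G) q x v :=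
    DFunLike.congr_fun (hasFDerivAt_apply_const (h.hasFDerivAt_fderiv hB) v).fderiv x
  rw [h2] at h1
  rw [← h.fderiv_apply_of_mem hq h1]
  exact h.fderiv_apply_eq_zero hB (h.proj_fderiv_fderiv hB x v)

end IsGraphAt

end DevCauchy

namespace DevCauchy

open Set Filter Topology

/-! ### Functions whose Hessian has rank one -/

/-- On the set `R`, contained in the closure of its interior, the Hessian of the smooth function
`F` has rank one, and `e` is not in its kernel. -/
structure HessianRankOne {E : Type*} [NormedAddCommGroup E] [NormedSpace ℝ E]
    (F : E → ℝ) (e : E) (B R : Set E) : Prop where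
  isOpen : IsOpen B
  smooth : ContDiffOn ℝ ∞ F B
  subset : R ⊆ B
  subset_closure : R ⊆ closure (interior R)
  ne_zero : ∀ y ∈ B, fderiv ℝ (fderiv ℝ F) y e e ≠ 0
  rank_one : ∀ y ∈ R, ∀ v, ∃ b : ℝ, ∀ w, fderiv ℝ (fderiv ℝ F) y (v + b • e) w = 0

/-- The slope `β` for which `v + β e` is in the kernel of the Hessian. -/
noncomputable def kernelSlope {E : Type*} [NormedAddCommGroup E] [NormedSpace ℝ E]
    (F : E → ℝ) (e v y : E) : ℝ :=
  - fderiv ℝ (fderiv ℝ F) y e v / fderiv ℝ (fderiv ℝ F) y e e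

namespace HessianRankOne

set_option maxSynthPendingDepth 3

variable {E : Type*} [NormedAddCommGroup E] [NormedSpace ℝ E] {F : E → ℝ} {e : E} {B R : Set E}

theorem contDiffOn_fderiv (h : HessianRankOne F e B R) : ContDiffOn ℝ ∞ (fderiv ℝ F) B :=
  h.smooth.fderiv_of_isOpen h.isOpen (by simp)

theorem contDiffOn_hessian (h : HessianRankOne F e B R) :
    ContDiffOn ℝ ∞ (fderiv ℝ (fderiv ℝ F)) B :=
  h.contDiffOn_fderiv.fderiv_of_isOpen h.isOpen (by simp)

theorem contDiffOn_third (h : HessianRankOne F e B R) :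
    ContDiffOn ℝ ∞ (fderiv ℝ (fderiv ℝ (fderiv ℝ F))) B :=
  h.contDiffOn_hessian.fderiv_of_isOpen h.isOpen (by simp)

theorem hasFDerivAt_hessian (h : HessianRankOne F e B R) {y : E} (hy : y ∈ B) :
    HasFDerivAt (fderiv ℝ (fderiv ℝ F)) (fderiv ℝ (fderiv ℝ (fderiv ℝ F)) y) y :=
  (((h.contDiffOn_hessian y hy).contDiffAt (h.isOpen.mem_nhds hy)).differentiableAt
    (by simp)).hasFDerivAt

theorem hessian_comm (h : HessianRankOne F e B R) {y : E} (hy : y ∈ B) (u v : E) :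
    fderiv ℝ (fderiv ℝ F) y u v = fderiv ℝ (fderiv ℝ F) y v u :=
  ((h.smooth y hy).contDiffAt (h.isOpen.mem_nhds hy)).isSymmSndFDerivAt two_le_smooth u v

theorem third_comm_left (h : HessianRankOne F e B R) {y : E} (hy : y ∈ B) (u v w : E) :
    fderiv ℝ (fderiv ℝ (fderiv ℝ F)) y u v w = fderiv ℝ (fderiv ℝ (fderiv ℝ F)) y v u w :=
  DFunLike.congr_fun (((h.contDiffOn_fderiv y hy).contDiffAt
    (h.isOpen.mem_nhds hy)).isSymmSndFDerivAt two_le_smooth u v) w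

theorem hasFDerivAt_hessian_apply (h : HessianRankOne F e B R) {y : E} (hy : y ∈ B) (v w : E) :
    HasFDerivAt (fun y => fderiv ℝ (fderiv ℝ F) y v w)
      (((fderiv ℝ (fderiv ℝ (fderiv ℝ F)) y).flip v).flip w) y :=
  hasFDerivAt_apply_const (hasFDerivAt_apply_const (h.hasFDerivAt_hessian hy) v) w

theorem third_comm_right (h : HessianRankOne F e B R) {y : E} (hy : y ∈ B) (u v w : E) :
    fderiv ℝ (fderiv ℝ (fderiv ℝ F)) y u v w = fderiv ℝ (fderiv ℝ (fderiv ℝ F)) y u w v := by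
  have h1 := h.hasFDerivAt_hessian_apply hy v w
  have h2 : (fun y => fderiv ℝ (fderiv ℝ F) y v w) =ᶠ[𝓝 y]
      fun y => fderiv ℝ (fderiv ℝ F) y w v := by
    filter_upwards [h.isOpen.mem_nhds hy] with z hz using h.hessian_comm hz v w
  exact DFunLike.congr_fun
    (h1.unique ((h.hasFDerivAt_hessian_apply hy w v).congr_of_eventuallyEq h2)) u

theorem contDiffOn_hessian_apply (h : HessianRankOne F e B R) (v w : E) :
    ContDiffOn ℝ ∞ (fun y => fderiv ℝ (fderiv ℝ F) y v w) B :=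
  (h.contDiffOn_hessian.clm_apply contDiffOn_const).clm_apply contDiffOn_const

theorem contDiffOn_kernelSlope (h : HessianRankOne F e B R) (v : E) :
    ContDiffOn ℝ ∞ (kernelSlope F e v) B :=
  (h.contDiffOn_hessian_apply e v).neg.div (h.contDiffOn_hessian_apply e e) h.ne_zero

theorem hasFDerivAt_kernelSlope (h : HessianRankOne F e B R) (v : E) {y : E} (hy : y ∈ B) :
    HasFDerivAt (kernelSlope F e v) (fderiv ℝ (kernelSlope F e v) y) y :=
  ((((h.contDiffOn_kernelSlope v) y hy).contDiffAt (h.isOpen.mem_nhds hy)).differentiableAt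
    (by simp)).hasFDerivAt

theorem kernelSlope_spec (h : HessianRankOne F e B R) {y : E} (hy : y ∈ R) (v w : E) :
    fderiv ℝ (fderiv ℝ F) y (v + kernelSlope F e v y • e) w = 0 := by
  obtain ⟨b, hb⟩ := h.rank_one y hy v
  have h1 := hb e
  have h0 := h.ne_zero y (h.subset hy)
  rw [map_add, map_smul, _root_.add_apply, _root_.smul_apply, smul_eq_mul,
    h.hessian_comm (h.subset hy) v e] at h1
  have : kernelSlope F e v y = b := by
    rw [kernelSlope, div_eq_iff h0]
    linarith
  rw [this]
  exact hb w

theorem mem_kernel_iff (h : HessianRankOne F e B R) {y : E} (hy : y ∈ R) (v : E) :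
    (∀ w, fderiv ℝ (fderiv ℝ F) y v w = 0) ↔ kernelSlope F e v y = 0 := by
  constructor
  · intro hv
    rw [kernelSlope, h.hessian_comm (h.subset hy), hv e, neg_zero, zero_div]
  · intro hv w
    have := h.kernelSlope_spec hy v w
    rwa [hv, zero_smul, add_zero] at this

/-- The derivative along `x` of the relation `D²F (v + β e) w = 0`, with `β` the kernel slope. It is
obtained in the interior of `R` and extends to `R` by continuity, which is why `R` is assumed to lie
in the closure of its interior. -/
theorem derivative_identity (h : HessianRankOne F e B R) {y : E} (hy : y ∈ R) (v x w : E) :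
    fderiv ℝ (fderiv ℝ (fderiv ℝ F)) y x (v + kernelSlope F e v y • e) w +
      fderiv ℝ (kernelSlope F e v) y x * fderiv ℝ (fderiv ℝ F) y e w = 0 := by
  let f : E → ℝ := fun y =>
    fderiv ℝ (fderiv ℝ (fderiv ℝ F)) y x (v + kernelSlope F e v y • e) w +
      fderiv ℝ (kernelSlope F e v) y x * fderiv ℝ (fderiv ℝ F) y e w
  have hf : ContinuousOn f B := by
    refine ContinuousOn.add (ContinuousOn.clm_apply (ContinuousOn.clm_apply
      (ContinuousOn.clm_apply h.contDiffOn_third.continuousOn continuousOn_const) ?_)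
      continuousOn_const) (ContinuousOn.mul (ContinuousOn.clm_apply ?_ continuousOn_const)
      (h.contDiffOn_hessian_apply e w).continuousOn)
    · exact continuousOn_const.add
        ((h.contDiffOn_kernelSlope v).continuousOn.smul continuousOn_const)
    · exact (h.contDiffOn_kernelSlope v).continuousOn_fderiv_of_isOpen h.isOpen (by simp)
  have hint : ∀ z ∈ interior R, f z = 0 := by
    intro z hz
    have hzB := h.subset (interior_subset hz)
    have h1 : HasFDerivAt (fun y => fderiv ℝ (fderiv ℝ F) y v w +
        kernelSlope F e v y * fderiv ℝ (fderiv ℝ F) y e w) _ z :=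
      (h.hasFDerivAt_hessian_apply hzB v w).add
        ((h.hasFDerivAt_kernelSlope v hzB).mul (h.hasFDerivAt_hessian_apply hzB e w))
    have h2 : (fun y => fderiv ℝ (fderiv ℝ F) y v w +
        kernelSlope F e v y * fderiv ℝ (fderiv ℝ F) y e w) =ᶠ[𝓝 z] fun _ => 0 := by
      filter_upwards [isOpen_interior.mem_nhds hz] with y hy
      have := h.kernelSlope_spec (interior_subset hy) v w
      rwa [map_add, map_smul, _root_.add_apply, _root_.smul_apply, smul_eq_mul] at this
    have h3 := DFunLike.congr_fun
      (h1.unique ((hasFDerivAt_const (0 : ℝ) z).congr_of_eventuallyEq h2)) x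
    simp only [_root_.add_apply, _root_.smul_apply, ContinuousLinearMap.flip_apply, smul_eq_mul,
      _root_.zero_apply] at h3
    simp only [f, map_add, map_smul, _root_.add_apply, _root_.smul_apply, smul_eq_mul]
    linarith
  by_contra hne
  have hc : ContinuousAt f y := hf.continuousAt (h.isOpen.mem_nhds (h.subset hy))
  have := mem_closure_iff_frequently.1 (h.subset_closure hy)
  obtain ⟨z, hz, hz'⟩ := (this.and_eventually (hc.eventually_ne hne)).exists
  exact hz' (hint z hz)

/-- The kernel of the Hessian is a totally geodesic distribution. -/
theorem fderiv_kernelSlope_eq_zero (h : HessianRankOne F e B R) {y : E} (hy : y ∈ R) (v : E)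
    {u : E} (hu : ∀ w, fderiv ℝ (fderiv ℝ F) y u w = 0) :
    fderiv ℝ (kernelSlope F e v) y u = 0 := by
  have hB := h.subset hy
  -- Let `k = v + β e`. The choice `x = e`, `w = u` gives `D³F(e, k, u) = 0`. For `x = u`, `w = e`
  -- the third derivative is the same by symmetry, and `dβ(u) D²F(e, e) = 0` remains.
  have h1 := h.derivative_identity hy v e u
  rw [h.hessian_comm hB e u, hu e, mul_zero, add_zero] at h1
  have h2 := h.derivative_identity hy v u e
  rw [h.third_comm_left hB, h.third_comm_right hB, h.third_comm_left hB, h1, zero_add] at h2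
  exact (mul_eq_zero.1 h2).resolve_right (h.ne_zero y hB)

/-- The kernel direction stays in the kernel along a segment. -/
theorem kernel_of_segment (h : HessianRankOne F e B R) {y v : E}
    (hR : ∀ s ∈ Icc (0 : ℝ) 1, y + s • v ∈ R) (hv : ∀ w, fderiv ℝ (fderiv ℝ F) y v w = 0)
    {s : ℝ} (hs : s ∈ Icc (0 : ℝ) 1) (w : E) :
    fderiv ℝ (fderiv ℝ F) (y + s • v) v w = 0 := by
  let c : ℝ → E := fun s => y + s • v
  have hc : ∀ s, HasDerivAt c v s := fun s => by
    simpa [c] using ((hasDerivAt_id s).smul_const v).const_add y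
  have hcc : ContinuousOn c (Icc 0 1) := fun s _ => (hc s).continuousAt.continuousWithinAt
  have hcB : ∀ s ∈ Icc (0 : ℝ) 1, c s ∈ B := fun s hs => h.subset (hR s hs)
  let φ : ℝ → ℝ := fun s => kernelSlope F e v (c s)
  -- The vector `v` differs from a kernel vector by `φ e`, and the slope has zero derivative in
  -- kernel directions. So `φ` solves a homogeneous linear equation with `φ 0 = 0`.
  have hφ : ∀ s ∈ Icc (0 : ℝ) 1,
      HasDerivAt φ (- φ s * fderiv ℝ (kernelSlope F e v) (c s) e) s := by
    intro s hs
    have h1 : HasDerivAt φ (fderiv ℝ (kernelSlope F e v) (c s) v) s :=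
      (h.hasFDerivAt_kernelSlope v (hcB s hs)).comp_hasDerivAt s (hc s)
    have h2 := h.fderiv_kernelSlope_eq_zero (hR s hs) v (h.kernelSlope_spec (hR s hs) v)
    rw [map_add, map_smul, smul_eq_mul] at h2
    convert h1 using 1
    simp only [φ, c]
    linarith
  have hK : ContinuousOn (fun s => fderiv ℝ (kernelSlope F e v) (c s) e) (Icc 0 1) := by
    refine ContinuousOn.clm_apply (ContinuousOn.comp (t := B) ?_ hcc hcB) continuousOn_const
    exact (h.contDiffOn_kernelSlope v).continuousOn_fderiv_of_isOpen h.isOpen (by simp)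
  obtain ⟨K, hKb⟩ := isCompact_Icc.exists_bound_of_continuousOn hK
  have h0 := eq_zero_of_abs_deriv_le_mul_abs_self_of_eq_zero_right (f := φ) (K := K)
    (fun s hs => (hφ s hs).continuousAt.continuousWithinAt)
    (fun s hs => (hφ s (Ico_subset_Icc_self hs)).hasDerivWithinAt)
    ((h.mem_kernel_iff (hR 0 (by simp)) v).1 (by simpa [c] using hv))
    (fun s hs => by
      rw [norm_mul, norm_neg, mul_comm]
      exact mul_le_mul_of_nonneg_right (hKb s (Ico_subset_Icc_self hs)) (norm_nonneg _))
  exact (h.mem_kernel_iff (hR s hs) v).2 (h0 s hs) w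

/-- The kernel of the Hessian is constant along curves tangent to it. -/
theorem kernel_of_curve (h : HessianRankOne F e B R) {c c' : ℝ → E}
    (hc : ∀ s ∈ Icc (0 : ℝ) 1, HasDerivWithinAt c (c' s) (Icc 0 1) s)
    (hR : ∀ s ∈ Icc (0 : ℝ) 1, c s ∈ R)
    (hc' : ∀ s ∈ Icc (0 : ℝ) 1, ∀ w, fderiv ℝ (fderiv ℝ F) (c s) (c' s) w = 0) :
    (∀ v, (∀ w, fderiv ℝ (fderiv ℝ F) (c 0) v w = 0) ↔
      ∀ w, fderiv ℝ (fderiv ℝ F) (c 1) v w = 0) ∧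
    ∀ w, fderiv ℝ (fderiv ℝ F) (c 0) (c 1 - c 0) w = 0 := by
  have hright : ∀ {f : ℝ → ℝ} {a s : ℝ}, s ∈ Ico (0 : ℝ) 1 →
      HasDerivWithinAt f a (Icc 0 1) s → HasDerivWithinAt f a (Ici s) s := fun {f a s} hs hf =>
    hf.mono_of_mem_nhdsWithin (Icc_mem_nhdsGE_of_mem hs)
  have hconst : ∀ v, ∀ s ∈ Icc (0 : ℝ) 1,
      kernelSlope F e v (c s) = kernelSlope F e v (c 0) := by
    intro v
    have hd : ∀ s ∈ Icc (0 : ℝ) 1,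
        HasDerivWithinAt (fun s => kernelSlope F e v (c s)) 0 (Icc 0 1) s := by
      intro s hs
      have h1 := (h.hasFDerivAt_kernelSlope v (h.subset (hR s hs))).comp_hasDerivWithinAt s
        (hc s hs)
      rwa [h.fderiv_kernelSlope_eq_zero (hR s hs) v (hc' s hs)] at h1
    exact constant_of_has_deriv_right_zero (fun s hs => (hd s hs).continuousWithinAt)
      fun s hs => hright hs (hd s (Ico_subset_Icc_self hs))
  have h0 : (0 : ℝ) ∈ Icc (0 : ℝ) 1 := by simp
  have h1 : (1 : ℝ) ∈ Icc (0 : ℝ) 1 := by simp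
  have hker : ∀ s ∈ Icc (0 : ℝ) 1, ∀ v, (∀ w, fderiv ℝ (fderiv ℝ F) (c 0) v w = 0) ↔
      ∀ w, fderiv ℝ (fderiv ℝ F) (c s) v w = 0 := fun s hs v => by
    rw [h.mem_kernel_iff (hR 0 h0), h.mem_kernel_iff (hR s hs), hconst v s hs]
  refine ⟨hker 1 h1, ?_⟩
  -- All velocities lie in the kernel at `c 0`, so the linear form that defines this kernel is
  -- constant along the curve.
  have hd : ∀ s ∈ Icc (0 : ℝ) 1, HasDerivWithinAt
      (fun s => fderiv ℝ (fderiv ℝ F) (c 0) e (c s)) 0 (Icc 0 1) s := by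
    intro s hs
    have h2 := (fderiv ℝ (fderiv ℝ F) (c 0) e).hasFDerivAt.comp_hasDerivWithinAt s (hc s hs)
    rwa [h.hessian_comm (h.subset (hR 0 h0)), (hker s hs _).2 (hc' s hs) e] at h2
  have h3 := constant_of_has_deriv_right_zero (fun s hs => (hd s hs).continuousWithinAt)
    (fun s hs => hright hs (hd s (Ico_subset_Icc_self hs))) 1 h1
  rw [h.mem_kernel_iff (hR 0 h0), kernelSlope, map_sub, h3, sub_self, neg_zero, zero_div]

end HessianRankOne

end DevCauchy

namespace DevCauchy

open Set Filter Topology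

/-! ### Moving frames and the ruled parametrization -/

/-- At an end point the sign `θ` points into `I`; at an interior point it plays no role. -/
theorem exists_side {I : Set ℝ} (hI : I.OrdConnected) (hI' : (interior I).Nonempty) {t₁ : ℝ}
    (ht₁ : t₁ ∈ I) : ∃ θ δ : ℝ, (θ = 1 ∨ θ = -1) ∧ 0 < δ ∧
      ((t₁ ∉ frontier I ∧ ∀ t, |t - t₁| < δ → t ∈ I) ∨
        (t₁ ∈ frontier I ∧ ∀ t, |t - t₁| < δ → (t ∈ I ↔ 0 ≤ θ * (t - t₁)))) := by
  by_cases hint : t₁ ∈ interior I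
  · obtain ⟨δ, hδ, hδI⟩ := Metric.mem_nhds_iff.1 (mem_interior_iff_mem_nhds.1 hint)
    exact ⟨1, δ, Or.inl rfl, hδ, Or.inl ⟨fun h => h.2 hint, fun t ht => hδI ht⟩⟩
  have hfr : t₁ ∈ frontier I := ⟨subset_closure ht₁, hint⟩
  obtain ⟨s, hs⟩ := hI'
  have hsI := interior_subset hs
  rcases lt_trichotomy s t₁ with hlt | rfl | hlt
  · refine ⟨-1, t₁ - s, Or.inr rfl, by linarith, Or.inr ⟨hfr, fun t ht => ⟨fun h => ?_, ?_⟩⟩⟩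
    · by_contra hneg
      exact hint (mem_interior_iff_mem_nhds.2 (mem_of_superset
        (Icc_mem_nhds hlt (show t₁ < t by linarith)) (hI.out hsI h)))
    · intro h
      have := abs_lt.1 ht
      exact hI.out hsI ht₁ ⟨by linarith, by linarith⟩
  · exact absurd hs hint
  · refine ⟨1, s - t₁, Or.inl rfl, by linarith, Or.inr ⟨hfr, fun t ht => ⟨fun h => ?_, ?_⟩⟩⟩
    · by_contra hneg
      exact hint (mem_interior_iff_mem_nhds.2 (mem_of_superset
        (Icc_mem_nhds (show t < t₁ by linarith) hlt) (hI.out h hsI)))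
    · intro h
      have := abs_lt.1 ht
      exact hI.out ht₁ hsI ⟨by linarith, by linarith⟩

variable {d m : ℕ} {I : Set ℝ} {γ : ℝ → Euc d} {D : ℝ → Submodule ℝ (Euc d)} {t₁ δ : ℝ}

/-- A smooth extension `c` of the curve and a smooth moving frame `F` near `t₁`: the first vector
is the unit vector of `Im ρ`, the next ones span the ruling direction, and the remaining ones are
constant and span the normal space at `t₁`. -/
structure LocalFrame (m : ℕ) (I : Set ℝ) (γ : ℝ → Euc d) (D : ℝ → Submodule ℝ (Euc d))
    (t₁ δ : ℝ) (c : ℝ → Euc d) (F : Fin d → ℝ → Euc d) : Prop where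
  pos : 0 < δ
  mem : t₁ ∈ I
  smooth_curve : ContDiff ℝ ∞ c
  smooth_frame : ∀ i, ContDiff ℝ ∞ (F i)
  curve : ∀ t ∈ I, |t - t₁| < δ → c t = γ t ∧ deriv c t = covDeriv I γ t ∧
    deriv (deriv c) t = covDeriv I (covDeriv I γ) t
  first : ∀ t ∈ I, |t - t₁| < δ → ∀ i : Fin d, i.val = 0 → F i t = unitConormal I γ D t
  mem_ruling : ∀ t ∈ I, |t - t₁| < δ → ∀ i : Fin d, 0 < i.val → i.val < m →
    F i t ∈ ruling I D t
  expand : ∀ t ∈ I, |t - t₁| < δ → ∀ x ∈ ruling I D t,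
    ∑ i : Fin d, (if 0 < i.val ∧ i.val < m then inner ℝ (F i t) x else 0) • F i t = x
  normal_const : ∀ i : Fin d, m ≤ i.val → ∀ t, F i t = F i t₁
  normal_mem : ∀ i : Fin d, m ≤ i.val → F i t₁ ∈ (D t₁)ᗮ
  orthonormal_base : Orthonormal ℝ fun i => F i t₁

/-- In a frame of `D` that starts with the unit conormal the other members are orthogonal to `Im ρ`,
which the conormal spans because the rank is one. Orthonormal vectors normal to `D t₁`, kept
constant, complete the frame. -/
theorem CauchyData.exists_localFrame (h : CauchyData m I γ D) (hm : 0 < m)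
    (hr : ∀ t ∈ I, rhoRank I D t = 1) (ht₁ : t₁ ∈ I) {ε : ℝ} (hε : 0 < ε) :
    ∃ δ c F, δ ≤ ε ∧ LocalFrame m I γ D t₁ δ c F := by
  have hmd : m ≤ d := by
    rw [← h.distribution.finrank_eq ht₁]
    exact (Submodule.finrank_le _).trans (by simp)
  obtain ⟨E, hEs, hE⟩ := h.distribution.exists_frame_of_unit_section hm ht₁
    (h.smoothNear_unitConormal ht₁) (fun s _ => unitConormal_mem s)
    (fun s hs => h.norm_unitConormal hs)
  obtain ⟨c, hcs, hc⟩ := (h.smooth.smoothNear ht₁).exists_extension h.uniqueDiffOn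
  have hc2 : ∀ᶠ s in 𝓝[I] t₁, covDeriv I (covDeriv I γ) s = deriv (deriv c) s := by
    refine eventually_derivWithin_eq_deriv h.uniqueDiffOn (g := deriv c) ?_ ?_
    · exact (contDiff_succ_iff_deriv.1 (show ContDiff ℝ (∞ + 1) c from hcs)).2.2
    · filter_upwards [hc] with s hs using hs.2.2
  obtain ⟨δ₀, hδ₀, hδ⟩ := Metric.mem_nhdsWithin_iff.1 (hE.and (hc.and hc2))
  have hEt := (hE.self_of_nhdsWithin ht₁)
  let v : Fin d → Euc d := fun i => if hi : i.val < m then E ⟨i.val, hi⟩ t₁ else 0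
  have hv : Orthonormal ℝ (Set.domRestrict {i : Fin d | i.val < m} v) := by
    have h1 := hEt.1.comp (fun i : {i : Fin d | i.val < m} => (⟨i.1.val, i.2⟩ : Fin m))
      (fun i j hij => Subtype.ext (Fin.ext (by simpa using hij)))
    convert h1 using 1
    ext1 i
    have := i.2
    simp only [mem_ofPred_eq] at this
    simp [v, this]
  obtain ⟨b, hb⟩ := hv.exists_orthonormalBasis_extension_of_card_eq (by simp)
  let F : Fin d → ℝ → Euc d := fun i t => if hi : i.val < m then E ⟨i.val, hi⟩ t else b i
  have hFlt : ∀ (i : Fin d) (hi : i.val < m) (t : ℝ), F i t = E ⟨i.val, hi⟩ t := fun i hi t => by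
    simp [F, hi]
  have hFge : ∀ (i : Fin d), m ≤ i.val → ∀ t : ℝ, F i t = b i := fun i hi t => by
    simp [F, not_lt.2 hi]
  have hFb : ∀ i, F i t₁ = b i := fun i => by
    by_cases hi : i.val < m
    · rw [hFlt i hi, hb i hi]
      simp [v, hi]
    · exact hFge i (not_lt.1 hi) _
  have hball : ∀ t ∈ I, |t - t₁| < min δ₀ ε → t ∈ Metric.ball t₁ δ₀ ∩ I := fun t ht hlt =>
    ⟨by rw [Metric.mem_ball, Real.dist_eq]; exact hlt.trans_le (min_le_left _ _), ht⟩
  have hmemr : ∀ t ∈ I, |t - t₁| < min δ₀ ε → ∀ i : Fin m, 0 < i.val →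
      E i t ∈ ruling I D t := by
    intro t ht hlt i hi
    obtain ⟨⟨h1, h2, h3⟩, -⟩ := hδ (hball t ht hlt)
    rw [h.mem_ruling_iff_unitConormal ht (hr t ht)]
    refine ⟨?_, ?_⟩
    · rw [← h2]
      exact Submodule.subset_span ⟨i, rfl⟩
    · rw [← h3]
      exact h1.2 fun h0 => by rw [← h0] at hi; simp at hi
  refine ⟨min δ₀ ε, c, F, min_le_right _ _, lt_min hδ₀ hε, ht₁, hcs, fun i => ?_, ?_, ?_, ?_,
    ?_, fun i hi t => ?_, fun i hi => ?_, ?_⟩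
  · by_cases hi : i.val < m
    · rw [show F i = E ⟨i.val, hi⟩ from funext (hFlt i hi)]
      exact hEs _
    · rw [show F i = fun _ => b i from funext (hFge i (not_lt.1 hi))]
      exact contDiff_const
  · intro t ht hlt
    obtain ⟨-, ⟨h1, -, h2⟩, h3⟩ := hδ (hball t ht hlt)
    exact ⟨h1.symm, h2.symm, h3.symm⟩
  · intro t ht hlt i hi
    rw [hFlt i (by omega), ← (hδ (hball t ht hlt)).1.2.2]
    congr 2
  · intro t ht hlt i hi hi'
    rw [hFlt i hi']
    exact hmemr t ht hlt _ hi
  · intro t ht hlt x hx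
    obtain ⟨⟨h1, h2, h3⟩, -⟩ := hδ (hball t ht hlt)
    have h4 := starProjection_eq_sum h1 h2 x
    rw [Submodule.starProjection_eq_self_iff.2 (ruling_le hx)] at h4
    conv_rhs => rw [h4]
    symm
    refine Finset.sum_of_injOn (fun i : Fin m => (⟨i.val, by omega⟩ : Fin d))
      (fun i _ j _ hij => Fin.ext (by simpa using hij)) (by simp [Set.MapsTo]) ?_ ?_
    · intro i _ hi
      by_cases hi' : i.val < m
      · exact absurd ⟨⟨i.val, hi'⟩, by simp⟩ hi
      · rw [if_neg (by omega), zero_smul]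
    · intro i _
      rw [hFlt _ i.isLt]
      by_cases hi : 0 < i.val
      · simp [hi]
      · have hi0 : i = ⟨0, hm⟩ := Fin.ext (by simp; omega)
        have h5 := ((h.mem_ruling_iff_unitConormal ht (hr t ht)).1 hx).2
        rw [← h3] at h5
        subst hi0
        simp [h5]
  · rw [hFge i hi, hFge i hi]
  · rw [hFb, ← hEt.2.1, Submodule.mem_orthogonal]
    intro u hu
    induction hu using Submodule.span_induction with
    | mem u hu =>
      obtain ⟨j, rfl⟩ := hu
      have h1 : b ⟨j.val, by omega⟩ = E j t₁ := by
        rw [← hFb, hFlt _ j.isLt]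
      simp only
      rw [← h1]
      exact b.orthonormal.2 fun h0 => by rw [← h0] at hi; simp at hi; omega
    | zero => simp
    | add u v _ _ hu hv => rw [inner_add_left, hu, hv, add_zero]
    | smul c u _ hu => rw [inner_smul_left, hu, mul_zero]
  · simp only [hFb]
    exact b.orthonormal

/-- The ruled parametrization attached to a moving frame, completed by the normal directions. -/
noncomputable def frameMap (i₀ : Fin d) (t₁ θ : ℝ) (c : ℝ → Euc d) (F : Fin d → ℝ → Euc d)
    (w : Euc d) : Euc d :=
  c (t₁ + θ * w i₀) + ∑ i, (if i = i₀ then 0 else w i) • F i (t₁ + θ * w i₀)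

/-- The coordinates of the point `γ(t) + x` in the parametrization `frameMap`. -/
noncomputable def frameCoord (m : ℕ) (i₀ : Fin d) (t₁ θ : ℝ) (F : Fin d → ℝ → Euc d)
    (z : ℝ × Euc d) : Euc d :=
  WithLp.toLp 2 fun i => if i = i₀ then θ * (z.1 - t₁) else
    if i.val < m then inner ℝ (F i z.1) z.2 else 0

section frameMap

variable {c : ℝ → Euc d} {F : Fin d → ℝ → Euc d} {i₀ : Fin d} {θ : ℝ}

theorem contDiff_frameMap (hc : ContDiff ℝ ∞ c) (hF : ∀ i, ContDiff ℝ ∞ (F i)) :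
    ContDiff ℝ ∞ (frameMap i₀ t₁ θ c F) := by
  have hp : ∀ i, ContDiff ℝ ∞ fun w : Euc d => w i := fun i =>
    (EuclideanSpace.proj (𝕜 := ℝ) i).contDiff
  have h1 : ContDiff ℝ ∞ fun w : Euc d => t₁ + θ * w i₀ :=
    contDiff_const.add (contDiff_const.mul (hp i₀))
  refine (hc.comp h1).add (ContDiff.sum fun i _ => ContDiff.fun_smul ?_ ((hF i).comp h1))
  split_ifs
  · exact contDiff_const
  · exact hp i

theorem fderiv_frameMap (hc : ContDiff ℝ ∞ c) (hF : ∀ i, ContDiff ℝ ∞ (F i)) (w v : Euc d) :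
    fderiv ℝ (frameMap i₀ t₁ θ c F) w v =
      (θ * v i₀) • (deriv c (t₁ + θ * w i₀) +
        ∑ i, (if i = i₀ then 0 else w i) • deriv (F i) (t₁ + θ * w i₀)) +
      ∑ i, (if i = i₀ then 0 else v i) • F i (t₁ + θ * w i₀) := by
  have h1 : HasDerivAt (fun s : ℝ => frameMap i₀ t₁ θ c F (w + s • v))
      (fderiv ℝ (frameMap i₀ t₁ θ c F) w v) 0 := by
    have h2 : HasDerivAt (fun s : ℝ => w + s • v) v 0 := by
      simpa using ((hasDerivAt_id (0 : ℝ)).smul_const v).const_add w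
    have h3 : HasFDerivAt (frameMap i₀ t₁ θ c F) (fderiv ℝ (frameMap i₀ t₁ θ c F) w)
        (w + (0 : ℝ) • v) := by
      rw [zero_smul, add_zero]
      exact (((contDiff_frameMap hc hF).differentiable (by simp)) w).hasFDerivAt
    exact h3.comp_hasDerivAt (0 : ℝ) h2
  let τ : ℝ → ℝ := fun s => t₁ + θ * (w i₀ + s * v i₀)
  have hτ : HasDerivAt τ (θ * v i₀) 0 := by
    simpa [τ] using ((((hasDerivAt_id (0 : ℝ)).mul_const (v i₀)).const_add (w i₀)).const_mul
      θ).const_add t₁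
  have hτ0 : τ 0 = t₁ + θ * w i₀ := by simp [τ]
  have hcd : HasDerivAt (fun s => c (τ s)) ((θ * v i₀) • deriv c (t₁ + θ * w i₀)) 0 := by
    rw [← hτ0]
    exact HasDerivAt.scomp (0 : ℝ) ((hc.differentiable (by simp)) _).hasDerivAt hτ
  have hFd : ∀ i, HasDerivAt (fun s => (if i = i₀ then 0 else w i + s * v i) • F i (τ s))
      ((if i = i₀ then 0 else w i) • ((θ * v i₀) • deriv (F i) (t₁ + θ * w i₀)) +
        (if i = i₀ then 0 else v i) • F i (t₁ + θ * w i₀)) 0 := by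
    intro i
    have h2 : HasDerivAt (fun s => F i (τ s)) ((θ * v i₀) • deriv (F i) (t₁ + θ * w i₀)) 0 := by
      rw [← hτ0]
      exact HasDerivAt.scomp (0 : ℝ) (((hF i).differentiable (by simp)) _).hasDerivAt hτ
    have h3 : HasDerivAt (fun s : ℝ => if i = i₀ then 0 else w i + s * v i)
        (if i = i₀ then 0 else v i) 0 := by
      split_ifs
      · exact hasDerivAt_const _ _
      · simpa using ((hasDerivAt_id (0 : ℝ)).mul_const (v i)).const_add (w i)
    have h4 := h3.smul h2
    simp only [hτ0, zero_mul, add_zero] at h4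
    exact h4
  have h5 : HasDerivAt (fun s : ℝ => frameMap i₀ t₁ θ c F (w + s • v)) _ 0 :=
    hcd.add (HasDerivAt.fun_sum fun i (_ : i ∈ Finset.univ) => hFd i)
  rw [h1.unique h5, smul_add, Finset.sum_add_distrib, Finset.smul_sum, add_assoc]
  congr 2
  exact Finset.sum_congr rfl fun i _ => smul_comm _ _ _

theorem continuous_frameCoord (hF : ∀ i, ContDiff ℝ ∞ (F i)) :
    Continuous (frameCoord m i₀ t₁ θ F) := by
  refine (PiLp.continuous_toLp 2 _).comp (continuous_pi fun i => ?_)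
  split_ifs
  · fun_prop
  · exact ((hF i).continuous.comp continuous_fst).inner continuous_snd
  · exact continuous_const

end frameMap

end DevCauchy

/-! ### Derivative and charts of the ruled map -/

namespace DevCauchy

open Set Filter Topology

variable {d m : ℕ} {I : Set ℝ} {γ : ℝ → Euc d} {D : ℝ → Submodule ℝ (Euc d)} {t₁ δ : ℝ}

/-- The ruled map `(t, x) ↦ γ(t) + x` is an immersion at `(t, x)`. -/
def ImmersedAt (I : Set ℝ) (γ : ℝ → Euc d) (D : ℝ → Submodule ℝ (Euc d)) (t : ℝ) (x : Euc d) :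
    Prop :=
  inner ℝ (unitConormal I γ D t) (covDeriv I γ t) -
    inner ℝ (covDeriv I (unitConormal I γ D) t) x ≠ (0 : ℝ)

theorem eventually_abs_sub_lt {t t₁ δ : ℝ} (h : |t - t₁| < δ) : ∀ᶠ s in 𝓝 t, |s - t₁| < δ :=
  (by fun_prop : Continuous fun s : ℝ => |s - t₁|).continuousAt.eventually_lt continuousAt_const h

namespace LocalFrame

variable {c : ℝ → Euc d} {F : Fin d → ℝ → Euc d}

theorem covDeriv_frame (h : CauchyData m I γ D) (hF : LocalFrame m I γ D t₁ δ c F) {t : ℝ}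
    (ht : t ∈ I) (i : Fin d) : covDeriv I (F i) t = deriv (F i) t :=
  (((hF.smooth_frame i).differentiable (by simp)) t).derivWithin (h.uniqueDiffOn t ht)

theorem eventually_mem_ruling (hF : LocalFrame m I γ D t₁ δ c F) {t : ℝ}
    (hlt : |t - t₁| < δ) {i : Fin d} (hi : 0 < i.val) (hi' : i.val < m) :
    ∀ᶠ s in 𝓝[I] t, F i s ∈ ruling I D s := by
  filter_upwards [self_mem_nhdsWithin, nhdsWithin_le_nhds (eventually_abs_sub_lt hlt)] with s h1 h2
    using hF.mem_ruling s h1 h2 i hi hi'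

/-- This is why the tangent space does not turn along a ruling: moving the foot point of a ruling
vector changes it only within `D t`. -/
theorem deriv_frame_mem (h : CauchyData m I γ D) (hF : LocalFrame m I γ D t₁ δ c F) {t : ℝ}
    (ht : t ∈ I) (hlt : |t - t₁| < δ) {i : Fin d} (hi : 0 < i.val) (hi' : i.val < m) :
    deriv (F i) t ∈ D t := by
  rw [← hF.covDeriv_frame h ht]
  exact covDeriv_mem_of_mem_ruling h.uniqueDiffOn h.distribution ht
    (((hF.smooth_frame i).differentiable (by simp)) t).differentiableWithinAt
    (by filter_upwards [hF.eventually_mem_ruling hlt hi hi'] with s hs using ruling_le hs)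
    (hF.mem_ruling t ht hlt i hi hi')

/-- The derivative of the orthogonality of the unit conormal and the ruling. It expresses the
conormal part of the velocity through the point `x` alone, independently of the frame. -/
theorem inner_deriv_frame (h : CauchyData m I γ D) (hr : ∀ t ∈ I, rhoRank I D t = 1)
    (hF : LocalFrame m I γ D t₁ δ c F) {t : ℝ}
    (ht : t ∈ I) (hlt : |t - t₁| < δ) {i : Fin d} (hi : 0 < i.val) (hi' : i.val < m) :
    inner ℝ (unitConormal I γ D t) (deriv (F i) t) =
      - inner ℝ (covDeriv I (unitConormal I γ D) t) (F i t) := by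
  have h1 := ((h.smoothNear_unitConormal ht).differentiableWithinAt ht).hasDerivWithinAt
  have h2 := (((hF.smooth_frame i).differentiable (by simp)) t).hasDerivAt.hasDerivWithinAt (s := I)
  have h3 := (h1.inner ℝ h2).derivWithin (h.uniqueDiffOn t ht)
  have h4 : (fun s => inner ℝ (unitConormal I γ D s) (F i s)) =ᶠ[𝓝[I] t] fun _ => (0 : ℝ) := by
    filter_upwards [hF.eventually_mem_ruling hlt hi hi', self_mem_nhdsWithin] with s hs hsI
    exact ((h.mem_ruling_iff_unitConormal hsI (hr s hsI)).1 hs).2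
  rw [h4.derivWithin_eq (h4.self_of_nhdsWithin ht), derivWithin_fun_const] at h3
  simp only [Pi.zero_apply] at h3
  unfold covDeriv
  linarith

/-- The part of the coordinates `w` along the ruling. -/
noncomputable def rulingPart (m : ℕ) (F : Fin d → ℝ → Euc d) (t : ℝ) (w : Euc d) : Euc d :=
  ∑ i : Fin d, (if 0 < i.val ∧ i.val < m then w i else 0) • F i t

theorem rulingPart_mem (hF : LocalFrame m I γ D t₁ δ c F) {t : ℝ}
    (ht : t ∈ I) (hlt : |t - t₁| < δ) (w : Euc d) : rulingPart m F t w ∈ ruling I D t := by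
  refine Submodule.sum_mem _ fun i _ => ?_
  split_ifs with hi
  · exact Submodule.smul_mem _ _ (hF.mem_ruling t ht hlt i hi.1 hi.2)
  · simp

theorem continuous_rulingPart (hF : LocalFrame m I γ D t₁ δ c F) :
    Continuous fun z : ℝ × Euc d => rulingPart m F z.1 z.2 := by
  refine continuous_finsetSum _ fun i _ => Continuous.fun_smul ?_
    ((hF.smooth_frame i).continuous.comp continuous_fst)
  split_ifs
  · exact (EuclideanSpace.proj (𝕜 := ℝ) i).continuous.comp continuous_snd
  · exact continuous_const

variable {i₀ : Fin d} {θ : ℝ}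

theorem frameMap_eq (hi₀ : i₀.val = 0) (hF : LocalFrame m I γ D t₁ δ c F) (w : Euc d) :
    frameMap i₀ t₁ θ c F w = c (t₁ + θ * w i₀) + rulingPart m F (t₁ + θ * w i₀) w +
      ∑ i : Fin d, (if 0 < i.val ∧ m ≤ i.val then w i else 0) • F i t₁ := by
  rw [frameMap, rulingPart, add_assoc, ← Finset.sum_add_distrib]
  congr 1
  refine Finset.sum_congr rfl fun i _ => ?_
  by_cases h0 : i = i₀
  · subst h0
    simp [hi₀]
  have h1 : 0 < i.val := Nat.pos_of_ne_zero fun h => h0 (Fin.ext (h.trans hi₀.symm))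
  rcases lt_or_ge i.val m with hi | hi
  · simp [h0, h1, hi, not_le.2 hi]
  · rw [hF.normal_const i hi]
    simp [h0, h1, hi, not_lt.2 hi]

/-- The normal frame vectors are constant, so their coordinates do not affect the projection to `D
t₁`. This allows a comparison with graphs over `D t₁`. -/
theorem frameMap_sub_mem (hi₀ : i₀.val = 0) (hF : LocalFrame m I γ D t₁ δ c F) (w : Euc d) :
    frameMap i₀ t₁ θ c F w - (c (t₁ + θ * w i₀) + rulingPart m F (t₁ + θ * w i₀) w) ∈
      (D t₁)ᗮ := by
  rw [hF.frameMap_eq hi₀, add_sub_cancel_left]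
  refine Submodule.sum_mem _ fun i _ => ?_
  split_ifs with hi
  · exact Submodule.smul_mem _ _ (hF.normal_mem i hi.2)
  · simp

theorem frameMap_of_plane (hi₀ : i₀.val = 0) (hF : LocalFrame m I γ D t₁ δ c F) {w : Euc d}
    (hw : w ∈ coordPlane d m) :
    frameMap i₀ t₁ θ c F w = c (t₁ + θ * w i₀) + rulingPart m F (t₁ + θ * w i₀) w := by
  rw [hF.frameMap_eq hi₀, add_eq_left]
  refine Finset.sum_eq_zero fun i _ => ?_
  split_ifs with hi
  · rw [hw i hi.2, zero_smul]
  · rw [zero_smul]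

theorem frameCoord_mem_plane (hm : 0 < m) (hi₀ : i₀.val = 0) (z : ℝ × Euc d) :
    frameCoord m i₀ t₁ θ F z ∈ coordPlane d m := by
  intro i hi
  have : i ≠ i₀ := by rintro rfl; omega
  simp [frameCoord, this, not_lt.2 hi]

theorem param_frameCoord (hθ : θ = 1 ∨ θ = -1) (z : ℝ × Euc d) :
    t₁ + θ * frameCoord m i₀ t₁ θ F z i₀ = z.1 := by
  simp only [frameCoord, if_true]
  rcases hθ with rfl | rfl <;> ring

theorem rulingPart_frameCoord (hi₀ : i₀.val = 0) (hF : LocalFrame m I γ D t₁ δ c F)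
    {z : ℝ × Euc d} (ht : z.1 ∈ I) (hlt : |z.1 - t₁| < δ) (hx : z.2 ∈ ruling I D z.1) :
    rulingPart m F z.1 (frameCoord m i₀ t₁ θ F z) = z.2 := by
  conv_rhs => rw [← hF.expand z.1 ht hlt z.2 hx]
  refine Finset.sum_congr rfl fun i _ => ?_
  split_ifs with hi
  · have : i ≠ i₀ := by rintro rfl; omega
    simp [frameCoord, this, hi.2]
  · rfl

theorem frameMap_frameCoord (hm : 0 < m) (hi₀ : i₀.val = 0) (hθ : θ = 1 ∨ θ = -1)
    (hF : LocalFrame m I γ D t₁ δ c F)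
    {z : ℝ × Euc d} (ht : z.1 ∈ I) (hlt : |z.1 - t₁| < δ) (hx : z.2 ∈ ruling I D z.1) :
    frameMap i₀ t₁ θ c F (frameCoord m i₀ t₁ θ F z) = γ z.1 + z.2 := by
  rw [hF.frameMap_of_plane hi₀ (frameCoord_mem_plane hm hi₀ z), param_frameCoord hθ,
    hF.rulingPart_frameCoord hi₀ ht hlt hx, (hF.curve z.1 ht hlt).1]

/-- The velocity of `frameMap` in the direction of the parameter, on the plane. -/
theorem inner_velocity (h : CauchyData m I γ D) (hr : ∀ t ∈ I, rhoRank I D t = 1)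
    (hi₀ : i₀.val = 0) (hF : LocalFrame m I γ D t₁ δ c F) {w : Euc d}
    (hw : w ∈ coordPlane d m) {t : ℝ} (ht : t ∈ I) (hlt : |t - t₁| < δ) :
    inner ℝ (unitConormal I γ D t)
        (deriv c t + ∑ i, (if i = i₀ then 0 else w i) • deriv (F i) t) =
      inner ℝ (unitConormal I γ D t) (covDeriv I γ t) -
        inner ℝ (covDeriv I (unitConormal I γ D) t) (rulingPart m F t w) ∧
    deriv c t + ∑ i, (if i = i₀ then 0 else w i) • deriv (F i) t ∈ D t := by
  have key : ∀ i : Fin d, (0 < i.val ∧ i.val < m) ∨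
      ((if i = i₀ then 0 else w i) = 0 ∧ ¬ (0 < i.val ∧ i.val < m)) := by
    intro i
    by_cases h0 : i = i₀
    · subst h0; right; simp [hi₀]
    have h1 : 0 < i.val := Nat.pos_of_ne_zero fun h => h0 (Fin.ext (h.trans hi₀.symm))
    by_cases hi : i.val < m
    · exact Or.inl ⟨h1, hi⟩
    · right; simp [hi, hw i (not_lt.1 hi)]
  constructor
  · rw [inner_add_right, (hF.curve t ht hlt).2.1, rulingPart, inner_sum, inner_sum, sub_eq_add_neg,
      ← Finset.sum_neg_distrib]
    congr 1
    refine Finset.sum_congr rfl fun i _ => ?_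
    rw [inner_smul_right, inner_smul_right]
    rcases key i with hi | ⟨h0, hi⟩
    · rw [hF.inner_deriv_frame h hr ht hlt hi.1 hi.2]
      have : i ≠ i₀ := by rintro rfl; omega
      simp [this, hi]
    · simp [h0, hi]
  · refine Submodule.add_mem _ ?_ (Submodule.sum_mem _ fun i _ => ?_)
    · rw [(hF.curve t ht hlt).2.1]
      exact h.velocity_mem t ht
    · rcases key i with hi | ⟨h0, hi⟩
      · exact Submodule.smul_mem _ _ (hF.deriv_frame_mem h ht hlt hi.1 hi.2)
      · rw [h0, zero_smul]; exact zero_mem _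

/-- The conormal component of the differential sees only the parameter direction, with a factor that
`ImmersedAt` keeps from vanishing. The remaining columns are orthonormal at `t₁`. -/
theorem exists_chart (h : CauchyData m I γ D) (hm : 0 < m)
    (hr : ∀ t ∈ I, rhoRank I D t = 1) (hi₀ : i₀.val = 0) (hθ : θ = 1 ∨ θ = -1)
    (hF : LocalFrame m I γ D t₁ δ c F) {x : Euc d} (hx : x ∈ ruling I D t₁)
    (hix : ImmersedAt I γ D t₁ x) :
    ∃ Ψ : OpenPartialHomeomorph (Euc d) (Euc d), IsSmoothChart Ψ ∧
      frameCoord m i₀ t₁ θ F (t₁, x) ∈ Ψ.source ∧ ∀ w, Ψ w = frameMap i₀ t₁ θ c F w := by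
  have hlt : |t₁ - t₁| < δ := by simpa using hF.pos
  have hinj : Function.Injective
      (fderiv ℝ (frameMap i₀ t₁ θ c F) (frameCoord m i₀ t₁ θ F (t₁, x))) := by
    rw [injective_iff_map_eq_zero]
    intro v hv
    rw [fderiv_frameMap hF.smooth_curve hF.smooth_frame, param_frameCoord hθ] at hv
    simp only at hv
    have hw := frameCoord_mem_plane (F := F) (t₁ := t₁) (θ := θ) hm hi₀ (t₁, x)
    have h1 := (hF.inner_velocity h hr hi₀ hw hF.mem hlt).1
    rw [hF.rulingPart_frameCoord hi₀ (z := (t₁, x)) hF.mem hlt hx] at h1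
    have hu := hF.first t₁ hF.mem hlt i₀ hi₀
    have h2 : inner ℝ (F i₀ t₁) (∑ i, (if i = i₀ then 0 else v i) • F i t₁) = 0 := by
      rw [hF.orthonormal_base.inner_right_fintype]
      simp
    have h3 := congrArg (fun y => inner ℝ (F i₀ t₁) y) hv
    simp only [inner_add_right (F i₀ t₁), h2, inner_smul_right (F i₀ t₁), inner_zero_right,
      add_zero] at h3
    rw [← inner_add_right, hu, h1] at h3
    have hθ0 : θ ≠ 0 := by rcases hθ with rfl | rfl <;> norm_num
    have hv0 : v i₀ = 0 :=
      (mul_eq_zero.1 ((mul_eq_zero.1 h3).resolve_right hix)).resolve_left hθ0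
    rw [hv0, mul_zero, zero_smul, zero_add] at hv
    ext i
    have h4 := congrArg (fun y => inner ℝ (F i t₁) y) hv
    simp only [inner_zero_right] at h4
    rw [hF.orthonormal_base.inner_right_fintype] at h4
    by_cases hi : i = i₀
    · rw [hi, hv0]; rfl
    · simpa [hi] using h4
  obtain ⟨Ψ, h1, h2, h3, -, h4⟩ := exists_openPartialHomeomorph_of_injective isOpen_univ
    (contDiff_frameMap hF.smooth_curve hF.smooth_frame).contDiffOn (mem_univ _) hinj
  exact ⟨Ψ, ⟨h1, h2⟩, h3, h4⟩

end LocalFrame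

theorem CauchyData.immersedAt_zero (h : CauchyData m I γ D) {t : ℝ} (ht : t ∈ I) :
    ImmersedAt I γ D t 0 := by
  rw [ImmersedAt, inner_zero_right, sub_zero]
  exact (h.inner_unitConormal_velocity_neg ht).ne

end DevCauchy

/-! ### Graph representations at interior and boundary points -/

namespace DevCauchy

open Set Filter Topology

variable {d m : ℕ}

theorem exists_graph_of_isInteriorPoint {M : Set (Euc d)} {p : Euc d}
    (hp : IsInteriorPoint m M p) :
    ∃ G B V, IsGraphAt M (tangentSpaceAt M p) G B V p ∧ ∀ y ∈ B, G y ∈ M := by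
  obtain ⟨hpM, Φ, hΦ, hps, hΦM⟩ := hp
  obtain ⟨G, B, V, hG, -, hGB⟩ := exists_isGraphAt hpM hΦ hps (Q := coordPlane d m)
    (fun x hx => ⟨hx, tangentSpaceAt_submodule _ hx⟩) hΦM
  exact ⟨G, B, V, hG, fun y hy => (hΦM _ (hGB y hy).1).2 (hGB y hy).2⟩

/-- The function `r` is the first coordinate of the boundary chart read on the graph. The paths of
the last clause are images of segments in the edge; along them the parallelism of the nullity can be
applied to the boundary. -/
theorem exists_graph_of_isBoundaryPoint (hm : 0 < m) (hmd : m ≤ d) {M : Set (Euc d)} {p : Euc d}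
    (hp : IsBoundaryPoint m M p) :
    ∃ G B V r, IsGraphAt M (tangentSpaceAt M p) G B V p ∧ ContDiffOn ℝ ∞ r B ∧ r p = 0 ∧
      (∀ y ∈ B, G y ∈ M ↔ (0 : ℝ) ≤ r y) ∧ (∀ y ∈ B, r y = 0 → G y ∈ bdry m M) ∧
      (∀ x ∈ tangentSpaceAt M p, fderiv ℝ r p x = 0 → x ∈ tangentSpaceAt (bdry m M) p) ∧
      ∀ W ∈ 𝓝 p, ∀ᶠ y in 𝓝 p, r y = 0 → ∃ c c' : ℝ → Euc d, c 0 = p ∧ c 1 = G y ∧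
        ∀ s ∈ Icc (0 : ℝ) 1, HasDerivWithinAt c (c' s) (Icc 0 1) s ∧ c s ∈ W ∧
          c s ∈ bdry m M ∧ c' s ∈ tangentSpaceAt (bdry m M) (c s) := by
  obtain ⟨hpM, Φ, hΦ, hps, hp0, hΦM⟩ := id hp
  have hpb : p ∈ bdry m M := hp
  obtain ⟨G, B, V, hG, hV, hGB⟩ := exists_isGraphAt hpM hΦ hps (Q := coordHalfPlane d m)
    (fun x hx => ⟨hx.1, tangentSpaceAt_coordHalfPlane hm hx⟩) hΦM
  have hbd : ∀ q ∈ Φ.source, q ∈ bdry m M ↔ Φ q ∈ coordEdge d m := fun q hq =>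
    mem_bdry_iff_of_chart hm hmd hΦ hΦM hq
  have hbt : ∀ q ∈ Φ.source, q ∈ bdry m M → tangentSpaceAt (bdry m M) q =
      (coordEdge d m).map (fderiv ℝ Φ.symm (Φ q) : Euc d →ₗ[ℝ] Euc d) := fun q hq hqb => by
    rw [hΦ.tangentSpaceAt_eq hq (Q := coordEdge d m) hbd,
      tangentSpaceAt_submodule _ ((hbd q hq).1 hqb)]
  let i₀ : Fin d := ⟨0, by omega⟩
  have huniq : ∀ i : Fin d, i.val = 0 → i = i₀ := fun i hi => Fin.ext hi
  have hpB := hG.nhd_subset hG.mem_nhd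
  have hGp : G p = p := hG.fix p ⟨hpM, hG.mem_nhd⟩
  let r : Euc d → ℝ := fun y => Φ (G y) i₀
  have hΦG : ContDiffOn ℝ ∞ (fun y => Φ (G y)) B :=
    hΦ.1.comp hG.smooth fun y hy => (hGB y hy).1
  refine ⟨G, B, V, r, hG, (EuclideanSpace.proj (𝕜 := ℝ) i₀).contDiff.comp_contDiffOn hΦG, ?_,
    fun y hy => ?_, fun y hy hry => ?_, fun x hx hx0 => ?_, fun W hW => ?_⟩
  · simp only [r, hGp]
    exact hp0 i₀ rfl
  · rw [hΦM _ (hGB y hy).1]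
    refine ⟨fun h => h.2 i₀ rfl, fun h => ⟨(hGB y hy).2, fun i hi => ?_⟩⟩
    rw [huniq i hi]
    exact h
  · rw [hbd _ (hGB y hy).1]
    refine ⟨(hGB y hy).2, fun i hi => ?_⟩
    rw [huniq i hi]
    exact hry
  · have h1 : HasFDerivAt (fun y => Φ (G y)) (fderiv ℝ Φ p ∘L fderiv ℝ G p) p := by
      have : HasFDerivAt Φ (fderiv ℝ Φ p) (G p) := by
        rw [hGp]; exact (hΦ.differentiableAt hps).hasFDerivAt
      exact this.comp p (hG.hasFDerivAt hpB)
    have h2 : HasFDerivAt r (EuclideanSpace.proj (𝕜 := ℝ) i₀ ∘L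
        (fderiv ℝ Φ p ∘L fderiv ℝ G p)) p :=
      (EuclideanSpace.proj (𝕜 := ℝ) i₀).hasFDerivAt.comp p h1
    rw [h2.fderiv] at hx0
    have hx0' : fderiv ℝ Φ p (fderiv ℝ G p x) i₀ = 0 := hx0
    rw [hG.fderiv_apply_of_mem ⟨hpM, hG.mem_nhd⟩ hx] at hx0'
    rw [hΦ.tangentSpaceAt_eq hps (Q := coordHalfPlane d m) hΦM,
      tangentSpaceAt_coordHalfPlane hm ((hΦM p hps).1 hpM)] at hx
    obtain ⟨u, hu, rfl⟩ := hx
    rw [ContinuousLinearMap.coe_coe, (hΦ.fderiv_symm_comp hps).2] at hx0'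
    rw [hbt p hps hpb]
    exact ⟨u, ⟨hu, fun i hi => by rw [huniq i hi]; exact hx0'⟩, rfl⟩
  · have hpt := Φ.map_source hps
    have hcs : ContinuousAt Φ.symm (Φ p) := Φ.continuousAt_symm hpt
    have h1 : ∀ᶠ z in 𝓝 (Φ p), z ∈ Φ.target ∧ Φ.symm z ∈ W := by
      refine (Φ.open_target.eventually_mem hpt).and ?_
      apply hcs.eventually_mem
      rwa [Φ.left_inv hps]
    obtain ⟨ε, hε, hball⟩ := Metric.mem_nhds_iff.1 h1
    have h2 : ContinuousAt (fun y => Φ (G y)) p :=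
      (hΦG.continuousOn.continuousAt (hG.isOpen_domain.mem_nhds hpB))
    have h3 : ∀ᶠ y in 𝓝 p, Φ (G y) ∈ Metric.ball (Φ p) ε := by
      apply h2.eventually_mem
      rw [hGp]
      exact Metric.ball_mem_nhds _ hε
    filter_upwards [h3, hG.isOpen_domain.mem_nhds hpB] with y hy hyB hry
    have hyb : Φ (G y) ∈ coordEdge d m := ⟨(hGB y hyB).2, fun i hi => by rw [huniq i hi]; exact hry⟩
    have hpe : Φ p ∈ coordEdge d m := (hbd p hps).1 hpb
    let a : ℝ → Euc d := fun s => Φ p + s • (Φ (G y) - Φ p)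
    have ha : ∀ s, HasDerivAt a (Φ (G y) - Φ p) s := fun s => by
      simpa [a] using ((hasDerivAt_id s).smul_const (Φ (G y) - Φ p)).const_add (Φ p)
    have hab : ∀ s ∈ Icc (0 : ℝ) 1, a s ∈ Φ.target ∧ Φ.symm (a s) ∈ W := by
      intro s hs
      apply hball
      have := (convex_ball (Φ p) ε).add_smul_sub_mem (Metric.mem_ball_self hε) hy hs
      exact this
    have hae : ∀ s, a s ∈ coordEdge d m := fun s =>
      Submodule.add_mem _ hpe (Submodule.smul_mem _ _ (Submodule.sub_mem _ hyb hpe))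
    refine ⟨fun s => Φ.symm (a s), fun s => fderiv ℝ Φ.symm (a s) (Φ (G y) - Φ p), ?_, ?_,
      fun s hs => ?_⟩
    · simp only [a, zero_smul, add_zero]
      exact Φ.left_inv hps
    · simp only [a, one_smul, add_sub_cancel]
      exact Φ.left_inv (hGB y hyB).1
    · have hs' := hab s hs
      have hsrc := Φ.map_target hs'.1
      have hright : Φ (Φ.symm (a s)) = a s := Φ.right_inv hs'.1
      have hb : Φ.symm (a s) ∈ bdry m M := by
        rw [hbd _ hsrc, hright]; exact hae s
      refine ⟨?_, hs'.2, hb, ?_⟩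
      · have : HasFDerivAt Φ.symm (fderiv ℝ Φ.symm (a s)) (a s) :=
          (hΦ.symm.differentiableAt hs'.1).hasFDerivAt
        exact (this.comp_hasDerivAt s (ha s)).hasDerivWithinAt
      · simp only
        rw [hbt _ hsrc hb, hright]
        exact ⟨_, Submodule.sub_mem _ hyb hpe, rfl⟩

/-! ### Solutions near a point of the curve -/

section

variable {I : Set ℝ} {γ : ℝ → Euc d} {D : ℝ → Submodule ℝ (Euc d)} {M : Set (Euc d)}
  {T : Submodule ℝ (Euc d)} {G : Euc d → Euc d} {B V : Set (Euc d)} {p : Euc d}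

theorem IsGraphAt.eventually_mem_nhd (h : CauchyData m I γ D) {t : ℝ}
    (ht : t ∈ I) (hG : IsGraphAt M T G B V p) (htV : γ t ∈ V) : ∀ᶠ s in 𝓝[I] t, γ s ∈ V :=
  (h.continuousOn_curve t ht).eventually_mem (hG.isOpen_nhd.mem_nhds htV)

theorem IsGraphAt.hasDerivWithinAt_fderiv (h : CauchyData m I γ D) {t : ℝ}
    (ht : t ∈ I) (hG : IsGraphAt M T G B V p) (htV : γ t ∈ V) :
    HasDerivWithinAt (fun s => fderiv ℝ G (γ s))
      (fderiv ℝ (fderiv ℝ G) (γ t) (covDeriv I γ t)) I t :=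
  (hG.hasFDerivAt_fderiv (hG.nhd_subset htV)).comp_hasDerivWithinAt t
    (h.smooth.differentiableWithinAt ht).hasDerivWithinAt

/-- A nullity vector `x` extends along the curve to the section `dG x` of `D`. Its derivative is
`D²G(γ', x) = 0`, so adjointness makes `x` orthogonal to the image of `ρ`. -/
theorem IsSolution.nullity_le_ruling (h : CauchyData m I γ D)
    (hM : IsSolution m I γ D M) (hG : IsGraphAt M T G B V p) {t : ℝ} (ht : t ∈ I)
    (htV : γ t ∈ V) : nullitySpace M (γ t) ≤ ruling I D t := by
  intro x hx
  have hxD : x ∈ D t := by rw [← (hM.2.1 t ht).2]; exact hx.1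
  have hXd : HasDerivWithinAt (fun s => fderiv ℝ G (γ s) x) _ I t :=
    (hG.hasDerivWithinAt_fderiv h ht htV).clm_apply (hasDerivWithinAt_const t I x)
  have hq : γ t ∈ M ∩ V := ⟨(hM.2.1 t ht).1, htV⟩
  have hx0 : covDeriv I (fun s => fderiv ℝ G (γ s) x) t = 0 := by
    rw [covDeriv, hXd.derivWithin (h.uniqueDiffOn t ht), map_zero, add_zero,
      hG.fderiv_fderiv_comm (hG.nhd_subset htV)]
    exact hG.fderiv_fderiv_eq_zero_of_mem_nullity hq hx _
  refine mem_ruling_iff.2 ⟨hxD, fun ν => ?_⟩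
  have h1 := inner_rho h.uniqueDiffOn h.distribution ht hXd.differentiableWithinAt (by
    filter_upwards [hG.eventually_mem_nhd h ht htV, self_mem_nhdsWithin] with s hs hsI
    rw [← (hM.2.1 s hsI).2, hG.tangentSpaceAt_eq ⟨(hM.2.1 s hsI).1, hs⟩]
    exact ⟨x, rfl⟩) ν
  rwa [hx0, inner_zero_right, neg_zero, hG.fderiv_apply_of_mem hq hx.1] at h1

/-- Differentiating `γ' = dG γ'` gives `γ'' = D²G(γ', γ') + dG γ''` with tangent last term, so a
vanishing Hessian term would make the acceleration tangent. -/
theorem IsSolution.hessian_velocity_ne_zero (h : CauchyData m I γ D)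
    (hM : IsSolution m I γ D M) (hG : IsGraphAt M T G B V p) {t : ℝ} (ht : t ∈ I)
    (htV : γ t ∈ V) :
    fderiv ℝ (fderiv ℝ G) (γ t) (covDeriv I γ t) (covDeriv I γ t) ≠ 0 := by
  intro h0
  have hvel : ∀ s ∈ I, covDeriv I γ s ∈ tangentSpaceAt M (γ s) := fun s hs => by
    rw [(hM.2.1 s hs).2]; exact h.velocity_mem s hs
  have h1 : covDeriv I γ =ᶠ[𝓝[I] t] fun s => fderiv ℝ G (γ s) (covDeriv I γ s) := by
    filter_upwards [hG.eventually_mem_nhd h ht htV, self_mem_nhdsWithin] with s hs hsI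
    exact (hG.fderiv_apply_of_mem ⟨(hM.2.1 s hsI).1, hs⟩ (hvel s hsI)).symm
  have h2 := ((hG.hasDerivWithinAt_fderiv h ht htV).clm_apply
    ((h.smoothNear_velocity ht).differentiableWithinAt ht).hasDerivWithinAt).derivWithin
      (h.uniqueDiffOn t ht)
  have h3 : covDeriv I (covDeriv I γ) t =
      fderiv ℝ G (γ t) (derivWithin (covDeriv I γ) I t) := by
    unfold covDeriv at h1 h0 h2 ⊢
    exact (h1.derivWithin_eq (h1.self_of_nhdsWithin ht)).trans (by rw [h2, h0, zero_add])
  apply h.curvature t ht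
  rw [Submodule.starProjection_apply_eq_zero_iff, Submodule.orthogonal_orthogonal, h3,
    ← (hM.2.1 t ht).2, hG.tangentSpaceAt_eq ⟨(hM.2.1 t ht).1, htV⟩]
  exact ⟨_, rfl⟩

theorem IsSolution.exists_graph (hm : 0 < m) (hmd : m ≤ d)
    (hM : IsSolution m I γ D M) {t : ℝ} (ht : t ∈ I) :
    ∃ G B V, IsGraphAt M (D t) G B V (γ t) := by
  have h1 := hM.2.1 t ht
  rw [← h1.2]
  rcases hM.1.1 (γ t) h1.1 with h2 | h2
  · obtain ⟨G, B, V, hG, -⟩ := exists_graph_of_isInteriorPoint h2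
    exact ⟨G, B, V, hG⟩
  · obtain ⟨G, B, V, r, hG, -⟩ := exists_graph_of_isBoundaryPoint hm hmd h2
    exact ⟨G, B, V, hG⟩

/-- If there is a solution then `ρ` has rank one, and the ruling direction is the nullity. -/
theorem IsSolution.rank_and_nullity (h : CauchyData m I γ D) (hm : 0 < m) (hmd : m ≤ d)
    (hM : IsSolution m I γ D M) {t : ℝ} (ht : t ∈ I) :
    rhoRank I D t = 1 ∧ nullitySpace M (γ t) = ruling I D t := by
  obtain ⟨G, B, V, hG⟩ := hM.exists_graph hm hmd ht
  have h1 := hM.nullity_le_ruling h hG ht hG.mem_nhd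
  have h2 := hM.1.2.1 (γ t) hG.mem
  have h3 := h.finrank_rhoImage_add_finrank_ruling ht
  have h4 := h.one_le_rhoRank ht
  have h5 := Submodule.finrank_mono h1
  -- The nullity has dimension `m - 1`, the ruling `m - rank`, and the rank is at least one: the
  -- inclusion leaves no other possibility than equality.
  exact ⟨by omega, Submodule.eq_of_le_of_finrank_le h1 (by omega)⟩

/-- At the points of a developable submanifold the Hessian of a graph representation has
rank one. -/
theorem IsGraphAt.exists_kernel (hm : 0 < m) (hG : IsGraphAt M T G B V p)
    (hT : Module.finrank ℝ T = m)
    (hM : ∀ q ∈ M, Module.finrank ℝ (nullitySpace M q) = m - 1) {y e : Euc d} (hy : y ∈ B)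
    (hyM : G y ∈ M ∩ V) (he : fderiv ℝ (fderiv ℝ G) y e e ≠ 0) (v : Euc d) :
    ∃ b : ℝ, ∀ w, fderiv ℝ (fderiv ℝ G) y (v + b • e) w = 0 := by
  have hqB := hG.nhd_subset hyM.2
  have htr := hG.fderiv_fderiv_translate hqB (hG.proj y hy).symm
  rw [htr] at he ⊢
  set q := G y with hq
  let K : Submodule ℝ (Euc d) := LinearMap.ker (fderiv ℝ (fderiv ℝ G) q : Euc d →ₗ[ℝ] Euc d →L[ℝ] Euc d)
  have hK : ∀ x, x ∈ K ↔ ∀ w, fderiv ℝ (fderiv ℝ G) q x w = 0 := fun x => by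
    rw [LinearMap.mem_ker, ContinuousLinearMap.coe_coe, ContinuousLinearMap.ext_iff]
    rfl
  -- The kernel contains the nullity and the vertical directions, whose direct sum has dimension `(m
  -- - 1) + (d - m)`. So its codimension is at most one, and `e` lies outside it.
  have h1 : nullitySpace M q ⊔ Tᗮ ≤ K := by
    refine sup_le (fun x hx => (hK x).2 ?_) fun x hx => (hK x).2 fun w => ?_
    · exact hG.fderiv_fderiv_eq_zero_of_mem_nullity hyM hx
    · rw [hG.fderiv_fderiv_comm hqB]
      exact hG.fderiv_fderiv_apply_eq_zero hqB ((Submodule.starProjection_apply_eq_zero_iff _).2 hx) w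
  have h2 : nullitySpace M q ⊓ Tᗮ = ⊥ := by
    rw [eq_bot_iff]
    rintro x ⟨hx, hx'⟩
    rw [Submodule.mem_bot, ← hG.fderiv_apply_of_mem hyM hx.1]
    exact hG.fderiv_apply_eq_zero hqB ((Submodule.starProjection_apply_eq_zero_iff _).2 hx')
  have h3 := Submodule.finrank_sup_add_finrank_inf_eq (nullitySpace M q) Tᗮ
  rw [h2, finrank_bot, hM q hyM.1] at h3
  have h4 := T.finrank_add_finrank_orthogonal
  rw [hT, finrank_euclideanSpace_fin] at h4
  have h5 := Submodule.finrank_mono h1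
  have he0 : e ∉ K := fun h => he ((hK e).1 h e)
  have h6 : K ⊔ Submodule.span ℝ {e} = ⊤ := by
    have hlt : K < K ⊔ Submodule.span ℝ {e} := by
      refine lt_of_le_of_ne le_sup_left fun heq => he0 ?_
      rw [heq]
      exact Submodule.mem_sup_right (Submodule.mem_span_singleton_self e)
    have := Submodule.finrank_lt_finrank_of_lt hlt
    have h7 := Submodule.finrank_le (K ⊔ Submodule.span ℝ {e})
    rw [finrank_euclideanSpace_fin] at h7
    apply Submodule.eq_top_of_finrank_eq
    rw [finrank_euclideanSpace_fin]
    omega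
  have h7 : v ∈ K ⊔ Submodule.span ℝ {e} := by rw [h6]; trivial
  obtain ⟨k, hk, z, hz, rfl⟩ := Submodule.mem_sup.1 h7
  obtain ⟨a, rfl⟩ := Submodule.mem_span_singleton.1 hz
  refine ⟨-a, (hK _).1 ?_⟩
  simpa using hk

end

end DevCauchy

/-! ### Half spaces bounded by a hyperplane, and segments of nullity -/

namespace DevCauchy

open Set Filter Topology

/-- A function that is increasing in the direction `e` and whose zeros near `p` lie on an affine
hyperplane transversal to `e` has the sign of the equation of the hyperplane. -/
theorem eventually_sign_iff {E : Type*} [NormedAddCommGroup E] [NormedSpace ℝ E] {p e : E}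
    {r : E → ℝ} {ρ : ℝ} (hρ : 0 < ρ) (hr : ContDiffOn ℝ ∞ r (Metric.ball p ρ)) (hrp : r p = 0)
    (hre : ∀ y ∈ Metric.ball p ρ, 0 < fderiv ℝ r y e) {ℓ : E →L[ℝ] ℝ} (hℓ : ℓ e = 1)
    (hzero : ∀ᶠ y in 𝓝 p, r y = 0 → ℓ (y - p) = 0) :
    ∀ᶠ y in 𝓝 p, (0 ≤ r y ↔ 0 ≤ ℓ (y - p)) ∧ (ℓ (y - p) = 0 → r y = 0) := by
  obtain ⟨ρ', hρ', hball⟩ := Metric.mem_nhds_iff.1 hzero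
  set ρ₁ := min ρ ρ' with hρ₁
  have hρ₁0 : 0 < ρ₁ := lt_min hρ hρ'
  have hb : Metric.ball p ρ₁ ⊆ Metric.ball p ρ := Metric.ball_subset_ball (min_le_left _ _)
  obtain ⟨σ, hσ, hσe⟩ : ∃ σ > 0, σ * ‖e‖ < ρ₁ / 2 := by
    refine ⟨ρ₁ / 2 / (‖e‖ + 1), by positivity, ?_⟩
    rw [div_mul_eq_mul_div, div_lt_iff₀ (by positivity)]
    nlinarith [norm_nonneg e]
  have hin : ∀ y ∈ Metric.ball p (ρ₁ / 2), ∀ s ∈ Icc (-σ) σ, y + s • e ∈ Metric.ball p ρ₁ := by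
    intro y hy s hs
    rw [Metric.mem_ball, dist_eq_norm] at hy ⊢
    have h1 : ‖s • e‖ ≤ σ * ‖e‖ := by
      rw [norm_smul]
      exact mul_le_mul_of_nonneg_right (abs_le.2 hs) (norm_nonneg _)
    calc ‖y + s • e - p‖ = ‖(y - p) + s • e‖ := by congr 1; abel
      _ ≤ ‖y - p‖ + ‖s • e‖ := norm_add_le _ _
      _ < ρ₁ := by linarith
  have hd : ∀ y ∈ Metric.ball p (ρ₁ / 2), ∀ s ∈ Icc (-σ) σ,
      HasDerivAt (fun s : ℝ => r (y + s • e)) (fderiv ℝ r (y + s • e) e) s := by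
    intro y hy s hs
    have h1 : HasDerivAt (fun s : ℝ => y + s • e) e s := by
      simpa using ((hasDerivAt_id s).smul_const e).const_add y
    have h2 : HasFDerivAt r (fderiv ℝ r (y + s • e)) (y + s • e) :=
      ((hr.contDiffAt (Metric.isOpen_ball.mem_nhds (hb (hin y hy s hs)))).differentiableAt
        (by simp)).hasFDerivAt
    exact h2.comp_hasDerivAt s h1
  have hcont : ∀ y ∈ Metric.ball p (ρ₁ / 2),
      ContinuousOn (fun s : ℝ => r (y + s • e)) (Icc (-σ) σ) := fun y hy s hs =>
    (hd y hy s hs).continuousAt.continuousWithinAt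
  have hmono : ∀ y ∈ Metric.ball p (ρ₁ / 2),
      StrictMonoOn (fun s : ℝ => r (y + s • e)) (Icc (-σ) σ) := by
    intro y hy
    refine strictMonoOn_of_deriv_pos (convex_Icc _ _) (hcont y hy) fun s hs => ?_
    have hs' := interior_subset hs
    rw [(hd y hy s hs').deriv]
    exact hre _ (hb (hin y hy s hs'))
  have h0σ : (0 : ℝ) ∈ Icc (-σ) σ := ⟨by linarith, hσ.le⟩
  have h1σ : σ ∈ Icc (-σ) σ := ⟨by linarith, le_rfl⟩
  have h2σ : -σ ∈ Icc (-σ) σ := ⟨le_rfl, by linarith⟩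
  have hpp : p ∈ Metric.ball p (ρ₁ / 2) := Metric.mem_ball_self (by linarith)
  have hpos : 0 < r (p + σ • e) := by
    have := hmono p hpp h0σ h1σ hσ
    simpa [hrp] using this
  have hneg : r (p + (-σ) • e) < 0 := by
    have := hmono p hpp h2σ h0σ (by linarith)
    simpa [hrp] using this
  have hcr : ∀ s ∈ Icc (-σ) σ, ContinuousAt (fun y => r (y + s • e)) p := fun s hs =>
    ContinuousAt.comp (g := r) (hr.continuousOn.continuousAt
      (Metric.isOpen_ball.mem_nhds (hb (hin p hpp s hs)))) (by fun_prop)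
  have hgood : ∀ᶠ y in 𝓝 p, 0 < r (y + σ • e) ∧ r (y + (-σ) • e) < 0 ∧
      y ∈ Metric.ball p (ρ₁ / 2) :=
    ((hcr σ h1σ).eventually_const_lt hpos).and (((hcr (-σ) h2σ).eventually_lt_const hneg).and
      (Metric.ball_mem_nhds _ (by linarith)))
  have hproj : Tendsto (fun y => y - ℓ (y - p) • e) (𝓝 p) (𝓝 p) := by
    have : Continuous fun y => y - ℓ (y - p) • e := by fun_prop
    have h1 := this.tendsto p
    simpa using h1
  have hℓc : ∀ᶠ y in 𝓝 p, |ℓ (y - p)| < σ := by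
    have : Continuous fun y => |ℓ (y - p)| := by fun_prop
    exact this.continuousAt.eventually_lt continuousAt_const (by simpa using hσ)
  filter_upwards [hproj.eventually hgood, hℓc] with y hy hyσ
  obtain ⟨h1, h2, h3⟩ := hy
  set τ := ℓ (y - p) with hτ
  set z := y - τ • e with hz
  have hzℓ : ℓ (z - p) = 0 := by
    have : z - p = (y - p) - τ • e := by rw [hz]; abel
    rw [this, map_sub, map_smul, hℓ, smul_eq_mul, mul_one, ← hτ, sub_self]
  -- `z` is the projection of `y` to the hyperplane along `e`. On the line through `z` the function
  -- changes sign, so it has a zero, which can only be `z` itself; monotonicity then settles the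
  -- sign at `y`.
  obtain ⟨s, hs, hs0⟩ : ∃ s ∈ Icc (-σ) σ, r (z + s • e) = 0 :=
    intermediate_value_Icc (by linarith) (hcont z h3) ⟨h2.le, h1.le⟩
  have hs1 : ℓ (z + s • e - p) = 0 :=
    hball (Metric.ball_subset_ball (min_le_right _ _) (hin z h3 s hs)) hs0
  have hs2 : s = 0 := by
    have : z + s • e - p = (z - p) + s • e := by abel
    rwa [this, map_add, map_smul, hℓ, hzℓ, zero_add, smul_eq_mul, mul_one] at hs1
  rw [hs2, zero_smul, add_zero] at hs0
  have hτσ : τ ∈ Icc (-σ) σ := abs_le.1 hyσ.le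
  have hyz : z + τ • e = y := by rw [hz]; abel
  have hle := (hmono z h3).le_iff_le h0σ hτσ
  simp only [zero_smul, add_zero, hs0, hyz] at hle
  refine ⟨hle, fun h0 => ?_⟩
  rw [h0, zero_smul, add_zero] at hyz
  rw [← hyz, hs0]

variable {d m : ℕ} {M : Set (Euc d)} {T : Submodule ℝ (Euc d)} {G : Euc d → Euc d}
  {B V : Set (Euc d)} {p : Euc d}

namespace IsGraphAt

theorem hessian_inner (hG : IsGraphAt M T G B V p) (ν : Euc d) {y : Euc d} (hy : y ∈ B)
    (u v : Euc d) : fderiv ℝ (fderiv ℝ fun y => inner ℝ ν (G y)) y u v =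
      inner ℝ ν (fderiv ℝ (fderiv ℝ G) y u v) := by
  have h1 : fderiv ℝ (fun y => inner ℝ ν (G y)) =ᶠ[𝓝 y]
      fun y => (innerSL ℝ ν) ∘L fderiv ℝ G y := by
    filter_upwards [hG.isOpen_domain.mem_nhds hy] with z hz
    exact HasFDerivAt.fderiv ((innerSL ℝ ν).hasFDerivAt.comp z (hG.hasFDerivAt hz))
  have h2 : HasFDerivAt (fun y => (innerSL ℝ ν) ∘L fderiv ℝ G y)
      ((ContinuousLinearMap.compL ℝ (Euc d) (Euc d) ℝ (innerSL ℝ ν)) ∘L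
        fderiv ℝ (fderiv ℝ G) y) y :=
    (ContinuousLinearMap.compL ℝ (Euc d) (Euc d) ℝ (innerSL ℝ ν)).hasFDerivAt.comp y
      (hG.hasFDerivAt_fderiv hy)
  rw [h1.fderiv_eq, h2.fderiv]
  rfl

/-- A segment in a direction of nullity that stays over `M` lies in `M`. -/
theorem apply_add_eq_of_segment {e ν : Euc d} {B₀ R : Set (Euc d)}
    (hG : IsGraphAt M T G B V p) (hR : HessianRankOne (fun y => inner ℝ ν (G y)) e B₀ R)
    (hB₀ : B₀ ⊆ B)
    (hker : ∀ y ∈ R, ∀ v, ∃ b : ℝ, ∀ w, fderiv ℝ (fderiv ℝ G) y (v + b • e) w = 0)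
    {q x : Euc d} (hq : q ∈ M ∩ V) (hx : x ∈ tangentSpaceAt M q)
    (hx0 : ∀ w, fderiv ℝ (fderiv ℝ G) q x w = 0)
    (hseg : ∀ s ∈ Icc (0 : ℝ) 1, q + s • x ∈ R) : G (q + x) = q + x := by
  have hRB : R ⊆ B := hR.subset.trans hB₀
  have hin := fun (y : Euc d) (hy : y ∈ B) => hG.hessian_inner ν hy
  have hqB := hG.nhd_subset hq.2
  -- `x` stays in the kernel of the scalar Hessian along the segment. Some `x + b e` is in the
  -- kernel of the vector-valued one, and pairing with `ν` and `e` shows `b = 0`.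
  have h0 : ∀ s ∈ Icc (0 : ℝ) 1, fderiv ℝ (fderiv ℝ G) (q + s • x) x x = 0 := by
    intro s hs
    have h1 := fun w => hR.kernel_of_segment hseg
      (fun w => by rw [hin _ hqB, hx0, inner_zero_right]) hs w
    obtain ⟨b, hb⟩ := hker _ (hseg s hs) x
    have hB := hRB (hseg s hs)
    have h2 : inner ℝ ν (fderiv ℝ (fderiv ℝ G) (q + s • x) (x + b • e) e) = 0 := by
      rw [hb e, inner_zero_right]
    rw [← hin _ hB, map_add, map_smul, _root_.add_apply, _root_.smul_apply, h1 e, zero_add,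
      smul_eq_mul] at h2
    have h3 := (mul_eq_zero.1 h2).resolve_right (hR.ne_zero _ (hR.subset (hseg s hs)))
    have h4 := hb x
    rwa [h3, zero_smul, add_zero] at h4
  have hright : ∀ {f : ℝ → Euc d} {a : Euc d} {s : ℝ}, HasDerivAt f a s →
      HasDerivWithinAt f a (Ici s) s := fun {f a s} hf => hf.hasDerivWithinAt
  have hl : ∀ s, HasDerivAt (fun s : ℝ => q + s • x) x s := fun s => by
    simpa using ((hasDerivAt_id s).smul_const x).const_add q
  -- It follows that `dG x` keeps the value `x`, and then that `G (q + s x) - s x` is constant.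
  have hd1 : ∀ s ∈ Icc (0 : ℝ) 1, HasDerivAt (fun s : ℝ => fderiv ℝ G (q + s • x) x) 0 s := by
    intro s hs
    have h1 := (hasFDerivAt_apply_const (hG.hasFDerivAt_fderiv (hRB (hseg s hs))) x)
      |>.comp_hasDerivAt s (hl s)
    rwa [ContinuousLinearMap.flip_apply, h0 s hs] at h1
  have h1 : ∀ s ∈ Icc (0 : ℝ) 1, fderiv ℝ G (q + s • x) x = x := by
    intro s hs
    have := constant_of_has_deriv_right_zero
      (fun s hs => (hd1 s hs).continuousAt.continuousWithinAt)
      (fun s hs => hright (hd1 s (Ico_subset_Icc_self hs))) s hs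
    rw [this, zero_smul, add_zero, hG.fderiv_apply_of_mem hq hx]
  have hd2 : ∀ s ∈ Icc (0 : ℝ) 1, HasDerivAt (fun s : ℝ => G (q + s • x) - s • x) 0 s := by
    intro s hs
    have h2 := ((hG.hasFDerivAt (hRB (hseg s hs))).comp_hasDerivAt s (hl s)).sub
      ((hasDerivAt_id s).smul_const x)
    rw [h1 s hs, one_smul, sub_self] at h2
    exact h2
  have h2 := constant_of_has_deriv_right_zero
    (fun s hs => (hd2 s hs).continuousAt.continuousWithinAt)
    (fun s hs => hright (hd2 s (Ico_subset_Icc_self hs))) 1 (by simp)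
  simp only [one_smul, zero_smul, add_zero, sub_zero] at h2
  rw [hG.fix q hq, sub_eq_iff_eq_add] at h2
  exact h2

end IsGraphAt

end DevCauchy

/-! ### Solutions contain the rulings near the curve -/

namespace DevCauchy

open Set Filter Topology

variable {d m : ℕ} {I : Set ℝ} {γ : ℝ → Euc d} {D : ℝ → Submodule ℝ (Euc d)} {M : Set (Euc d)}
  {T : Submodule ℝ (Euc d)} {G : Euc d → Euc d} {B V : Set (Euc d)} {p : Euc d}

/-- The points over a ball that a graph representation maps into `M`. -/
def graphRegion (M : Set (Euc d)) (G : Euc d → Euc d) (p : Euc d) (ρ : ℝ) : Set (Euc d) :=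
  {y | y ∈ Metric.ball p ρ ∧ G y ∈ M}

/-- Pairing with `ν = D²G(e, e)` at `p` reduces to a scalar function whose second derivative along
`e` does not vanish near `p`. The closure condition is left as a hypothesis, because its proof
differs at interior and boundary points. -/
theorem IsGraphAt.exists_hessianRankOne (hm : 0 < m) (hG : IsGraphAt M T G B V p)
    (hT : Module.finrank ℝ T = m)
    (hM : ∀ q ∈ M, Module.finrank ℝ (nullitySpace M q) = m - 1) {e : Euc d}
    (he : fderiv ℝ (fderiv ℝ G) p e e ≠ 0) {N : Set (Euc d)} (hN : N ∈ 𝓝 p) :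
    ∃ ρ > 0, ∃ ν, Metric.ball p ρ ⊆ B ∩ V ∩ N ∧
      (∀ y ∈ graphRegion M G p ρ, ∀ v, ∃ b : ℝ, ∀ w,
        fderiv ℝ (fderiv ℝ G) y (v + b • e) w = 0) ∧
      (graphRegion M G p ρ ⊆ closure (interior (graphRegion M G p ρ)) →
        HessianRankOne (fun y => inner ℝ ν (G y)) e (Metric.ball p ρ) (graphRegion M G p ρ)) := by
  have hpB := hG.nhd_subset hG.mem_nhd
  set ν := fderiv ℝ (fderiv ℝ G) p e e with hν
  have hcH : ContinuousOn (fun y => inner ℝ ν (fderiv ℝ (fderiv ℝ G) y e e)) B := by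
    have h1 : ContinuousOn (fderiv ℝ (fderiv ℝ G)) B :=
      hG.contDiffOn_fderiv.continuousOn_fderiv_of_isOpen hG.isOpen_domain (by simp)
    exact continuousOn_const.inner ((h1.clm_apply continuousOn_const).clm_apply continuousOn_const)
  have hp0 : inner ℝ ν (fderiv ℝ (fderiv ℝ G) p e e) ≠ 0 := by
    rw [← hν]; simpa using he
  have h1 : ∀ᶠ y in 𝓝 p, inner ℝ ν (fderiv ℝ (fderiv ℝ G) y e e) ≠ 0 :=
    (hcH.continuousAt (hG.isOpen_domain.mem_nhds hpB)).eventually_ne hp0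
  have h2 : ∀ᶠ y in 𝓝 p, G y ∈ V := by
    apply (hG.contDiffAt hpB).continuousAt.eventually_mem
    rw [hG.fix p ⟨hG.mem, hG.mem_nhd⟩]
    exact hG.isOpen_nhd.mem_nhds hG.mem_nhd
  have h3 : ∀ᶠ y in 𝓝 p, y ∈ B ∩ V ∩ N :=
    inter_mem (inter_mem (hG.isOpen_domain.mem_nhds hpB) (hG.isOpen_nhd.mem_nhds hG.mem_nhd)) hN
  obtain ⟨ρ, hρ, hball⟩ := Metric.mem_nhds_iff.1 (h1.and (h2.and h3))
  have hker : ∀ y ∈ graphRegion M G p ρ, ∀ v, ∃ b : ℝ, ∀ w,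
        fderiv ℝ (fderiv ℝ G) y (v + b • e) w = 0 := by
    intro y hy v
    obtain ⟨h4, h5, h6⟩ := hball hy.1
    refine hG.exists_kernel hm hT hM h6.1.1 ⟨hy.2, h5⟩ (fun h0 => h4 ?_) v
    rw [h0, inner_zero_right]
  refine ⟨ρ, hρ, ν, fun y hy => (hball hy).2.2, hker, fun hcl => ?_⟩
  have hBB : Metric.ball p ρ ⊆ B := fun y hy => (hball hy).2.2.1.1
  refine ⟨Metric.isOpen_ball, ?_, fun y hy => hy.1, hcl, fun y hy => ?_, fun y hy v => ?_⟩
  · exact contDiffOn_const.inner ℝ (hG.smooth.mono hBB)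
  · rw [hG.hessian_inner ν (hBB hy)]
    exact (hball hy).1
  · obtain ⟨b, hb⟩ := hker y hy v
    exact ⟨b, fun w => by rw [hG.hessian_inner ν (hBB hy.1), hb, inner_zero_right]⟩

theorem IsSolution.hessian_ruling (h : CauchyData m I γ D) (hm : 0 < m) (hmd : m ≤ d)
    (hM : IsSolution m I γ D M) (hG : IsGraphAt M T G B V p) {t : ℝ} (ht : t ∈ I)
    (htV : γ t ∈ V) {x : Euc d} (hx : x ∈ ruling I D t) (w : Euc d) :
    fderiv ℝ (fderiv ℝ G) (γ t) x w = 0 := by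
  rw [← (hM.rank_and_nullity h hm hmd ht).2] at hx
  exact hG.fderiv_fderiv_eq_zero_of_mem_nullity ⟨(hM.2.1 t ht).1, htV⟩ hx w

theorem segment_mem_ball {q x p : Euc d} {ρ : ℝ} (hq : ‖q - p‖ < ρ / 2) (hx : ‖x‖ < ρ / 2)
    {s : ℝ} (hs : s ∈ Icc (0 : ℝ) 1) : q + s • x ∈ Metric.ball p ρ := by
  rw [Metric.mem_ball, dist_eq_norm]
  have h1 : ‖s • x‖ ≤ ‖x‖ := by
    rw [norm_smul, Real.norm_eq_abs, abs_of_nonneg hs.1]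
    exact mul_le_of_le_one_left (norm_nonneg _) hs.2
  calc ‖q + s • x - p‖ = ‖(q - p) + s • x‖ := by congr 1; abel
    _ ≤ ‖q - p‖ + ‖s • x‖ := norm_add_le _ _
    _ < ρ := by linarith

/-- Near an interior point of the curve, a solution contains the rulings. -/
theorem IsSolution.rulings_near_of_interior (h : CauchyData m I γ D) (hm : 0 < m) (hmd : m ≤ d)
    (hM : IsSolution m I γ D M) {t₁ : ℝ} (ht₁ : t₁ ∈ I) (hfr : t₁ ∉ frontier I) :
    ∃ G B V, IsGraphAt M (D t₁) G B V (γ t₁) ∧ ∃ ρ > 0, ∀ t ∈ I, ‖γ t - γ t₁‖ < ρ →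
      ∀ x ∈ ruling I D t, ‖x‖ < ρ → γ t + x ∈ M ∩ V := by
  have h1 := hM.2.1 t₁ ht₁
  have hint : IsInteriorPoint m M (γ t₁) := by
    refine (hM.1.1 _ h1.1).resolve_right fun hb => hfr ?_
    exact (hM.2.2.1 t₁ ht₁).1 hb
  obtain ⟨G, B, V, hG, hGM⟩ := exists_graph_of_isInteriorPoint hint
  rw [h1.2] at hG
  obtain ⟨ρ, hρ, ν, hball, hker, hR⟩ := hG.exists_hessianRankOne hm
    (h.distribution.finrank_eq ht₁) hM.1.2.1
    (hM.hessian_velocity_ne_zero h hG ht₁ hG.mem_nhd) univ_mem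
  have hreg : graphRegion M G (γ t₁) ρ = Metric.ball (γ t₁) ρ := by
    ext y
    exact ⟨fun hy => hy.1, fun hy => ⟨hy, hGM y (hball hy).1.1⟩⟩
  have hR := hR (by rw [hreg, Metric.isOpen_ball.interior_eq]; exact subset_closure)
  refine ⟨G, B, V, hG, ρ / 2, by positivity, fun t ht htρ x hx hxρ => ?_⟩
  have hseg : ∀ s ∈ Icc (0 : ℝ) 1, γ t + s • x ∈ Metric.ball (γ t₁) ρ := fun s hs =>
    segment_mem_ball htρ hxρ hs
  have h0 := hseg 0 (by simp)
  have h1' := hseg 1 (by simp)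
  rw [zero_smul, add_zero] at h0
  rw [one_smul] at h1'
  have h2 := hG.apply_add_eq_of_segment hR (fun y hy => (hball hy).1.1) hker
    (q := γ t) (x := x) ⟨(hM.2.1 t ht).1, (hball h0).1.2⟩
    (by rw [(hM.2.1 t ht).2]; exact ruling_le hx)
    (hM.hessian_ruling h hm hmd hG ht (hball h0).1.2 hx) (by rwa [hreg])
  refine ⟨?_, (hball h1').1.2⟩
  rw [← h2]
  exact hGM _ (hball h1').1.1

/-- After the substitution `t = t₁ + θ s` the difference quotients for `s > 0` are nonnegative. -/
theorem hasDerivWithinAt_nonneg_of_side {t₁ θ a : ℝ} {I : Set ℝ} {f : ℝ → ℝ}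
    (hθ : θ = 1 ∨ θ = -1) (hside : ∀ᶠ t in 𝓝 t₁, t ∈ I ↔ 0 ≤ θ * (t - t₁))
    (hf : HasDerivWithinAt f a I t₁) (h0 : f t₁ = 0) (hpos : ∀ᶠ t in 𝓝[I] t₁, 0 ≤ f t) :
    0 ≤ θ * a := by
  have hθθ : θ * θ = 1 := by rcases hθ with rfl | rfl <;> norm_num
  have hI : I ∈ 𝓝[(fun s => t₁ + θ * s) '' Ici 0] t₁ := by
    filter_upwards [nhdsWithin_le_nhds hside, self_mem_nhdsWithin] with t ht ht'
    obtain ⟨s, hs, rfl⟩ := ht'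
    rw [ht]
    have : θ * (t₁ + θ * s - t₁) = s := by linear_combination s * hθθ
    rw [this]; exact hs
  have hlin : HasDerivWithinAt (fun s : ℝ => t₁ + θ * s) θ (Ici 0) 0 := by
    simpa using (((hasDerivAt_id (0 : ℝ)).const_mul θ).const_add t₁).hasDerivWithinAt
  have hz : t₁ + θ * 0 = t₁ := by ring
  have hg : HasDerivWithinAt (fun s : ℝ => f (t₁ + θ * s)) (a * θ) (Ici 0) 0 := by
    have h1 : HasDerivWithinAt f a ((fun s => t₁ + θ * s) '' Ici 0) (t₁ + θ * 0) := by
      rw [hz]; exact hf.mono_of_mem_nhdsWithin hI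
    exact h1.comp (0 : ℝ) hlin (mapsTo_image _ _)
  rw [mul_comm]
  have hg' := hasDerivWithinAt_iff_tendsto_slope.1 hg
  have hmap : Tendsto (fun s : ℝ => t₁ + θ * s) (𝓝[Ici 0] 0) (𝓝[I] t₁) := by
    have := hlin.continuousWithinAt.tendsto_nhdsWithin (mapsTo_image _ _)
    rw [hz] at this
    exact this.mono_right (le_inf inf_le_left (le_principal_iff.2 hI))
  have hne : (𝓝[Ici (0 : ℝ) \ {0}] 0).NeBot := by
    rw [Ici_sdiff_left]; infer_instance
  refine ge_of_tendsto hg' ?_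
  have h3 := (hmap.mono_left (nhdsWithin_mono (0 : ℝ) (sdiff_subset (t := {(0 : ℝ)})))).eventually hpos
  filter_upwards [h3, self_mem_nhdsWithin] with s hs hs'
  rw [slope_def_field, hz, h0, sub_zero, sub_zero]
  exact div_nonneg hs hs'.1

/-- Near an end point of the curve, a solution contains the rulings, and lies on one side of the
ruling through the end point. -/
theorem IsSolution.rulings_near_of_frontier (h : CauchyData m I γ D) (hm : 0 < m) (hmd : m ≤ d)
    (hM : IsSolution m I γ D M) {t₁ θ : ℝ} (ht₁ : t₁ ∈ I) (hfr : t₁ ∈ frontier I)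
    (hθ : θ = 1 ∨ θ = -1) (hside : ∀ᶠ t in 𝓝 t₁, t ∈ I ↔ 0 ≤ θ * (t - t₁)) :
    ∃ G B V, IsGraphAt M (D t₁) G B V (γ t₁) ∧
      (∃ ρ > 0, ∀ t ∈ I, ‖γ t - γ t₁‖ < ρ →
        ∀ x ∈ ruling I D t, ‖x‖ < ρ → γ t + x ∈ M ∩ V) ∧
      ∃ ℓ : Euc d →L[ℝ] ℝ, ℓ (θ • covDeriv I γ t₁) = 1 ∧ (∀ x ∈ ruling I D t₁, ℓ x = 0) ∧
        (∀ z ∈ (D t₁)ᗮ, ℓ z = 0) ∧ ∀ᶠ q in 𝓝 (γ t₁), q ∈ M → 0 ≤ ℓ (q - γ t₁) := by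
  have h1 := hM.2.1 t₁ ht₁
  have hbd : IsBoundaryPoint m M (γ t₁) := (hM.2.2.1 t₁ ht₁).2 hfr
  obtain ⟨G, B, V, r, hG, hr, hrp, hrM, -, hrt, hpath⟩ := exists_graph_of_isBoundaryPoint hm hmd hbd
  have hbn := hM.1.2.2 _ hbd
  rw [hbn, (hM.rank_and_nullity h hm hmd ht₁).2] at hrt
  rw [h1.2] at hG hrt
  set p := γ t₁ with hp
  have hpB := hG.nhd_subset hG.mem_nhd
  have hGp : G p = p := hG.fix p ⟨hG.mem, hG.mem_nhd⟩
  set e := θ • covDeriv I γ t₁ with he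
  have hθθ : θ * θ = 1 := by rcases hθ with rfl | rfl <;> norm_num
  have hee : fderiv ℝ (fderiv ℝ G) p e e ≠ 0 := by
    rw [he, map_smul, map_smul, _root_.smul_apply, smul_smul, hθθ, one_smul]
    exact hM.hessian_velocity_ne_zero h hG ht₁ hG.mem_nhd
  have hrfix : ∀ q ∈ M ∩ V, 0 ≤ r q := fun q hq => by
    rw [← hrM q (hG.nhd_subset hq.2), hG.fix q hq]; exact hq.1
  have hrd : HasFDerivAt r (fderiv ℝ r p) p :=
    ((hr.contDiffAt (hG.isOpen_domain.mem_nhds hpB)).differentiableAt (by simp)).hasFDerivAt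
  -- Since `r ≥ 0` on the curve, the derivative is nonnegative. If it were zero the velocity would
  -- be tangent to the boundary, hence a ruling direction.
  have hre : 0 < fderiv ℝ r p e := by
    have h2 : 0 ≤ θ * fderiv ℝ r p (covDeriv I γ t₁) := by
      refine hasDerivWithinAt_nonneg_of_side hθ hside
        (hrd.comp_hasDerivWithinAt t₁ (h.smooth.differentiableWithinAt ht₁).hasDerivWithinAt)
        hrp ?_
      filter_upwards [hG.eventually_mem_nhd h ht₁ hG.mem_nhd, self_mem_nhdsWithin] with s hs hsI
      exact hrfix _ ⟨(hM.2.1 s hsI).1, hs⟩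
    rw [he, map_smul, smul_eq_mul]
    refine lt_of_le_of_ne h2 fun h0 => ?_
    have hθ0 : θ ≠ 0 := by rcases hθ with rfl | rfl <;> norm_num
    exact h.velocity_notMem_ruling ht₁ (hrt _ (h.velocity_mem t₁ ht₁)
      ((mul_eq_zero.1 h0.symm).resolve_left hθ0))
  have hrec : ContinuousOn (fun y => fderiv ℝ r y e) B :=
    (hr.continuousOn_fderiv_of_isOpen hG.isOpen_domain (by simp)).clm_apply continuousOn_const
  have hN : ∀ᶠ y in 𝓝 p, 0 < fderiv ℝ r y e :=
    (hrec.continuousAt (hG.isOpen_domain.mem_nhds hpB)).eventually_const_lt hre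
  obtain ⟨ρ, hρ, ν, hball, hker, hR⟩ := hG.exists_hessianRankOne hm
    (h.distribution.finrank_eq ht₁) hM.1.2.1 hee hN
  have hBB : Metric.ball p ρ ⊆ B := fun y hy => (hball hy).1.1
  have hreg : ∀ y, y ∈ graphRegion M G p ρ ↔ y ∈ Metric.ball p ρ ∧ 0 ≤ r y := fun y =>
    and_congr_right fun hy => hrM y (hBB hy)
  have hrcont : ∀ y ∈ Metric.ball p ρ, ContinuousAt r y := fun y hy =>
    hr.continuousOn.continuousAt (hG.isOpen_domain.mem_nhds (hBB hy))
  -- From a point with `r ≥ 0` a small move along `e` makes `r` positive, so the region lies in the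
  -- closure of its interior.
  have hR := hR (by
    intro y hy
    have hyb := (hreg y).1 hy
    have hpos : ∀ z ∈ Metric.ball p ρ, 0 < r z → z ∈ interior (graphRegion M G p ρ) := by
      intro z hz hz0
      rw [mem_interior_iff_mem_nhds]
      filter_upwards [Metric.isOpen_ball.mem_nhds hz, (hrcont z hz).eventually_const_lt hz0]
        with z' h2 h3
      exact (hreg z').2 ⟨h2, h3.le⟩
    rw [mem_closure_iff_frequently]
    have hline : HasDerivAt (fun s : ℝ => y + s • e) e 0 := by
      simpa using ((hasDerivAt_id (0 : ℝ)).smul_const e).const_add y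
    have h2 : HasDerivAt (fun s : ℝ => r (y + s • e)) (fderiv ℝ r y e) 0 := by
      have h3 : HasFDerivAt r (fderiv ℝ r y) (y + (0 : ℝ) • e) := by
        rw [zero_smul, add_zero]
        exact ((hr.contDiffAt (hG.isOpen_domain.mem_nhds (hBB hyb.1))).differentiableAt
          (by simp)).hasFDerivAt
      exact h3.comp_hasDerivAt (0 : ℝ) hline
    have h3 : Tendsto (fun s : ℝ => y + s • e) (𝓝[>] 0) (𝓝 y) := by
      have := hline.continuousAt.tendsto
      simp only [zero_smul, add_zero] at this
      exact this.mono_left nhdsWithin_le_nhds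
    have h4 : ∀ᶠ s in 𝓝[>] (0 : ℝ), 0 < r (y + s • e) := by
      have h5 := hasDerivWithinAt_iff_tendsto_slope.1 (h2.hasDerivWithinAt (s := Ioi (0 : ℝ)))
      have h6 : Ioi (0 : ℝ) \ {0} = Ioi 0 := by simp
      rw [h6] at h5
      filter_upwards [h5.eventually_const_lt (hball hyb.1).2, self_mem_nhdsWithin] with s hs hs'
      rw [slope_def_field, zero_smul, add_zero, sub_zero] at hs
      have hs0 : (0 : ℝ) < s := hs'
      have := (div_pos_iff_of_pos_right hs0).1 hs
      linarith [hyb.2]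
    refine h3.frequently (Eventually.frequently ?_)
    filter_upwards [h4, h3.eventually (Metric.isOpen_ball.mem_nhds hyb.1)] with s hs hs'
    exact hpos _ hs' hs)
  have hin := fun (y : Euc d) (hy : y ∈ B) => hG.hessian_inner ν hy
  have hpb : p ∈ Metric.ball p ρ := Metric.mem_ball_self hρ
  have hFe := hR.ne_zero p hpb
  set F : Euc d → ℝ := fun y => inner ℝ ν (G y) with hF
  -- The hyperplane `ℓ = 0` is the kernel of the Hessian at `p`, normalized by `ℓ e = 1`.
  let ℓ : Euc d →L[ℝ] ℝ :=
    (fderiv ℝ (fderiv ℝ F) p e e)⁻¹ • fderiv ℝ (fderiv ℝ F) p e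
  have hℓ : ∀ x, ℓ x = (fderiv ℝ (fderiv ℝ F) p e e)⁻¹ * fderiv ℝ (fderiv ℝ F) p e x :=
    fun x => rfl
  have hℓe : ℓ e = 1 := by rw [hℓ, inv_mul_cancel₀ hFe]
  have hℓker : ∀ x, (∀ w, fderiv ℝ (fderiv ℝ F) p x w = 0) → ℓ x = 0 := fun x hx => by
    rw [hℓ, hR.hessian_comm hpb e x, hx, mul_zero]
  have hℓT : ∀ z, (D t₁).starProjection z = 0 → ℓ z = 0 := fun z hz => by
    rw [hℓ, hin p hpB e z, hG.fderiv_fderiv_apply_eq_zero hpB hz, inner_zero_right, mul_zero]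
  -- The boundary is tangent to the nullity, so on a boundary path from `p` the kernel of the
  -- Hessian is constant and contains the displacement. The rest, `y - G y`, is vertical.
  have hcurve : ∀ᶠ y in 𝓝 p, r y = 0 → ℓ (y - p) = 0 ∧
      ∀ v, (∀ w, fderiv ℝ (fderiv ℝ F) y v w = 0) → ∀ w, fderiv ℝ (fderiv ℝ F) p v w = 0 := by
    filter_upwards [hpath _ (Metric.ball_mem_nhds p hρ), hG.isOpen_domain.mem_nhds hpB]
      with y hy hyB hry
    obtain ⟨c, c', hc0, hc1, hc⟩ := hy hry
    have hcM : ∀ s ∈ Icc (0 : ℝ) 1, c s ∈ M ∩ V := fun s hs =>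
      ⟨(hc s hs).2.2.1.1, (hball (hc s hs).2.1).1.2⟩
    have hk := hR.kernel_of_curve (fun s hs => (hc s hs).1)
      (fun s hs => ⟨(hc s hs).2.1, by rw [hG.fix _ (hcM s hs)]; exact (hcM s hs).1⟩)
      (fun s hs w => by
        have h2 := (hc s hs).2.2.2
        rw [hM.1.2.2 _ (hc s hs).2.2.1] at h2
        rw [hin _ (hG.nhd_subset (hcM s hs).2),
          hG.fderiv_fderiv_eq_zero_of_mem_nullity (hcM s hs) h2, inner_zero_right])
    rw [hc0, hc1] at hk
    have hGyB : G y ∈ B := (hG.saturated y hyB _ (hG.proj y hyB)).1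
    refine ⟨?_, fun v hv => (hk.1 v).2 fun w => ?_⟩
    · have h2 : y - p = (G y - p) + (y - G y) := by abel
      rw [h2, map_add, hℓker _ hk.2, hℓT _ (by rw [map_sub, hG.proj y hyB, sub_self]), add_zero]
    · rw [← hv w, hin _ hGyB, hin _ hyB, hG.fderiv_fderiv_translate hyB (hG.proj y hyB)]
  have hsign := eventually_sign_iff hρ (hr.mono hBB) hrp (fun y hy => (hball hy).2) hℓe
    (hcurve.mono fun y hy hy0 => (hy hy0).1)
  obtain ⟨ρ₂, hρ₂, hball₂⟩ := Metric.mem_nhds_iff.1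
    (hsign.and (hcurve.and (Metric.ball_mem_nhds p hρ)))
  refine ⟨G, B, V, hG, ⟨ρ₂ / 2, by positivity, fun t ht htρ x hx hxρ => ?_⟩, ℓ, hℓe, ?_, ?_, ?_⟩
  · have hseg : ∀ s ∈ Icc (0 : ℝ) 1, γ t + s • x ∈ Metric.ball p ρ₂ := fun s hs =>
      segment_mem_ball htρ hxρ hs
    have hsub : ∀ s ∈ Icc (0 : ℝ) 1, γ t + s • x ∈ Metric.ball p ρ := fun s hs =>
      (hball₂ (hseg s hs)).2.2
    have h0 := hseg 0 (by simp)
    have h1' := hsub 1 (by simp)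
    rw [zero_smul, add_zero] at h0
    rw [one_smul] at h1'
    have htV : γ t ∈ V := (hball (hball₂ h0).2.2).1.2
    have htM : γ t ∈ M ∩ V := ⟨(hM.2.1 t ht).1, htV⟩
    have hx0 := hM.hessian_ruling h hm hmd hG ht htV hx
    have hFx0 : ∀ w, fderiv ℝ (fderiv ℝ F) (γ t) x w = 0 := fun w => by
      rw [hin _ (hG.nhd_subset htV), hx0, inner_zero_right]
    have ha : 0 ≤ ℓ (γ t - p) := ((hball₂ h0).1.1).1 (hrfix _ htM)
    have hℓs : ∀ s : ℝ, ℓ (γ t + s • x - p) = ℓ (γ t - p) + s * ℓ x := fun s => by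
      have : γ t + s • x - p = (γ t - p) + s • x := by abel
      rw [this, map_add, map_smul, smul_eq_mul]
    have hregion : ∀ s ∈ Icc (0 : ℝ) 1, 0 ≤ ℓ (γ t - p) + s * ℓ x →
        γ t + s • x ∈ graphRegion M G p ρ := fun s hs hs0 =>
      (hreg _).2 ⟨hsub s hs, ((hball₂ (hseg s hs)).1.1).2 (by rwa [hℓs])⟩
    -- Suppose the segment left the half space `ℓ ≥ 0`. At the exit point, which satisfies `r = 0`,
    -- the vector `x` would still be in the kernel, hence in the kernel at `p`; this contradicts `ℓ
    -- x < 0`.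
    have hpos : ∀ s ∈ Icc (0 : ℝ) 1, 0 ≤ ℓ (γ t - p) + s * ℓ x := by
      intro s hs
      by_contra hneg
      have hb : ℓ x < 0 := by
        by_contra hb
        exact hneg (add_nonneg ha (mul_nonneg hs.1 (not_lt.1 hb)))
      set a := ℓ (γ t - p) with ha'
      set σ := a / (- ℓ x) with hσ
      have hσ0 : 0 ≤ σ := div_nonneg ha (by linarith)
      have hσx : σ * ℓ x = - a := by rw [hσ, div_neg, neg_mul, div_mul_cancel₀ _ hb.ne]
      have hσs : σ < s := by
        rw [hσ, div_lt_iff₀ (by linarith)]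
        linarith
      have hσI : σ ∈ Icc (0 : ℝ) 1 := ⟨hσ0, by linarith [hs.2]⟩
      have hstar : ∀ w, fderiv ℝ (fderiv ℝ F) (γ t + σ • x) x w = 0 := by
        -- The exit time is zero if `γ t` itself lies on the hyperplane.
        rcases eq_or_lt_of_le hσ0 with h00 | h00
        · rw [← h00, zero_smul, add_zero]; exact hFx0
        · intro w
          have h2 := hR.kernel_of_segment (y := γ t) (v := σ • x) (fun s' hs' => by
            rw [smul_smul]
            refine hregion _ ⟨mul_nonneg hs'.1 hσ0, mul_le_one₀ hs'.2 hσ0 hσI.2⟩ ?_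
            rw [mul_assoc, hσx]
            nlinarith [hs'.2]) (fun w => by
              rw [map_smul, _root_.smul_apply, hFx0, smul_zero]) (s := 1) (by simp) w
          rw [one_smul, map_smul, _root_.smul_apply, smul_eq_mul] at h2
          exact (mul_eq_zero.1 h2).resolve_left h00.ne'
      have hstar0 : ℓ (γ t + σ • x - p) = 0 := by rw [hℓs, hσx, add_neg_cancel]
      have hs1 := hball₂ (hseg σ hσI)
      exact hb.ne (hℓker _ ((hs1.2.1 (hs1.1.2 hstar0)).2 x hstar))
    have h2 := hG.apply_add_eq_of_segment hR hBB hker htM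
      (by rw [(hM.2.1 t ht).2]; exact ruling_le hx) hx0
      (fun s hs => hregion s hs (hpos s hs))
    have h3 := hregion 1 (by simp) (hpos 1 (by simp))
    rw [one_smul] at h3
    refine ⟨?_, (hball h1').1.2⟩
    rw [← h2]
    exact h3.2
  · intro x hx
    refine hℓker x fun w => ?_
    rw [hin p hpB, hM.hessian_ruling h hm hmd hG ht₁ hG.mem_nhd hx, inner_zero_right]
  · intro z hz
    exact hℓT z ((Submodule.starProjection_apply_eq_zero_iff _).2 hz)
  · filter_upwards [hsign, hG.isOpen_nhd.mem_nhds hG.mem_nhd] with q hq hqV hqM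
    exact hq.1.1 (hrfix q ⟨hqM, hqV⟩)

end DevCauchy

/-! ### Near the curve, solutions contain only points of rulings -/

namespace DevCauchy

open Set Filter Topology LocalFrame

variable {d m : ℕ} {I : Set ℝ} {γ : ℝ → Euc d} {D : ℝ → Submodule ℝ (Euc d)} {M : Set (Euc d)}
  {t₁ δ θ : ℝ} {c : ℝ → Euc d} {F : Fin d → ℝ → Euc d} {i₀ : Fin d}

/-- The function `ℓ (frameMap w - γ t₁)` vanishes for `w i₀ = 0`, since `ℓ` kills the ruling and the
normal space, and has derivative one in the direction of `w i₀` at the origin. Near the origin its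
sign is therefore that of `w i₀`. -/
theorem LocalFrame.eventually_nonneg_of_functional (hi₀ : i₀.val = 0)
    (hF : LocalFrame m I γ D t₁ δ c F) {ℓ : Euc d →L[ℝ] ℝ}
    (hℓ : ℓ (θ • covDeriv I γ t₁) = 1) (hℓr : ∀ x ∈ ruling I D t₁, ℓ x = 0)
    (hℓn : ∀ z ∈ (D t₁)ᗮ, ℓ z = 0) :
    ∀ᶠ w in 𝓝 (0 : Euc d), 0 ≤ ℓ (frameMap i₀ t₁ θ c F w - γ t₁) → 0 ≤ w i₀ := by
  have hlt : |t₁ - t₁| < δ := by simpa using hF.pos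
  set f := frameMap i₀ t₁ θ c F with hf
  have hfs : ContDiff ℝ ∞ f := contDiff_frameMap hF.smooth_curve hF.smooth_frame
  set e : Euc d := EuclideanSpace.single i₀ 1 with he
  have hd0 : ℓ (fderiv ℝ f 0 e) = 1 := by
    rw [hf, fderiv_frameMap hF.smooth_curve hF.smooth_frame]
    have h1 : ∀ i, (if i = i₀ then (0 : ℝ) else e i) = 0 := fun i => by
      by_cases hi : i = i₀ <;> simp [he, hi]
    simp only [h1]
    simpa [he, (hF.curve t₁ hF.mem hlt).2.1] using hℓ
  have hpos : ∀ᶠ w in 𝓝 (0 : Euc d), 0 < ℓ (fderiv ℝ f w e) := by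
    have : Continuous fun w => ℓ (fderiv ℝ f w e) :=
      ℓ.continuous.comp ((hfs.continuous_fderiv (by simp)).clm_apply continuous_const)
    exact this.continuousAt.eventually_const_lt (lt_of_lt_of_eq zero_lt_one hd0.symm)
  obtain ⟨ρ, hρ, hball⟩ := Metric.mem_nhds_iff.1 hpos
  have hproj : Continuous fun w : Euc d => w - w i₀ • e := by fun_prop
  have h0 : ∀ᶠ w in 𝓝 (0 : Euc d), w - w i₀ • e ∈ Metric.ball 0 ρ :=
    hproj.continuousAt.eventually_mem (by simpa using Metric.ball_mem_nhds (0 : Euc d) hρ)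
  filter_upwards [h0, Metric.ball_mem_nhds (0 : Euc d) hρ] with w hw hwb hle
  by_contra hneg
  rw [not_le] at hneg
  set w₀ := w - w i₀ • e with hw₀
  have hsub : w - w₀ = w i₀ • e := by rw [hw₀]; abel
  have hw₀i : w₀ i₀ = 0 := by simp [hw₀, he]
  have hz : ℓ (f w₀ - γ t₁) = 0 := by
    rw [hf, hF.frameMap_eq hi₀, hw₀i, mul_zero, add_zero, (hF.curve t₁ hF.mem hlt).1,
      add_assoc, add_sub_cancel_left, map_add, hℓr _ (hF.rulingPart_mem hF.mem hlt _), zero_add]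
    refine hℓn _ (Submodule.sum_mem _ fun i _ => ?_)
    split_ifs with hi
    · exact Submodule.smul_mem _ _ (hF.normal_mem i hi.2)
    · simp
  have hderiv : ∀ s : ℝ, HasDerivAt (fun s : ℝ => ℓ (f (w₀ + s • (w - w₀)) - γ t₁))
      (ℓ (fderiv ℝ f (w₀ + s • (w - w₀)) (w - w₀))) s := by
    intro s
    have h1 : HasDerivAt (fun s : ℝ => w₀ + s • (w - w₀)) (w - w₀) s := by
      simpa using ((hasDerivAt_id s).smul_const (w - w₀)).const_add w₀
    exact ℓ.hasFDerivAt.comp_hasDerivAt s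
      ((((hfs.differentiable (by simp)) _).hasFDerivAt.comp_hasDerivAt s h1).sub_const _)
  have hanti : StrictAntiOn (fun s : ℝ => ℓ (f (w₀ + s • (w - w₀)) - γ t₁)) (Icc 0 1) := by
    refine strictAntiOn_of_deriv_neg (convex_Icc _ _)
      (fun s _ => (hderiv s).continuousAt.continuousWithinAt) fun s hs => ?_
    have h1 := hball ((convex_ball (0 : Euc d) ρ).add_smul_sub_mem hw hwb (interior_subset hs))
    rw [(hderiv s).deriv, hsub, map_smul, map_smul, smul_eq_mul, ← hsub]
    exact mul_neg_of_neg_of_pos hneg h1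
  have h1 := hanti (left_mem_Icc.2 zero_le_one) (right_mem_Icc.2 zero_le_one) zero_lt_one
  simp only [one_smul, add_sub_cancel, zero_smul, add_zero, hz] at h1
  linarith

/-- Near a point of the curve, a solution contains the rulings, and only points with parameters
in `I`. -/
theorem IsSolution.exists_graph_of_localFrame (h : CauchyData m I γ D) (hm : 0 < m) (hmd : m ≤ d)
    (hM : IsSolution m I γ D M) (hi₀ : i₀.val = 0) (hθ : θ = 1 ∨ θ = -1)
    (hF : LocalFrame m I γ D t₁ δ c F)
    (hside : (t₁ ∉ frontier I ∧ ∀ t, |t - t₁| < δ → t ∈ I) ∨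
        (t₁ ∈ frontier I ∧ ∀ t, |t - t₁| < δ → (t ∈ I ↔ 0 ≤ θ * (t - t₁)))) :
    ∃ G B V, IsGraphAt M (D t₁) G B V (γ t₁) ∧
      (∃ ρ > 0, ∀ t ∈ I, ‖γ t - γ t₁‖ < ρ →
        ∀ x ∈ ruling I D t, ‖x‖ < ρ → γ t + x ∈ M ∩ V) ∧
      ∀ᶠ w in 𝓝 (0 : Euc d), frameMap i₀ t₁ θ c F w ∈ M → t₁ + θ * w i₀ ∈ I := by
  have hc : Continuous fun w : Euc d => |t₁ + θ * w i₀ - t₁| := by fun_prop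
  have hsmall : ∀ᶠ w in 𝓝 (0 : Euc d), |t₁ + θ * w i₀ - t₁| < δ :=
    hc.continuousAt.eventually_lt continuousAt_const (by simpa using hF.pos)
  rcases hside with ⟨hfr, hs⟩ | ⟨hfr, hs⟩
  · obtain ⟨G, B, V, hG, hρ⟩ := hM.rulings_near_of_interior h hm hmd hF.mem hfr
    exact ⟨G, B, V, hG, hρ, hsmall.mono fun w hw _ => hs _ hw⟩
  · have hside : ∀ᶠ t in 𝓝 t₁, t ∈ I ↔ 0 ≤ θ * (t - t₁) :=
      (eventually_abs_sub_lt (by simpa using hF.pos)).mono hs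
    obtain ⟨G, B, V, hG, hρ, ℓ, h1, h2, h3, h4⟩ :=
      hM.rulings_near_of_frontier h hm hmd hF.mem hfr hθ hside
    refine ⟨G, B, V, hG, hρ, ?_⟩
    have hlt : |t₁ - t₁| < δ := by simpa using hF.pos
    have h0 : frameMap i₀ t₁ θ c F 0 = γ t₁ := by
      simp [frameMap, (hF.curve t₁ hF.mem hlt).1]
    have h5 := (contDiff_frameMap (i₀ := i₀) (t₁ := t₁) (θ := θ) hF.smooth_curve
      hF.smooth_frame).continuous.tendsto 0
    rw [h0] at h5
    filter_upwards [hsmall, h5.eventually h4,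
      hF.eventually_nonneg_of_functional hi₀ h1 h2 h3] with w hw1 hw2 hw3 hwM
    rw [hs _ hw1]
    have h6 := hw3 (hw2 hwM)
    have : θ * (t₁ + θ * w i₀ - t₁) = w i₀ := by rcases hθ with rfl | rfl <;> ring
    rwa [this]

/-- Near a point of the curve, a solution is locally the image of the rulings. -/
theorem IsSolution.exists_rulings_near (h : CauchyData m I γ D) (hm : 0 < m) (hmd : m ≤ d)
    (hM : IsSolution m I γ D M) (ht₁ : t₁ ∈ I) :
    ∃ ρ > 0, ∀ t ∈ I, ‖γ t - γ t₁‖ < ρ → ∀ x ∈ ruling I D t, ‖x‖ < ρ → γ t + x ∈ M ∧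
      ∀ η > 0, ∀ᶠ q in 𝓝 (γ t + x), q ∈ M →
        ∃ s ∈ I, ∃ z ∈ ruling I D s, |s - t| < η ∧ ‖z - x‖ < η ∧ q = γ s + z := by
  have hr : ∀ t ∈ I, rhoRank I D t = 1 := fun t ht => (hM.rank_and_nullity h hm hmd ht).1
  obtain ⟨θ, δ₀, hθ, hδ₀, hside⟩ := exists_side h.ordConnected h.interior_nonempty ht₁
  obtain ⟨δ, c, F, hδ, hF⟩ := h.exists_localFrame hm hr ht₁ hδ₀
  let i₀ : Fin d := ⟨0, by omega⟩
  have hi₀ : i₀.val = 0 := rfl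
  have hlt₁ : |t₁ - t₁| < δ := by simpa using hF.pos
  obtain ⟨G, B, V, hG, ⟨ρ₁, hρ₁, hA⟩, hI⟩ := hM.exists_graph_of_localFrame h hm hmd hi₀ hθ hF
    (hside.imp (fun h1 => ⟨h1.1, fun t ht => h1.2 t (ht.trans_le hδ)⟩)
      (fun h1 => ⟨h1.1, fun t ht => h1.2 t (ht.trans_le hδ)⟩))
  obtain ⟨Ψ, -, hΨs, hΨ⟩ := hF.exists_chart h hm hr hi₀ hθ (zero_mem _) (h.immersedAt_zero ht₁)
  have hw0 : frameCoord m i₀ t₁ θ F (t₁, 0) = 0 := by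
    ext i; simp [frameCoord]
  have hcoord : ∀ᶠ z in 𝓝 (t₁, (0 : Euc d)), frameCoord m i₀ t₁ θ F z ∈ Ψ.source ∧
      ∀ᶠ w in 𝓝 (frameCoord m i₀ t₁ θ F z),
        frameMap i₀ t₁ θ c F w ∈ M → t₁ + θ * w i₀ ∈ I := by
    refine (continuous_frameCoord hF.smooth_frame).continuousAt.eventually
      (p := fun w₁ => w₁ ∈ Ψ.source ∧ ∀ᶠ w in 𝓝 w₁,
        frameMap i₀ t₁ θ c F w ∈ M → t₁ + θ * w i₀ ∈ I)
      ((Ψ.open_source.eventually_mem hΨs).and ?_)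
    rw [hw0]
    exact hI.eventually_nhds
  obtain ⟨ρ₂, hρ₂, hball⟩ := Metric.mem_nhds_iff.1 hcoord
  obtain ⟨η₀, hη₀, hdist⟩ := h.exists_dist_lt ht₁ (lt_min hρ₂ hF.pos)
  refine ⟨min ρ₁ (min ρ₂ η₀), lt_min hρ₁ (lt_min hρ₂ hη₀), fun t ht htρ x hx hxρ => ?_⟩
  have htρ₁ := htρ.trans_le (min_le_left _ _)
  have hxρ₁ := hxρ.trans_le (min_le_left _ _)
  have hxM := hA t ht htρ₁ x hx hxρ₁
  refine ⟨hxM.1, fun η hη => ?_⟩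
  have htt := hdist t ht (htρ.trans_le ((min_le_right _ _).trans (min_le_right _ _)))
  have htδ : |t - t₁| < δ := htt.trans_le (min_le_right _ _)
  obtain ⟨hs, hev⟩ := hball (show (t, x) ∈ Metric.ball (t₁, (0 : Euc d)) ρ₂ by
    rw [Metric.mem_ball, Prod.dist_eq, max_lt_iff, Real.dist_eq, dist_zero_right]
    exact ⟨htt.trans_le (min_le_left _ _),
      hxρ.trans_le ((min_le_right _ _).trans (min_le_left _ _))⟩)
  set w' := frameCoord m i₀ t₁ θ F (t, x) with hw'
  have hτ : t₁ + θ * w' i₀ = t := param_frameCoord hθ (t, x)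
  have hrp : rulingPart m F t w' = x := hF.rulingPart_frameCoord hi₀ (z := (t, x)) ht htδ hx
  have hΨw : Ψ w' = γ t + x := by
    rw [hΨ]; exact hF.frameMap_frameCoord hm hi₀ hθ (z := (t, x)) ht htδ hx
  have hcont : ContinuousAt (fun w : Euc d =>
      (t₁ + θ * w i₀, rulingPart m F (t₁ + θ * w i₀) w)) w' := by
    have h1 : Continuous fun w : Euc d => t₁ + θ * w i₀ := by fun_prop
    exact (h1.prodMk (hF.continuous_rulingPart.comp (h1.prodMk continuous_id))).continuousAt
  have hgood : ∀ᶠ z : ℝ × Euc d in 𝓝 (t, x), |z.1 - t₁| < δ ∧ ‖c z.1 - γ t₁‖ < ρ₁ ∧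
      ‖z.2‖ < ρ₁ ∧ |z.1 - t| < η ∧ ‖z.2 - x‖ < η := by
    have hc : Continuous fun z : ℝ × Euc d => ‖c z.1 - γ t₁‖ :=
      ((hF.smooth_curve.continuous.comp continuous_fst).sub continuous_const).norm
    have h1 : Continuous fun z : ℝ × Euc d => |z.1 - t₁| := by fun_prop
    have h2 : Continuous fun z : ℝ × Euc d => ‖z.2‖ := by fun_prop
    have h3 : Continuous fun z : ℝ × Euc d => |z.1 - t| := by fun_prop
    have h4 : Continuous fun z : ℝ × Euc d => ‖z.2 - x‖ := by fun_prop
    have hc0 : ‖c t - γ t₁‖ < ρ₁ := by rwa [(hF.curve t ht htδ).1]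
    have h30 : |t - t| < η := by simpa using hη
    have h40 : ‖x - x‖ < η := by simpa using hη
    filter_upwards [(h1.tendsto (t, x)).eventually_lt_const htδ,
      (hc.tendsto (t, x)).eventually_lt_const hc0, (h2.tendsto (t, x)).eventually_lt_const hxρ₁,
      (h3.tendsto (t, x)).eventually_lt_const h30, (h4.tendsto (t, x)).eventually_lt_const h40]
      with z a1 a2 a3 a4 a5 using ⟨a1, a2, a3, a4, a5⟩
  have hsymm : Tendsto Ψ.symm (𝓝 (γ t + x)) (𝓝 w') := by
    have h1 := Ψ.continuousAt_symm (Ψ.map_source hs)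
    rw [ContinuousAt, Ψ.left_inv hs, hΨw] at h1
    exact h1
  have hlim : Tendsto (fun q => (t₁ + θ * Ψ.symm q i₀,
      rulingPart m F (t₁ + θ * Ψ.symm q i₀) (Ψ.symm q))) (𝓝 (γ t + x)) (𝓝 (t, x)) := by
    have h1 := hcont.tendsto.comp hsymm
    rw [hτ, hrp] at h1
    exact h1
  have htarget : Ψ.target ∈ 𝓝 (γ t + x) := by
    rw [← hΨw]; exact Ψ.open_target.mem_nhds (Ψ.map_source hs)
  filter_upwards [htarget, hlim.eventually hgood, hsymm.eventually hev,
    hG.isOpen_nhd.mem_nhds hxM.2] with q hq hz hwI hqV hqM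
  set w := Ψ.symm q with hw
  have hfw : frameMap i₀ t₁ θ c F w = q := by rw [← hΨ, hw, Ψ.right_inv hq]
  have hsI := hwI (by rwa [hfw])
  obtain ⟨h1, h2, h3, h4, h5⟩ := hz
  have hx' := hF.rulingPart_mem hsI h1 w
  have hcs := (hF.curve _ hsI h1).1
  rw [hcs] at h2
  have hAM := hA _ hsI h2 _ hx' h3
  refine ⟨_, hsI, _, hx', h4, h5, ?_⟩
  have h6 := hF.frameMap_sub_mem (θ := θ) hi₀ w
  rw [hfw, hcs] at h6
  -- The point `q` and the point of the ruling with the same coordinates have equal projections to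
  -- `D t₁`. Both lie in `M ∩ V`, where `G` fixes them, and so they coincide.
  have h7 : (D t₁).starProjection q = (D t₁).starProjection
      (γ (t₁ + θ * w i₀) + rulingPart m F (t₁ + θ * w i₀) w) := by
    rw [← sub_eq_zero, ← map_sub]
    exact (Submodule.starProjection_apply_eq_zero_iff _).2 h6
  rw [← hG.fix q ⟨hqM, hqV⟩, (hG.saturated _ (hG.nhd_subset hAM.2) q h7).2, hG.fix _ hAM]

end DevCauchy

/-! ### Ruled patches and the developable submanifolds they parametrize -/

namespace DevCauchy

open Set Filter Topology LocalFrame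

variable {d m : ℕ} {I : Set ℝ} {γ : ℝ → Euc d} {D : ℝ → Submodule ℝ (Euc d)}

/-- The total space of the ruling bundle. -/
def ruledDomain (I : Set ℝ) (D : ℝ → Submodule ℝ (Euc d)) : Set (ℝ × Euc d) :=
  {z | z.1 ∈ I ∧ z.2 ∈ ruling I D z.1}

/-- The ruled map `(t, x) ↦ γ(t) + x`. -/
def ruledMap (γ : ℝ → Euc d) (z : ℝ × Euc d) : Euc d := γ z.1 + z.2

/-- An open, fibrewise star-shaped neighbourhood of the zero section of the ruling bundle on which
the ruled map is an embedded immersion. -/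
structure IsRuledPatch (I : Set ℝ) (γ : ℝ → Euc d) (D : ℝ → Submodule ℝ (Euc d))
    (W : Set (ℝ × Euc d)) : Prop where
  subset : W ⊆ ruledDomain I D
  relOpen : ∀ z ∈ W, ∀ᶠ z' in 𝓝 z, z' ∈ ruledDomain I D → z' ∈ W
  zero_mem : ∀ t ∈ I, (t, 0) ∈ W
  star : ∀ z ∈ W, ∀ s ∈ Icc (0 : ℝ) 1, (z.1, s • z.2) ∈ W
  immersed : ∀ z ∈ W, ImmersedAt I γ D z.1 z.2
  embedded : ∀ z ∈ W, ∀ O ∈ 𝓝 z, ∃ V ∈ 𝓝 (ruledMap γ z), ∀ z' ∈ W, ruledMap γ z' ∈ V → z' ∈ O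

variable {W : Set (ℝ × Euc d)} {δ θ : ℝ} {c : ℝ → Euc d} {F : Fin d → ℝ → Euc d} {i₀ : Fin d}
  {z₁ : ℝ × Euc d}

theorem secondFundamentalForm_eq {M : Set (Euc d)} {p : Euc d} {T : Submodule ℝ (Euc d)}
    (hT : tangentSpaceAt M p = T) (x : Euc d) (Y : Euc d → Euc d) :
    secondFundamentalForm M p x Y = Tᗮ.starProjection (fderiv ℝ Y p x) := by
  subst hT
  rfl

namespace IsRuledPatch

/-- The chart inverts `frameMap`. The embedding condition allows its domain to be shrunk until no
other part of the image comes back near the point; what remains is the plane, restricted to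
parameters in `I`. -/
theorem exists_chart (h : CauchyData m I γ D) (hm : 0 < m) (hr : ∀ t ∈ I, rhoRank I D t = 1)
    (hW : IsRuledPatch I γ D W) (hz₁ : z₁ ∈ W) (hi₀ : i₀.val = 0) (hθ : θ = 1 ∨ θ = -1)
    (hF : LocalFrame m I γ D z₁.1 δ c F) :
    ∃ Φ : OpenPartialHomeomorph (Euc d) (Euc d), IsSmoothChart Φ ∧ ruledMap γ z₁ ∈ Φ.source ∧
      Φ (ruledMap γ z₁) = frameCoord m i₀ z₁.1 θ F z₁ ∧
      (∀ w, Φ.symm w = frameMap i₀ z₁.1 θ c F w) ∧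
      ∀ q ∈ Φ.source, |z₁.1 + θ * Φ q i₀ - z₁.1| < δ ∧
        (q ∈ ruledMap γ '' W ↔ Φ q ∈ coordPlane d m ∧ z₁.1 + θ * Φ q i₀ ∈ I) ∧
        (Φ q ∈ coordPlane d m → z₁.1 + θ * Φ q i₀ ∈ I →
          (z₁.1 + θ * Φ q i₀, rulingPart m F (z₁.1 + θ * Φ q i₀) (Φ q)) ∈ W ∧
          q = ruledMap γ (z₁.1 + θ * Φ q i₀, rulingPart m F (z₁.1 + θ * Φ q i₀) (Φ q))) := by
  have hz := hW.subset hz₁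
  have hlt : |z₁.1 - z₁.1| < δ := by simpa using hF.pos
  obtain ⟨Ψ, hΨ, hΨs, hΨf⟩ := hF.exists_chart h hm hr hi₀ hθ hz.2 (hW.immersed z₁ hz₁)
  set w₁ := frameCoord m i₀ z₁.1 θ F z₁ with hw₁
  have hτ : z₁.1 + θ * w₁ i₀ = z₁.1 := param_frameCoord hθ z₁
  have hrp : rulingPart m F z₁.1 w₁ = z₁.2 := hF.rulingPart_frameCoord hi₀ hz.1 hlt hz.2
  have hΨw : Ψ w₁ = ruledMap γ z₁ := by
    rw [hΨf]; exact hF.frameMap_frameCoord hm hi₀ hθ hz.1 hlt hz.2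
  have hsymm : Tendsto Ψ.symm (𝓝 (ruledMap γ z₁)) (𝓝 w₁) := by
    have h1 := Ψ.continuousAt_symm (Ψ.map_source hΨs)
    rwa [ContinuousAt, Ψ.left_inv hΨs, hΨw] at h1
  have hparam : Continuous fun w : Euc d => z₁.1 + θ * w i₀ := by fun_prop
  have hpair : Continuous fun w : Euc d =>
      (z₁.1 + θ * w i₀, rulingPart m F (z₁.1 + θ * w i₀) w) :=
    hparam.prodMk (hF.continuous_rulingPart.comp (hparam.prodMk continuous_id))
  have hN : ∀ᶠ w in 𝓝 w₁, |z₁.1 + θ * w i₀ - z₁.1| < δ ∧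
      ((z₁.1 + θ * w i₀, rulingPart m F (z₁.1 + θ * w i₀) w) ∈ ruledDomain I D →
        (z₁.1 + θ * w i₀, rulingPart m F (z₁.1 + θ * w i₀) w) ∈ W) := by
    have h1 := hpair.tendsto w₁
    have h2 : (z₁.1 + θ * w₁ i₀, rulingPart m F (z₁.1 + θ * w₁ i₀) w₁) = z₁ := by rw [hτ, hrp]
    rw [h2] at h1
    have h3 : Tendsto (fun w : Euc d => |z₁.1 + θ * w i₀ - z₁.1|) (𝓝 w₁) (𝓝 0) := by
      have := ((hparam.sub continuous_const).abs (f := fun w : Euc d =>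
        z₁.1 + θ * w i₀ - z₁.1)).tendsto w₁
      rwa [hτ, sub_self, abs_zero] at this
    exact (h3.eventually_lt_const hF.pos).and (h1.eventually (hW.relOpen z₁ hz₁))
  have hO : ∀ᶠ z in 𝓝 z₁, |z.1 - z₁.1| < δ ∧ frameCoord m i₀ z₁.1 θ F z ∈ Ψ.source := by
    have h1 : Continuous fun z : ℝ × Euc d => |z.1 - z₁.1| := by fun_prop
    exact ((h1.tendsto z₁).eventually_lt_const hlt).and
      ((continuous_frameCoord hF.smooth_frame).continuousAt.eventually_mem
        (Ψ.open_source.mem_nhds hΨs))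
  obtain ⟨V, hV, hVO⟩ := hW.embedded z₁ hz₁ _ hO
  obtain ⟨V', hV'sub, hV'o, hV'⟩ := mem_nhds_iff.1 (inter_mem hV (hsymm.eventually hN))
  refine ⟨Ψ.symm.restrOpen V' hV'o, hΨ.symm.restrOpen hV'o,
    ⟨hΨw ▸ Ψ.map_source hΨs, hV'⟩, ?_, hΨf, ?_⟩
  · show Ψ.symm (ruledMap γ z₁) = w₁
    rw [← hΨw, Ψ.left_inv hΨs]
  · rintro q ⟨hqt, hqV⟩
    obtain ⟨hqV, hq1, hq2⟩ := hV'sub hqV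
    set w := Ψ.symm q with hw
    have hfw : frameMap i₀ z₁.1 θ c F w = q := by rw [← hΨf, hw, Ψ.right_inv hqt]
    have key : w ∈ coordPlane d m → z₁.1 + θ * w i₀ ∈ I →
        (z₁.1 + θ * w i₀, rulingPart m F (z₁.1 + θ * w i₀) w) ∈ W ∧
        q = ruledMap γ (z₁.1 + θ * w i₀, rulingPart m F (z₁.1 + θ * w i₀) w) := by
      intro hwp hwI
      refine ⟨hq2 ⟨hwI, hF.rulingPart_mem hwI hq1 w⟩, ?_⟩
      conv_lhs => rw [← hfw, hF.frameMap_of_plane hi₀ hwp, (hF.curve _ hwI hq1).1]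
      rfl
    refine ⟨hq1, ⟨?_, fun hq => ⟨_, (key hq.1 hq.2).1, (key hq.1 hq.2).2.symm⟩⟩, key⟩
    rintro ⟨z', hz', rfl⟩
    obtain ⟨hz'δ, hz's⟩ := hVO z' hz' hqV
    have hz'd := hW.subset hz'
    have h1 : w = frameCoord m i₀ z₁.1 θ F z' := by
      rw [hw, ← Ψ.left_inv hz's, hΨf]
      congr 1
      exact (hF.frameMap_frameCoord hm hi₀ hθ hz'd.1 hz'δ hz'd.2).symm
    show w ∈ coordPlane d m ∧ z₁.1 + θ * w i₀ ∈ I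
    rw [h1, param_frameCoord hθ]
    exact ⟨frameCoord_mem_plane hm hi₀ z', hz'd.1⟩

/-- The velocity `Y` of the parameter lies in `D` and has nonzero conormal component, and the other
columns span the ruling, which is a hyperplane of `D`. -/
theorem map_fderiv_frameMap (h : CauchyData m I γ D) (hm : 0 < m)
    (hr : ∀ t ∈ I, rhoRank I D t = 1)
    (hz : z₁ ∈ ruledDomain I D) (hix : ImmersedAt I γ D z₁.1 z₁.2)
    (hi₀ : i₀.val = 0) (hθ : θ = 1 ∨ θ = -1)
    (hF : LocalFrame m I γ D z₁.1 δ c F) :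
    (coordPlane d m).map (fderiv ℝ (frameMap i₀ z₁.1 θ c F)
      (frameCoord m i₀ z₁.1 θ F z₁) : Euc d →ₗ[ℝ] Euc d) = D z₁.1 ∧
    (coordEdge d m).map (fderiv ℝ (frameMap i₀ z₁.1 θ c F)
      (frameCoord m i₀ z₁.1 θ F z₁) : Euc d →ₗ[ℝ] Euc d) = ruling I D z₁.1 := by
  have hlt : |z₁.1 - z₁.1| < δ := by simpa using hF.pos
  have hwp := frameCoord_mem_plane (F := F) (t₁ := z₁.1) (θ := θ) hm hi₀ z₁
  obtain ⟨h1, h2⟩ := hF.inner_velocity h hr hi₀ hwp hF.mem hlt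
  rw [hF.rulingPart_frameCoord hi₀ hz.1 hlt hz.2] at h1
  have hfd : ∀ v ∈ coordPlane d m, fderiv ℝ (frameMap i₀ z₁.1 θ c F)
      (frameCoord m i₀ z₁.1 θ F z₁) v = (θ * v i₀) • (deriv c z₁.1 +
        ∑ i, (if i = i₀ then 0 else frameCoord m i₀ z₁.1 θ F z₁ i) • deriv (F i) z₁.1) +
        rulingPart m F z₁.1 v := by
    intro v hv
    rw [fderiv_frameMap hF.smooth_curve hF.smooth_frame, param_frameCoord hθ, rulingPart]
    congr 1
    refine Finset.sum_congr rfl fun i _ => ?_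
    by_cases h0 : i = i₀
    · subst h0; simp [hi₀]
    have h1 : 0 < i.val := Nat.pos_of_ne_zero fun h => h0 (Fin.ext (h.trans hi₀.symm))
    by_cases hi : i.val < m
    · simp [h0, h1, hi]
    · simp [h0, hi, hv i (not_lt.1 hi)]
  set Y := deriv c z₁.1 + ∑ i, (if i = i₀ then 0 else frameCoord m i₀ z₁.1 θ F z₁ i) •
    deriv (F i) z₁.1 with hY
  have hb : inner ℝ (unitConormal I γ D z₁.1) Y ≠ (0 : ℝ) := by rw [h1]; exact hix
  have hrul : ∀ x ∈ ruling I D z₁.1, ∃ v ∈ coordEdge d m, rulingPart m F z₁.1 v = x := by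
    intro x hx
    refine ⟨frameCoord m i₀ z₁.1 θ F (z₁.1, x),
      ⟨frameCoord_mem_plane hm hi₀ _, fun i hi => ?_⟩,
      hF.rulingPart_frameCoord hi₀ (z := (z₁.1, x)) hz.1 hlt hx⟩
    have : i = i₀ := Fin.ext (hi.trans hi₀.symm)
    simp [frameCoord, this]
  have hθθ : θ * θ = 1 := by rcases hθ with rfl | rfl <;> norm_num
  constructor
  · apply le_antisymm
    · rintro _ ⟨v, hv, rfl⟩
      rw [ContinuousLinearMap.coe_coe, hfd v hv]
      exact add_mem (Submodule.smul_mem _ _ h2) (ruling_le (hF.rulingPart_mem hz.1 hlt v))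
    · intro y hy
      set a : ℝ := inner ℝ (unitConormal I γ D z₁.1) y / inner ℝ (unitConormal I γ D z₁.1) Y
        with ha
      have hyr : y - a • Y ∈ ruling I D z₁.1 := by
        rw [h.mem_ruling_iff_unitConormal hz.1 (hr _ hz.1)]
        refine ⟨sub_mem hy (Submodule.smul_mem _ _ h2), ?_⟩
        rw [inner_sub_right, inner_smul_right, ha, div_mul_cancel₀ _ hb, sub_self]
      obtain ⟨v, hv, hvx⟩ := hrul _ hyr
      -- The velocity enters the differential with the factor `θ`, and `θ * θ = 1`, so this
      -- coordinate produces `a • Y`.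
      have hwe : EuclideanSpace.single i₀ (θ * a) ∈ coordPlane d m := by
        intro i hi
        have : i ≠ i₀ := by rintro rfl; omega
        simp [this]
      have hwp' := add_mem hwe hv.1
      refine ⟨_, hwp', ?_⟩
      rw [ContinuousLinearMap.coe_coe, hfd _ hwp']
      have h3 : rulingPart m F z₁.1 (EuclideanSpace.single i₀ (θ * a) + v) =
          rulingPart m F z₁.1 v := by
        refine Finset.sum_congr rfl fun i _ => ?_
        split_ifs with hi
        · have : i ≠ i₀ := by rintro rfl; omega
          simp [this]
        · rfl
      rw [h3, hvx, PiLp.add_apply, hv.2 i₀ hi₀]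
      simp only [PiLp.single_apply, if_true, add_zero]
      rw [← mul_assoc, hθθ, one_mul]
      abel
  · apply le_antisymm
    · rintro _ ⟨v, hv, rfl⟩
      rw [ContinuousLinearMap.coe_coe, hfd v hv.1, hv.2 i₀ hi₀, mul_zero, zero_smul, zero_add]
      exact hF.rulingPart_mem hz.1 hlt v
    · intro x hx
      obtain ⟨v, hv, hvx⟩ := hrul x hx
      refine ⟨v, hv, ?_⟩
      rw [ContinuousLinearMap.coe_coe, hfd v hv.1, hv.2 i₀ hi₀, mul_zero, zero_smul, zero_add, hvx]

/-- The local description of the image of a ruled patch. -/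
theorem local_description (h : CauchyData m I γ D) (hm : 0 < m)
    (hmd : m ≤ d) (hr : ∀ t ∈ I, rhoRank I D t = 1) (hW : IsRuledPatch I γ D W) (hz₁ : z₁ ∈ W) :
    tangentSpaceAt (ruledMap γ '' W) (ruledMap γ z₁) = D z₁.1 ∧
    ((z₁.1 ∉ frontier I ∧ IsInteriorPoint m (ruledMap γ '' W) (ruledMap γ z₁)) ∨
      (z₁.1 ∈ frontier I ∧ IsBoundaryPoint m (ruledMap γ '' W) (ruledMap γ z₁) ∧
        tangentSpaceAt (bdry m (ruledMap γ '' W)) (ruledMap γ z₁) = ruling I D z₁.1)) := by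
  have hz := hW.subset hz₁
  obtain ⟨θ, δ₀, hθ, hδ₀, hside⟩ := exists_side h.ordConnected h.interior_nonempty hz.1
  obtain ⟨δ, c, F, hδ, hF⟩ := h.exists_localFrame hm hr hz.1 hδ₀
  let i₀ : Fin d := ⟨0, by omega⟩
  have hi₀ : i₀.val = 0 := rfl
  obtain ⟨Φ, hΦ, hp, hΦp, hsymm, hΦM⟩ := hW.exists_chart h hm hr hz₁ hi₀ hθ hF
  obtain ⟨hD, hR⟩ := map_fderiv_frameMap h hm hr hz (hW.immersed _ hz₁) hi₀ hθ hF
  have hsymm' : (Φ.symm : Euc d → Euc d) = frameMap i₀ z₁.1 θ c F := funext hsymm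
  have hpM : ruledMap γ z₁ ∈ ruledMap γ '' W := mem_image_of_mem _ hz₁
  rw [← hΦp, ← hsymm'] at hD hR
  rcases hside with ⟨hfr, hs⟩ | ⟨hfr, hs⟩
  · have hM : ∀ q ∈ Φ.source, q ∈ ruledMap γ '' W ↔ Φ q ∈ (coordPlane d m : Set (Euc d)) := by
      intro q hq
      obtain ⟨h1, h2, -⟩ := hΦM q hq
      exact h2.trans (and_iff_left (hs _ (h1.trans_le hδ)))
    refine ⟨?_, Or.inl ⟨hfr, hpM, Φ, hΦ, hp, hM⟩⟩
    rw [hΦ.tangentSpaceAt_eq hp hM, tangentSpaceAt_submodule _ ((hM _ hp).1 hpM), hD]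
  · have hM : ∀ q ∈ Φ.source, q ∈ ruledMap γ '' W ↔ Φ q ∈ coordHalfPlane d m := by
      intro q hq
      obtain ⟨h1, h2, -⟩ := hΦM q hq
      rw [h2, hs _ (h1.trans_le hδ)]
      have : θ * (z₁.1 + θ * Φ q i₀ - z₁.1) = Φ q i₀ := by rcases hθ with rfl | rfl <;> ring
      rw [this]
      refine and_congr_right fun _ => ⟨fun h0 i hi => ?_, fun h0 => h0 i₀ hi₀⟩
      rwa [show i = i₀ from Fin.ext hi]
    have hb : IsBoundaryPoint m (ruledMap γ '' W) (ruledMap γ z₁) := by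
      refine ⟨hpM, Φ, hΦ, hp, fun i hi => ?_, hM⟩
      rw [hΦp, show i = i₀ from Fin.ext hi]
      simp [frameCoord]
    have hbd : ∀ q ∈ Φ.source, q ∈ bdry m (ruledMap γ '' W) ↔
        Φ q ∈ (coordEdge d m : Set (Euc d)) := fun q hq => mem_bdry_iff_of_chart hm hmd hΦ hM hq
    refine ⟨?_, Or.inr ⟨hfr, hb, ?_⟩⟩
    · rw [hΦ.tangentSpaceAt_eq hp hM, tangentSpaceAt_coordHalfPlane hm ((hM _ hp).1 hpM), hD]
    · rw [hΦ.tangentSpaceAt_eq hp hbd, tangentSpaceAt_submodule _ ((hbd _ hp).1 hb), hR]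

/-- The velocity of the curve, kept constant along rulings, is a tangent field. Its second
fundamental form is the parameter component, up to `θ`, times `π^⊥(γ'') ≠ 0`, so nullity vectors
have no such component. Conversely the tangent space is constant on a ruling, so tangent fields have
tangent derivatives along it. -/
theorem nullitySpace_eq (h : CauchyData m I γ D) (hm : 0 < m)
    (hmd : m ≤ d) (hr : ∀ t ∈ I, rhoRank I D t = 1) (hW : IsRuledPatch I γ D W) (hz₁ : z₁ ∈ W) :
    nullitySpace (ruledMap γ '' W) (ruledMap γ z₁) = ruling I D z₁.1 := by
  have hz := hW.subset hz₁
  have htan := (hW.local_description h hm hmd hr hz₁).1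
  obtain ⟨θ, δ₀, hθ, hδ₀, -⟩ := exists_side h.ordConnected h.interior_nonempty hz.1
  obtain ⟨δ, c, F, hδ, hF⟩ := h.exists_localFrame hm hr hz.1 hδ₀
  have hlt : |z₁.1 - z₁.1| < δ := by simpa using hF.pos
  let i₀ : Fin d := ⟨0, by omega⟩
  have hi₀ : i₀.val = 0 := rfl
  obtain ⟨Φ, hΦ, hp, hΦp, hsymm, hΦM⟩ := hW.exists_chart h hm hr hz₁ hi₀ hθ hF
  obtain ⟨hD, hR⟩ := map_fderiv_frameMap h hm hr hz (hW.immersed _ hz₁) hi₀ hθ hF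
  have hsymm' : (Φ.symm : Euc d → Euc d) = frameMap i₀ z₁.1 θ c F := funext hsymm
  rw [← hΦp, ← hsymm'] at hD hR
  apply le_antisymm
  · rintro y ⟨hyT, hyN⟩
    rw [htan, ← hD] at hyT
    obtain ⟨v, hv, rfl⟩ := hyT
    rw [ContinuousLinearMap.coe_coe] at hyN ⊢
    let Y₀ : Euc d → Euc d := fun q => deriv c (z₁.1 + θ * Φ q i₀)
    have hproj : ContDiffOn ℝ ∞ (fun q => Φ q i₀) Φ.source :=
      (EuclideanSpace.proj (𝕜 := ℝ) i₀).contDiff.comp_contDiffOn hΦ.1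
    have hτs : ContDiffOn ℝ ∞ (fun q => z₁.1 + θ * Φ q i₀) Φ.source :=
      contDiffOn_const.add (contDiffOn_const.mul hproj)
    have hc' : ContDiff ℝ ∞ (deriv c) :=
      (contDiff_succ_iff_deriv.1 (show ContDiff ℝ (∞ + 1) c from hF.smooth_curve)).2.2
    obtain ⟨Y, hY, hYY⟩ := exists_tangentField Φ.open_source (Y₀ := Y₀)
      (hc'.comp_contDiffOn hτs) (M := ruledMap γ '' W) (p := ruledMap γ z₁) (fun q hq => by
        obtain ⟨h1, h2, h3⟩ := hΦM q hq.2
        obtain ⟨h4, h5⟩ := h2.1 hq.1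
        obtain ⟨h6, h7⟩ := h3 h4 h5
        have h8 := (hW.local_description h hm hmd hr h6).1
        rw [← h7] at h8
        rw [h8]
        show deriv c (z₁.1 + θ * Φ q i₀) ∈ _
        rw [(hF.curve _ h5 h1).2.1]
        exact h.velocity_mem _ h5) hp
    have h0 := hyN Y hY
    rw [secondFundamentalForm_eq htan, hYY.fderiv_eq] at h0
    have hτd : HasFDerivAt (fun q => z₁.1 + θ * Φ q i₀)
        (θ • (EuclideanSpace.proj (𝕜 := ℝ) i₀ ∘L fderiv ℝ Φ (ruledMap γ z₁))) (ruledMap γ z₁) :=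
      (((EuclideanSpace.proj (𝕜 := ℝ) i₀).hasFDerivAt.comp _
        (hΦ.differentiableAt hp).hasFDerivAt).const_mul θ).const_add z₁.1
    have hτ0 : z₁.1 + θ * Φ (ruledMap γ z₁) i₀ = z₁.1 := by rw [hΦp]; exact param_frameCoord hθ z₁
    have hY₀d : HasFDerivAt Y₀ _ (ruledMap γ z₁) :=
      HasFDerivAt.comp (g := deriv c) (ruledMap γ z₁)
        ((hc'.differentiable (by simp)) _).hasDerivAt.hasFDerivAt hτd
    rw [hY₀d.fderiv, hτ0, (hF.curve _ hz.1 hlt).2.2] at h0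
    have h1 : (θ * v i₀) • (D z₁.1)ᗮ.starProjection (covDeriv I (covDeriv I γ) z₁.1) = 0 := by
      rw [← map_smul, ← (hΦ.fderiv_symm_comp hp).2 v]
      exact h0
    have hθ0 : θ ≠ 0 := by rcases hθ with rfl | rfl <;> norm_num
    have hv0 : v i₀ = 0 := (mul_eq_zero.1
      ((smul_eq_zero.1 h1).resolve_right (h.curvature _ hz.1))).resolve_left hθ0
    rw [← hR]
    exact ⟨v, ⟨hv, fun i hi => by rwa [show i = i₀ from Fin.ext hi]⟩, rfl⟩
  · intro x hx
    refine ⟨by rw [htan]; exact ruling_le hx, fun Y hY => ?_⟩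
    rw [secondFundamentalForm_eq htan]
    set P := (D z₁.1)ᗮ.starProjection with hP
    have hline : HasDerivAt (fun s : ℝ => z₁.2 + s • x) x 0 := by
      simpa using ((hasDerivAt_id (0 : ℝ)).smul_const x).const_add z₁.2
    have hpt : HasDerivAt (fun s : ℝ => ruledMap γ (z₁.1, z₁.2 + s • x)) x 0 :=
      hline.const_add (γ z₁.1)
    have hYd : HasDerivAt (fun s : ℝ => P (Y (ruledMap γ (z₁.1, z₁.2 + s • x))))
        (P (fderiv ℝ Y (ruledMap γ z₁) x)) 0 := by
      have h1 : HasFDerivAt Y (fderiv ℝ Y (ruledMap γ z₁))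
          (ruledMap γ (z₁.1, z₁.2 + (0 : ℝ) • x)) := by
        rw [zero_smul, add_zero]
        exact ((hY.1.differentiable (by simp)) _).hasFDerivAt
      exact P.hasFDerivAt.comp_hasDerivAt (0 : ℝ) (h1.comp_hasDerivAt (0 : ℝ) hpt)
    have hcont : Tendsto (fun s : ℝ => (z₁.1, z₁.2 + s • x)) (𝓝 0) (𝓝 z₁) := by
      have h1 : Continuous fun s : ℝ => (z₁.1, z₁.2 + s • x) := by fun_prop
      simpa using h1.tendsto 0
    have hzero : (fun s : ℝ => P (Y (ruledMap γ (z₁.1, z₁.2 + s • x)))) =ᶠ[𝓝 0] fun _ => 0 := by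
      filter_upwards [hcont.eventually (hW.relOpen z₁ hz₁)] with s hs
      have hsW := hs ⟨hz.1, add_mem hz.2 (Submodule.smul_mem _ s hx)⟩
      have h1 := hY.2 _ (mem_image_of_mem _ hsW)
      rw [(hW.local_description h hm hmd hr hsW).1] at h1
      rw [hP, Submodule.starProjection_apply_eq_zero_iff, Submodule.orthogonal_orthogonal]
      exact h1
    rw [← hYd.deriv, hzero.deriv_eq, deriv_const]

/-- The image of a ruled patch solves the geometric Cauchy problem. -/
theorem isSolution (h : CauchyData m I γ D) (hm : 0 < m)
    (hmd : m ≤ d) (hr : ∀ t ∈ I, rhoRank I D t = 1) (hW : IsRuledPatch I γ D W) :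
    IsSolution m I γ D (ruledMap γ '' W) := by
  have hloc := fun z (hz : z ∈ W) => hW.local_description h hm hmd hr hz
  have hbd : ∀ z ∈ W, ruledMap γ z ∈ bdry m (ruledMap γ '' W) ↔ z.1 ∈ frontier I := by
    intro z hz
    rcases (hloc z hz).2 with ⟨h1, h2⟩ | ⟨h1, h2, -⟩
    · exact iff_of_false (h2.not_isBoundaryPoint hm hmd) h1
    · exact iff_of_true h2 h1
  have hγ : ∀ t, ruledMap γ (t, 0) = γ t := fun t => add_zero _
  refine ⟨⟨?_, ?_, ?_⟩, fun t ht => ?_, fun t ht => ?_, fun p hp => ?_⟩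
  · rintro _ ⟨z, hz, rfl⟩
    exact (hloc z hz).2.imp (fun h1 => h1.2) (fun h1 => h1.2.1)
  · rintro _ ⟨z, hz, rfl⟩
    rw [hW.nullitySpace_eq h hm hmd hr hz]
    have h1 := h.finrank_rhoImage_add_finrank_ruling (hW.subset hz).1
    rw [hr _ (hW.subset hz).1] at h1
    omega
  · intro p hp
    obtain ⟨z, hz, rfl⟩ := hp.1
    rw [hW.nullitySpace_eq h hm hmd hr hz]
    rcases (hloc z hz).2 with ⟨h1, -⟩ | ⟨-, -, h2⟩
    · exact absurd ((hbd z hz).1 hp) h1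
    · exact h2
  · rw [← hγ t]
    exact ⟨mem_image_of_mem _ (hW.zero_mem t ht), (hloc _ (hW.zero_mem t ht)).1⟩
  · conv_lhs => rw [← hγ t]
    exact hbd _ (hW.zero_mem t ht)
  · obtain ⟨z, hz, rfl⟩ := hp.1
    have hfr := (hbd z hz).1 hp
    refine ⟨z.1, ⟨(hW.subset hz).1, hfr⟩, ?_⟩
    -- The ruling segment from an end point of the curve to the given boundary point stays in the
    -- patch, by star-shapedness, and in the boundary, because its parameter is that end point.
    have hpre : IsPreconnected ((fun s : ℝ => ruledMap γ (z.1, s • z.2)) '' Icc 0 1) := by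
      refine isPreconnected_Icc.image _ (Continuous.continuousOn ?_)
      exact (continuous_const (y := γ z.1)).add (continuous_id.smul (continuous_const (y := z.2)))
    have hsub : (fun s : ℝ => ruledMap γ (z.1, s • z.2)) '' Icc 0 1 ⊆
        bdry m (ruledMap γ '' W) := by
      rintro _ ⟨s, hs, rfl⟩
      exact (hbd _ (hW.star z hz s hs)).2 hfr
    refine hpre.subset_connectedComponentIn ⟨0, by simp, ?_⟩ hsub ⟨1, by simp, ?_⟩
    · simp only [zero_smul, hγ]
    · simp only [one_smul]

end IsRuledPatch

end DevCauchy

/-! ### Tubes around the curve; existence and uniqueness of solutions -/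

namespace DevCauchy

open Set Filter Topology LocalFrame

variable {d m : ℕ} {I : Set ℝ} {γ : ℝ → Euc d} {D : ℝ → Submodule ℝ (Euc d)} {M : Set (Euc d)}
  {t₁ : ℝ} {W : Set (ℝ × Euc d)}

/-- The ruled map is injective on `A`, with continuous inverse. -/
def EmbeddedOn (γ : ℝ → Euc d) (A : Set (ℝ × Euc d)) : Prop :=
  ∀ z ∈ A, ∀ O ∈ 𝓝 z, ∃ V ∈ 𝓝 (ruledMap γ z), ∀ z' ∈ A, ruledMap γ z' ∈ V → z' ∈ O

theorem EmbeddedOn.mono {A B : Set (ℝ × Euc d)} (h : EmbeddedOn γ B) (hAB : A ⊆ B) :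
    EmbeddedOn γ A := fun z hz O hO => by
  obtain ⟨V, hV, h1⟩ := h z (hAB hz) O hO
  exact ⟨V, hV, fun z' hz' => h1 z' (hAB hz')⟩

/-- The part of the ruling bundle within distance `e` of `(t, 0)`. -/
def ruledBall (I : Set ℝ) (γ : ℝ → Euc d) (D : ℝ → Submodule ℝ (Euc d)) (t e : ℝ) :
    Set (ℝ × Euc d) :=
  {z | z ∈ ruledDomain I D ∧ ‖γ z.1 - γ t‖ < e ∧ ‖z.2‖ < e}

/-- The part of the ruling bundle consisting of the vectors of length less than `ε`. -/
def ruledTube (I : Set ℝ) (D : ℝ → Submodule ℝ (Euc d)) (ε : ℝ → ℝ) : Set (ℝ × Euc d) :=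
  {z | z ∈ ruledDomain I D ∧ ‖z.2‖ < ε z.1}

/-- Ruled balls measure the distance of the points of `γ`, not of the parameters. As `γ` is a
homeomorphism onto its image, small ruled balls are small in the parameter too. -/
theorem CauchyData.exists_ruledBall (h : CauchyData m I γ D) (ht₁ : t₁ ∈ I)
    {Q : ℝ × Euc d → Prop} (hQ : ∀ᶠ z in 𝓝 (t₁, (0 : Euc d)), z ∈ ruledDomain I D → Q z) :
    ∃ ρ > 0, ∀ z ∈ ruledBall I γ D t₁ ρ, Q z := by
  obtain ⟨ρ, hρ, hball⟩ := Metric.mem_nhds_iff.1 hQ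
  obtain ⟨η, hη, hdist⟩ := h.exists_dist_lt ht₁ hρ
  refine ⟨min ρ η, lt_min hρ hη, fun z hz => hball ?_ hz.1⟩
  rw [Metric.mem_ball, Prod.dist_eq, max_lt_iff, Real.dist_eq, dist_zero_right]
  exact ⟨hdist _ hz.1.1 (hz.2.1.trans_le (min_le_right _ _)), hz.2.2.trans_le (min_le_left _ _)⟩

theorem CauchyData.exists_embeddedOn (h : CauchyData m I γ D) (hm : 0 < m) (hmd : m ≤ d)
    (hr : ∀ t ∈ I, rhoRank I D t = 1) (ht₁ : t₁ ∈ I) :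
    ∃ ρ > 0, EmbeddedOn γ (ruledBall I γ D t₁ ρ) := by
  obtain ⟨δ, c, F, -, hF⟩ := h.exists_localFrame hm hr ht₁ one_pos
  let i₀ : Fin d := ⟨0, by omega⟩
  have hi₀ : i₀.val = 0 := rfl
  have hθ : (1 : ℝ) = 1 ∨ (1 : ℝ) = -1 := Or.inl rfl
  obtain ⟨Ψ, -, hΨs, hΨ⟩ := hF.exists_chart h hm hr hi₀ hθ (zero_mem _) (h.immersedAt_zero ht₁)
  have hev : ∀ᶠ z in 𝓝 (t₁, (0 : Euc d)), z ∈ ruledDomain I D →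
      |z.1 - t₁| < δ ∧ frameCoord m i₀ t₁ 1 F z ∈ Ψ.source := by
    have h1 : Continuous fun z : ℝ × Euc d => |z.1 - t₁| := by fun_prop
    have h2 : |t₁ - t₁| < δ := by simpa using hF.pos
    filter_upwards [(h1.tendsto (t₁, 0)).eventually_lt_const h2,
      (continuous_frameCoord hF.smooth_frame).continuousAt.eventually_mem
        (Ψ.open_source.mem_nhds hΨs)] with z h3 h4 _ using ⟨h3, h4⟩
  obtain ⟨ρ, hρ, hball⟩ := h.exists_ruledBall ht₁ hev
  -- A continuous left inverse of the ruled map, read off from the chart coordinates.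
  let K : Euc d → ℝ × Euc d := fun q =>
    (t₁ + 1 * Ψ.symm q i₀, rulingPart m F (t₁ + 1 * Ψ.symm q i₀) (Ψ.symm q))
  have hKz : ∀ z ∈ ruledBall I γ D t₁ ρ, ruledMap γ z ∈ Ψ.target ∧ K (ruledMap γ z) = z := by
    intro z hz
    obtain ⟨h1, h2⟩ := hball z hz
    have h3 : Ψ (frameCoord m i₀ t₁ 1 F z) = ruledMap γ z := by
      rw [hΨ]; exact hF.frameMap_frameCoord hm hi₀ hθ hz.1.1 h1 hz.1.2
    refine ⟨h3 ▸ Ψ.map_source h2, ?_⟩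
    simp only [K, ← h3, Ψ.left_inv h2, param_frameCoord hθ]
    rw [hF.rulingPart_frameCoord hi₀ hz.1.1 h1 hz.1.2]
  refine ⟨ρ, hρ, fun z hz O hO => ⟨K ⁻¹' O, ?_, fun z' hz' hV => ?_⟩⟩
  · have h1 : Continuous fun w : Euc d => t₁ + 1 * w i₀ := by fun_prop
    have h2 : Continuous fun w : Euc d => (t₁ + 1 * w i₀, rulingPart m F (t₁ + 1 * w i₀) w) :=
      h1.prodMk (hF.continuous_rulingPart.comp (h1.prodMk continuous_id))
    have h3 : ContinuousAt K (ruledMap γ z) :=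
      h2.continuousAt.comp (Ψ.continuousAt_symm (hKz z hz).1)
    apply h3.preimage_mem_nhds
    rwa [(hKz z hz).2]
  · rw [← (hKz z' hz').2]
    exact hV

theorem CauchyData.exists_immersedAt (h : CauchyData m I γ D) (ht₁ : t₁ ∈ I) :
    ∃ ρ > 0, ∀ z ∈ ruledBall I γ D t₁ ρ, ImmersedAt I γ D z.1 z.2 := by
  apply h.exists_ruledBall ht₁
  have hfst : Tendsto (fun z : ℝ × Euc d => z.1) (𝓝[ruledDomain I D] (t₁, (0 : Euc d)))
      (𝓝[I] t₁) := continuous_fst.continuousWithinAt.tendsto_nhdsWithin fun z hz => hz.1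
  have hsnd : Tendsto (fun z : ℝ × Euc d => z.2) (𝓝[ruledDomain I D] (t₁, (0 : Euc d)))
      (𝓝 0) := continuous_snd.continuousWithinAt
  have hu := h.smoothNear_unitConormal ht₁
  have h1 := (hu.continuousWithinAt ht₁).tendsto.comp hfst
  have h2 := ((h.smoothNear_velocity ht₁).continuousWithinAt ht₁).tendsto.comp hfst
  have h3 := ((hu.covDeriv h.uniqueDiffOn).continuousWithinAt ht₁).tendsto.comp hfst
  exact eventually_nhdsWithin_iff.1
    (((h1.inner h2).sub (h3.inner hsnd)).eventually_ne (h.immersedAt_zero ht₁))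

/-- The supremum of the admissible radii, capped at one, is 1-Lipschitz with respect to the distance
of the points of `γ`, hence continuous. A quarter of it leaves room for a ball of radius `3 ε`. -/
theorem CauchyData.exists_radius (h : CauchyData m I γ D) {P : Set (ℝ × Euc d) → Prop}
    (hP : ∀ A B, P B → A ⊆ B → P A) (hloc : ∀ t ∈ I, ∃ e > 0, P (ruledBall I γ D t e)) :
    ∃ ε : ℝ → ℝ, ContinuousOn ε I ∧ (∀ t ∈ I, 0 < ε t) ∧
      (∀ t ∈ I, ∀ t' ∈ I, ε t ≤ ε t' + ‖γ t - γ t'‖ / 4) ∧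
      ∀ t ∈ I, P (ruledBall I γ D t (3 * ε t)) := by
  let S : ℝ → Set ℝ := fun t => {e | e ≤ 1 ∧ P (ruledBall I γ D t e)}
  have hbdd : ∀ t, BddAbove (S t) := fun t => ⟨1, fun e he => he.1⟩
  have hpos : ∀ t ∈ I, ∃ e ∈ S t, 0 < e := fun t ht => by
    obtain ⟨e, he, hPe⟩ := hloc t ht
    exact ⟨min e 1, ⟨min_le_right _ _, hP _ _ hPe fun z hz => ⟨hz.1, hz.2.1.trans_le (min_le_left _ _),
      hz.2.2.trans_le (min_le_left _ _)⟩⟩, lt_min he one_pos⟩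
  have hG : ∀ t ∈ I, 0 < sSup (S t) := fun t ht => by
    obtain ⟨e, he, he0⟩ := hpos t ht
    exact he0.trans_le (le_csSup (hbdd t) he)
  have hlip : ∀ t ∈ I, ∀ t' ∈ I, sSup (S t) ≤ sSup (S t') + ‖γ t - γ t'‖ := by
    intro t ht t' ht'
    obtain ⟨e₀, he₀, -⟩ := hpos t ht
    refine csSup_le ⟨e₀, he₀⟩ fun e he => ?_
    rw [← sub_le_iff_le_add]
    refine le_csSup (hbdd t') ⟨by linarith [he.1, norm_nonneg (γ t - γ t')],
      hP _ _ he.2 fun z hz => ⟨hz.1, ?_, ?_⟩⟩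
    · have h1 := norm_sub_le_norm_sub_add_norm_sub (γ z.1) (γ t') (γ t)
      rw [norm_sub_rev (γ t') (γ t)] at h1
      linarith [hz.2.1]
    · linarith [hz.2.2, norm_nonneg (γ t - γ t')]
  refine ⟨fun t => sSup (S t) / 4, fun t ht => ?_, fun t ht => by linarith [hG t ht],
    fun t ht t' ht' => by linarith [hlip t ht t' ht'], fun t ht => ?_⟩
  · have h1 : Tendsto (fun s => ‖γ s - γ t‖) (𝓝[I] t) (𝓝 0) := by
      have := ((h.continuousOn_curve t ht).sub continuousWithinAt_const).norm (a := t)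
        (f := fun s => γ s - γ t)
      simpa [ContinuousWithinAt] using this
    refine tendsto_iff_dist_tendsto_zero.2 (squeeze_zero' (Eventually.of_forall fun _ => dist_nonneg)
      ?_ h1)
    filter_upwards [self_mem_nhdsWithin] with s hs
    rw [Real.dist_eq, abs_le]
    have h2 := hlip s hs t ht
    have h3 := hlip t ht s hs
    rw [norm_sub_rev] at h3
    constructor <;> linarith [norm_nonneg (γ s - γ t)]
  · obtain ⟨e₀, he₀, -⟩ := hpos t ht
    obtain ⟨e, he, hlt⟩ := exists_lt_of_lt_csSup ⟨e₀, he₀⟩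
      (show 3 * (sSup (S t) / 4) < sSup (S t) by linarith [hG t ht])
    exact hP _ _ he.2 fun z hz => ⟨hz.1, hz.2.1.trans hlt, hz.2.2.trans hlt⟩

/-- A tubular neighbourhood of the zero section on which the ruled map is an embedded immersion
and a given local property holds. -/
theorem CauchyData.exists_tube (h : CauchyData m I γ D) (hm : 0 < m) (hmd : m ≤ d)
    (hr : ∀ t ∈ I, rhoRank I D t = 1) {Q : ℝ × Euc d → Prop}
    (hQ : ∀ t ∈ I, ∃ ρ > 0, ∀ z ∈ ruledBall I γ D t ρ, Q z) :
    ∃ ε : ℝ → ℝ, ContinuousOn ε I ∧ (∀ t ∈ I, 0 < ε t) ∧ EmbeddedOn γ (ruledTube I D ε) ∧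
      ∀ z ∈ ruledTube I D ε, ImmersedAt I γ D z.1 z.2 ∧ Q z := by
  obtain ⟨ε, hε, hpos, hlip, hball⟩ := h.exists_radius
    (P := fun A => EmbeddedOn γ A ∧ ∀ z ∈ A, ImmersedAt I γ D z.1 z.2 ∧ Q z)
    (fun A B hB hAB => ⟨hB.1.mono hAB, fun z hz => hB.2 z (hAB hz)⟩) (fun t ht => by
      obtain ⟨e₁, he₁, h1⟩ := h.exists_embeddedOn hm hmd hr ht
      obtain ⟨e₂, he₂, h2⟩ := h.exists_immersedAt ht
      obtain ⟨e₃, he₃, h3⟩ := hQ t ht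
      have hsub : ∀ {e e' : ℝ}, e ≤ e' → ruledBall I γ D t e ⊆ ruledBall I γ D t e' :=
        fun hee z hz => ⟨hz.1, hz.2.1.trans_le hee, hz.2.2.trans_le hee⟩
      refine ⟨min e₁ (min e₂ e₃), lt_min he₁ (lt_min he₂ he₃), h1.mono (hsub (min_le_left _ _)),
        fun z hz => ⟨h2 z (hsub ((min_le_right _ _).trans (min_le_left _ _)) hz),
          h3 z (hsub ((min_le_right _ _).trans (min_le_right _ _)) hz)⟩⟩)
  have hmem : ∀ z ∈ ruledTube I D ε, z ∈ ruledBall I γ D z.1 (3 * ε z.1) := fun z hz => by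
    have := hpos _ hz.1.1
    exact ⟨hz.1, by rw [sub_self, norm_zero]; linarith, by linarith [hz.2]⟩
  refine ⟨ε, hε, hpos, fun z hz O hO => ?_, fun z hz => (hball _ hz.1.1).2 z (hmem z hz)⟩
  obtain ⟨V, hV, hVO⟩ := (hball _ hz.1.1).1 z (hmem z hz) O hO
  -- Let `g` be the distance of the two points of `γ`. Closeness of the images gives `g < ε(t) +
  -- ε(t') ≤ 2 ε(t) + g / 4`, so both `g` and `ε(t')` are below `3 ε(t)`: the two points lie in one
  -- ball on which the embedding is known.
  refine ⟨V ∩ Metric.ball (ruledMap γ z) (ε z.1 - ‖z.2‖),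
    inter_mem hV (Metric.ball_mem_nhds _ (by linarith [hz.2])), fun z' hz' hV' => ?_⟩
  refine hVO z' ?_ hV'.1
  have h1 := hV'.2
  rw [Metric.mem_ball, dist_eq_norm] at h1
  have h2 : ‖γ z'.1 - γ z.1‖ ≤ ‖ruledMap γ z' - ruledMap γ z‖ + ‖z'.2‖ + ‖z.2‖ := by
    have : γ z'.1 - γ z.1 = ruledMap γ z' - ruledMap γ z - z'.2 + z.2 := by
      unfold ruledMap; abel
    rw [this]
    exact (norm_add_le _ _).trans (add_le_add_left (norm_sub_le _ _) _)
  have h3 := hlip _ hz'.1.1 _ hz.1.1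
  have h4 := hz'.2
  have h5 := hpos _ hz.1.1
  exact ⟨hz'.1, by linarith, by linarith⟩

theorem ruledTube_relOpen {ε : ℝ → ℝ} (hε : ContinuousOn ε I) {z : ℝ × Euc d}
    (hz : z ∈ ruledTube I D ε) : ∀ᶠ z' in 𝓝 z, z' ∈ ruledDomain I D → z' ∈ ruledTube I D ε := by
  have hfst : Tendsto (fun z : ℝ × Euc d => z.1) (𝓝[ruledDomain I D] z) (𝓝[I] z.1) :=
    continuous_fst.continuousWithinAt.tendsto_nhdsWithin fun z hz => hz.1
  have h1 := (hε z.1 hz.1.1).tendsto.comp hfst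
  have h2 : Tendsto (fun z : ℝ × Euc d => ‖z.2‖) (𝓝[ruledDomain I D] z) (𝓝 ‖z.2‖) :=
    (continuous_norm.comp continuous_snd).continuousWithinAt
  have h3 := eventually_nhdsWithin_iff.1 (h2.eventually_lt h1 hz.2)
  filter_upwards [h3] with z' hz' hd using ⟨hd, hz' hd⟩

theorem isRuledPatch_ruledTube {ε : ℝ → ℝ} (hε : ContinuousOn ε I) (hpos : ∀ t ∈ I, 0 < ε t)
    (hemb : EmbeddedOn γ (ruledTube I D ε))
    (himm : ∀ z ∈ ruledTube I D ε, ImmersedAt I γ D z.1 z.2) :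
    IsRuledPatch I γ D (ruledTube I D ε) where
  subset _ hz := hz.1
  relOpen _ hz := ruledTube_relOpen hε hz
  zero_mem t ht := ⟨⟨ht, zero_mem _⟩, by simpa using hpos t ht⟩
  star z hz s hs := by
    refine ⟨⟨hz.1.1, Submodule.smul_mem _ _ hz.1.2⟩, lt_of_le_of_lt ?_ hz.2⟩
    rw [norm_smul, Real.norm_eq_abs, abs_of_nonneg hs.1]
    exact mul_le_of_le_one_left (norm_nonneg _) hs.2
  immersed := himm
  embedded := hemb

/-- Around a solution there is a tube such that, for any neighbourhood `W` of the zero section in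
it, the solution is the image of `W` near the curve. -/
theorem IsSolution.exists_tube (h : CauchyData m I γ D) (hm : 0 < m) (hmd : m ≤ d)
    (hM : IsSolution m I γ D M) :
    ∃ ε : ℝ → ℝ, ContinuousOn ε I ∧ (∀ t ∈ I, 0 < ε t) ∧ EmbeddedOn γ (ruledTube I D ε) ∧
      (∀ z ∈ ruledTube I D ε, ImmersedAt I γ D z.1 z.2) ∧
      ∀ W ⊆ ruledTube I D ε, (∀ z ∈ W, ∀ᶠ z' in 𝓝 z, z' ∈ ruledDomain I D → z' ∈ W) →
        ∃ U, IsOpen U ∧ ruledMap γ '' W ⊆ U ∧ M ∩ U = ruledMap γ '' W := by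
  obtain ⟨ε, hε, hpos, hemb, hQ⟩ := h.exists_tube hm hmd
    (fun t ht => (hM.rank_and_nullity h hm hmd ht).1)
    (Q := fun z => ruledMap γ z ∈ M ∧ ∀ η > 0, ∀ᶠ q in 𝓝 (ruledMap γ z), q ∈ M →
      ∃ s ∈ I, ∃ x ∈ ruling I D s, |s - z.1| < η ∧ ‖x - z.2‖ < η ∧ q = γ s + x) (fun t ht => by
      obtain ⟨ρ, hρ, h1⟩ := hM.exists_rulings_near h hm hmd ht
      exact ⟨ρ, hρ, fun z hz => h1 z.1 hz.1.1 hz.2.1 z.2 hz.1.2 hz.2.2⟩)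
  refine ⟨ε, hε, hpos, hemb, fun z hz => (hQ z hz).1, fun W hW hopen => ?_⟩
  -- Near a point of a ruling the solution has only points `γ s + x` with `(s, x)` close to the
  -- given pair. Relative openness of `W` puts this pair in `W`.
  have hsub : ruledMap γ '' W ⊆ interior {q | q ∈ M → q ∈ ruledMap γ '' W} := by
    rintro _ ⟨z, hz, rfl⟩
    obtain ⟨η, hη, hball⟩ := Metric.mem_nhds_iff.1 (hopen z hz)
    rw [mem_interior_iff_mem_nhds]
    filter_upwards [(hQ z (hW hz)).2.2 η hη] with q hq hqM
    obtain ⟨s, hs, x, hx, h1, h2, rfl⟩ := hq hqM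
    refine ⟨(s, x), hball ?_ ⟨hs, hx⟩, rfl⟩
    rw [Metric.mem_ball, Prod.dist_eq, max_lt_iff, Real.dist_eq, dist_eq_norm]
    exact ⟨h1, h2⟩
  refine ⟨_, isOpen_interior, hsub, Subset.antisymm ?_ ?_⟩
  · exact fun q hq => interior_subset hq.2 hq.1
  · rintro q hq
    refine ⟨?_, hsub hq⟩
    obtain ⟨z, hz, rfl⟩ := hq
    exact (hQ z (hW hz)).2.1

theorem curve_subset_image (hW : IsRuledPatch I γ D W) : γ '' I ⊆ ruledMap γ '' W := by
  rintro _ ⟨t, ht, rfl⟩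
  exact ⟨(t, 0), hW.zero_mem t ht, add_zero _⟩

/-- Existence of solutions of the geometric Cauchy problem. -/
theorem CauchyData.exists_solution_iff (h : CauchyData m I γ D) (hm : 0 < m) (hmd : m ≤ d) :
    (∃ M, IsSolution m I γ D M) ↔ ∀ t ∈ I, rhoRank I D t = 1 := by
  refine ⟨fun ⟨M, hM⟩ t ht => (hM.rank_and_nullity h hm hmd ht).1, fun hr => ?_⟩
  obtain ⟨ε, hε, hpos, hemb, himm⟩ := h.exists_tube hm hmd hr (Q := fun _ => True)
    (fun _ _ => ⟨1, one_pos, fun _ _ => trivial⟩)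
  exact ⟨_, (isRuledPatch_ruledTube hε hpos hemb fun z hz => (himm z hz).1).isSolution h hm hmd hr⟩

/-- Two solutions coincide near the curve. -/
theorem IsSolution.eq_near (h : CauchyData m I γ D) (hm : 0 < m) (hmd : m ≤ d)
    {M₁ M₂ : Set (Euc d)} (h₁ : IsSolution m I γ D M₁) (h₂ : IsSolution m I γ D M₂) :
    ∃ U, IsOpen U ∧ γ '' I ⊆ U ∧ M₁ ∩ U = M₂ ∩ U := by
  obtain ⟨ε₁, hε₁, hpos₁, hemb₁, himm₁, hU₁⟩ := h₁.exists_tube h hm hmd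
  obtain ⟨ε₂, hε₂, hpos₂, -, -, hU₂⟩ := h₂.exists_tube h hm hmd
  have hs₁ : ruledTube I D (fun t => min (ε₁ t) (ε₂ t)) ⊆ ruledTube I D ε₁ :=
    fun z hz => ⟨hz.1, hz.2.trans_le (min_le_left _ _)⟩
  have hs₂ : ruledTube I D (fun t => min (ε₁ t) (ε₂ t)) ⊆ ruledTube I D ε₂ :=
    fun z hz => ⟨hz.1, hz.2.trans_le (min_le_right _ _)⟩
  have hε : ContinuousOn (fun t => min (ε₁ t) (ε₂ t)) I := fun t ht =>
    Filter.Tendsto.min (hε₁ t ht) (hε₂ t ht)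
  have hW := isRuledPatch_ruledTube hε (fun t ht => lt_min (hpos₁ t ht) (hpos₂ t ht))
    (hemb₁.mono hs₁) (fun z hz => himm₁ z (hs₁ hz))
  -- The thinner of the two tubes is admissible for both solutions, so each coincides near the curve
  -- with its image.
  obtain ⟨U₁, hUo₁, hsub₁, heq₁⟩ := hU₁ _ hs₁ hW.relOpen
  obtain ⟨U₂, hUo₂, hsub₂, heq₂⟩ := hU₂ _ hs₂ hW.relOpen
  refine ⟨U₁ ∩ U₂, hUo₁.inter hUo₂,
    (curve_subset_image hW).trans (subset_inter hsub₁ hsub₂), ?_⟩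
  rw [← inter_assoc, heq₁, inter_comm U₁, ← inter_assoc, heq₂, inter_eq_left.2 hsub₁,
    inter_eq_left.2 hsub₂]

/-- Near the curve a solution is the union of the rulings. -/
theorem IsSolution.eq_rulings_near (h : CauchyData m I γ D) (hm : 0 < m) (hmd : m ≤ d)
    (hM : IsSolution m I γ D M) :
    ∃ (U : Set (Euc d)) (ε : ℝ → ℝ), IsOpen U ∧ γ '' I ⊆ U ∧ ContinuousOn ε I ∧
      (∀ t ∈ I, 0 < ε t) ∧ M ∩ U = {p | ∃ t ∈ I, ∃ x ∈ D t ⊓ (rhoImage I D t)ᗮ,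
        ‖x‖ < ε t ∧ p = γ t + x} := by
  obtain ⟨ε, hε, hpos, hemb, himm, hU⟩ := hM.exists_tube h hm hmd
  have hW := isRuledPatch_ruledTube hε hpos hemb himm
  obtain ⟨U, hUo, hsub, heq⟩ := hU _ Subset.rfl hW.relOpen
  refine ⟨U, ε, hUo, (curve_subset_image hW).trans hsub, hε, hpos, ?_⟩
  rw [heq]
  ext p
  constructor
  · rintro ⟨z, hz, rfl⟩
    exact ⟨z.1, hz.1.1, z.2, hz.1.2, hz.2, rfl⟩
  · rintro ⟨t, ht, x, hx, hxε, rfl⟩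
    exact ⟨(t, x), ⟨⟨ht, hx⟩, hxε⟩, rfl⟩

end DevCauchy

namespace DevCauchy

open Set Filter Topology

/-! ### Adapted frames over a compact interval -/

variable {d m : ℕ} {I : Set ℝ} {γ : ℝ → Euc d} {D : ℝ → Submodule ℝ (Euc d)}

/-- On a closed interval it is enough to continue `f` beyond each end point by the extension of its
germ there. -/
theorem smoothAlong_Icc_of_smoothNear {V : Type*} [NormedAddCommGroup V] [NormedSpace ℝ V]
    {a b : ℝ} (hab : a < b) {f : ℝ → V} (h : ∀ t ∈ Icc a b, SmoothNear (Icc a b) f t) :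
    SmoothAlong (Icc a b) f := by
  obtain ⟨ga, hga, hfa⟩ := h a (left_mem_Icc.2 hab.le)
  obtain ⟨gb, hgb, hfb⟩ := h b (right_mem_Icc.2 hab.le)
  let g : ℝ → V := fun t => if t < a then ga t else if b < t then gb t else f t
  have hgI : ∀ t ∈ Icc a b, g t = f t := fun t ht => by
    simp [g, not_lt.2 ht.1, not_lt.2 ht.2]
  have key : ∀ t, ∃ k : ℝ → V, ContDiff ℝ ∞ k ∧ g =ᶠ[𝓝 t] k := by
    intro t
    rcases lt_trichotomy t a with hta | rfl | hta
    · refine ⟨ga, hga, ?_⟩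
      filter_upwards [Iio_mem_nhds hta] with s hs
      simp [g, mem_Iio.1 hs]
    · refine ⟨ga, hga, ?_⟩
      filter_upwards [eventually_nhdsWithin_iff.1 hfa, Iio_mem_nhds hab] with s hs hsb
      by_cases hst : s < t
      · simp [g, hst]
      · have : s ∈ Icc t b := ⟨not_lt.1 hst, (mem_Iio.1 hsb).le⟩
        rw [hgI s this, hs this]
    rcases lt_trichotomy t b with htb | rfl | htb
    · obtain ⟨k, hk, hfk⟩ := h t ⟨hta.le, htb.le⟩
      refine ⟨k, hk, ?_⟩
      filter_upwards [eventually_nhdsWithin_iff.1 hfk, Icc_mem_nhds hta htb] with s hs hsI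
      rw [hgI s hsI, hs hsI]
    · refine ⟨gb, hgb, ?_⟩
      filter_upwards [eventually_nhdsWithin_iff.1 hfb, Ioi_mem_nhds hab] with s hs hsa
      by_cases hst : t < s
      · simp [g, hst, not_lt.2 (hab.trans hst).le]
      · have : s ∈ Icc a t := ⟨(mem_Ioi.1 hsa).le, not_lt.1 hst⟩
        rw [hgI s this, hs this]
    · refine ⟨gb, hgb, ?_⟩
      filter_upwards [Ioi_mem_nhds htb] with s hs
      simp [g, mem_Ioi.1 hs, not_lt.2 (hab.trans hs).le]
  refine ⟨univ, g, isOpen_univ, subset_univ _, fun t _ => ?_, fun t ht => (hgI t ht).symm⟩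
  obtain ⟨k, hk, hgk⟩ := key t
  exact (hk.contDiffAt.congr_of_eventuallyEq hgk).contDiffWithinAt

/-- `e` is a smooth orthonormal frame of `D` over `J` whose first member is the velocity. -/
def FrameOn (hm : 0 < m) (I : Set ℝ) (γ : ℝ → Euc d) (D : ℝ → Submodule ℝ (Euc d)) (J : Set ℝ)
    (e : Fin m → ℝ → Euc d) : Prop :=
  ∀ t ∈ J, (∀ i, SmoothNear I (e i) t) ∧ Orthonormal ℝ (fun i => e i t) ∧ (∀ i, e i t ∈ D t) ∧
    e ⟨0, hm⟩ t = covDeriv I γ t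

theorem FrameOn.mono {hm : 0 < m} {J J' : Set ℝ} {e : Fin m → ℝ → Euc d}
    (h : FrameOn hm I γ D J' e) (hJ : J ⊆ J') : FrameOn hm I γ D J e := fun t ht => h t (hJ ht)

theorem FrameOn.starProjection_eq_sum {hm : 0 < m} (hD : IsDistribution m I D) {J : Set ℝ}
    {e : Fin m → ℝ → Euc d} (h : FrameOn hm I γ D J e) {t : ℝ} (ht : t ∈ J) (htI : t ∈ I)
    {x : Euc d} (hx : x ∈ D t) : x = ∑ i, (inner ℝ (e i t) x) • e i t := by
  obtain ⟨-, h1, h2, -⟩ := h t ht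
  have := DevCauchy.starProjection_eq_sum h1
    (span_range_eq_of_orthonormal (hD.finrank_eq htI) h1 h2) x
  rwa [Submodule.starProjection_eq_self_iff.2 hx] at this

/-- `χ` passes from the identity to the constant `x - δ / 2` by convex combination. It serves to
continue a change of frames beyond the interval on which both frames are defined. -/
theorem exists_smooth_retraction {x δ : ℝ} (hδ : 0 < δ) :
    ∃ χ : ℝ → ℝ, ContDiff ℝ ∞ χ ∧ (∀ t ≤ x - 2 * δ / 3, χ t = t) ∧
      ∀ t > x - δ, χ t ∈ Ioo (x - δ) x := by
  let ψ : ℝ → ℝ := fun t => Real.smoothTransition (3 / δ * (t - (x - 2 * δ / 3)))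
  have hψ0 : ∀ t, 0 ≤ ψ t := fun t => Real.smoothTransition.nonneg _
  have hψ1 : ∀ t, ψ t ≤ 1 := fun t => Real.smoothTransition.le_one _
  refine ⟨fun t => t + ψ t * (x - δ / 2 - t), ?_, fun t ht => ?_, fun t ht => ?_⟩
  · have h1 : ContDiff ℝ ∞ ψ := Real.smoothTransition.contDiff.comp
      (contDiff_const.mul (contDiff_id.sub contDiff_const))
    exact contDiff_id.add (h1.mul (contDiff_const.sub contDiff_id))
  · have : ψ t = 0 := Real.smoothTransition.zero_of_nonpos
      (mul_nonpos_of_nonneg_of_nonpos (by positivity) (by linarith))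
    simp [this]
  · by_cases hlt : x - δ / 3 ≤ t
    · have : ψ t = 1 := Real.smoothTransition.one_of_one_le (by
        rw [div_mul_eq_mul_div, le_div_iff₀ hδ]; linarith)
      simp only [this, one_mul]
      constructor <;> linarith
    · rw [not_le] at hlt
      have h1 : (fun t => t + ψ t * (x - δ / 2 - t)) t =
          (1 - ψ t) * t + ψ t * (x - δ / 2) := by simp only; ring
      rw [mem_Ioo, h1]
      constructor
      · nlinarith [hψ0 t, hψ1 t]
      · nlinarith [hψ0 t, hψ1 t]

theorem SmoothNear.comp_smooth {V : Type*} [NormedAddCommGroup V] [NormedSpace ℝ V] {f : ℝ → V}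
    {χ : ℝ → ℝ} (hχ : ContDiff ℝ ∞ χ) {t : ℝ} (hf : SmoothNear I f (χ t))
    (hmap : ∀ᶠ s in 𝓝 t, χ s ∈ I) : SmoothNear I (fun s => f (χ s)) t := by
  obtain ⟨g, hg, hfg⟩ := hf
  refine ⟨fun s => g (χ s), hg.comp hχ, ?_⟩
  have h1 : Tendsto χ (𝓝[I] t) (𝓝[I] χ t) := tendsto_nhdsWithin_iff.2
    ⟨hχ.continuous.continuousAt.tendsto.mono_left nhdsWithin_le_nhds,
      hmap.filter_mono nhdsWithin_le_nhds⟩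
  exact h1.eventually hfg

/-- On the overlap `e` is obtained from `f` by an orthogonal matrix `A` that fixes the first member,
the velocity. Beyond it `A` is replaced by `A ∘ χ`, which keeps these properties because `χ` takes
values in the overlap. -/
theorem FrameOn.glue {hm : 0 < m} (hD : IsDistribution m I D) {a x δ : ℝ} (hδ : 0 < δ)
    (haδ : a ≤ x - δ) {J : Set ℝ}
    (hJI : J ⊆ I) (hJ : Icc (x - δ) x ⊆ J) {e f : Fin m → ℝ → Euc d}
    (he : FrameOn hm I γ D (Icc a x) e) (hf : FrameOn hm I γ D J f) :
    ∃ E, FrameOn hm I γ D (Icc a x ∪ J ∩ Ici x) E := by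
  obtain ⟨χ, hχ, hχid, hχm⟩ := exists_smooth_retraction (x := x) hδ
  let A : Fin m → Fin m → ℝ → ℝ := fun i j s => inner ℝ (f i s) (e j s)
  let E : Fin m → ℝ → Euc d := fun j t =>
    if t ≤ x - 2 * δ / 3 then e j t else ∑ i, A i j (χ t) • f i t
  have hov : ∀ s ∈ Icc (x - δ) x, s ∈ Icc a x ∧ s ∈ J := fun s hs =>
    ⟨⟨haδ.trans hs.1, hs.2⟩, hJ hs⟩
  -- Between `x - δ` and `x - 2 δ / 3` the map `χ` is the identity, and the sum is the expansion of
  -- `e j t` in the frame `f`.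
  have hEsum : ∀ j, ∀ t > x - δ, t ∈ I → E j t = ∑ i, A i j (χ t) • f i t := by
    intro j t ht htI
    by_cases htx : t ≤ x - 2 * δ / 3
    · have ho := hov t ⟨ht.le, by linarith⟩
      simp only [E, htx, if_true, hχid t htx, A]
      exact hf.starProjection_eq_sum hD ho.2 htI ((he t ho.1).2.2.1 j)
    · simp [E, htx]
  refine ⟨E, fun t ht => ?_⟩
  by_cases htx : t < x - 2 * δ / 3
  · have ht' : t ∈ Icc a x := ht.resolve_right fun h => by linarith [mem_Ici.1 h.2]
    obtain ⟨h1, h2, h3, h4⟩ := he t ht'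
    have hEe : ∀ j, E j t = e j t := fun j => by simp [E, htx.le]
    refine ⟨fun i => (h1 i).congr ?_, by simpa only [hEe] using h2, fun i => by
      rw [hEe]; exact h3 i, by rw [hEe]; exact h4⟩
    filter_upwards [nhdsWithin_le_nhds (Iio_mem_nhds htx)] with s hs
    simp [E, (mem_Iio.1 hs).le]
  · rw [not_lt] at htx
    have htδ : t > x - δ := by linarith
    have htJ : t ∈ J := by
      rcases ht with h | h
      · exact hJ ⟨htδ.le, h.2⟩
      · exact h.1
    have htI := hJI htJ
    have hEt : ∀ j, E j t = ∑ i, A i j (χ t) • f i t := fun j => hEsum j t htδ htI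
    obtain ⟨h1, h2, h3, h4⟩ := hf t htJ
    have hχt := hov _ ⟨(hχm t htδ).1.le, (hχm t htδ).2.le⟩
    have hχI := hJI hχt.2
    obtain ⟨k1, k2, k3, k4⟩ := he _ hχt.1
    obtain ⟨l1, l2, l3, l4⟩ := hf _ hχt.2
    refine ⟨fun j => ?_, ?_, fun j => ?_, ?_⟩
    · have hev : ∀ᶠ s in 𝓝 t, χ s ∈ I := by
        filter_upwards [Ioi_mem_nhds htδ] with s hs
        exact hJI (hov _ ⟨(hχm s hs).1.le, (hχm s hs).2.le⟩).2
      have h5 : SmoothNear I (fun s => ∑ i, A i j (χ s) • f i s) t :=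
        SmoothNear.sum fun i _ =>
          (SmoothNear.comp_smooth (f := A i j) hχ ((l1 i).inner (k1 j)) hev).smul (h1 i)
      refine h5.congr ?_
      filter_upwards [self_mem_nhdsWithin, nhdsWithin_le_nhds (Ioi_mem_nhds htδ)] with s hs hs'
      exact hEsum j s hs' hs
    · rw [orthonormal_iff_ite] at k2 ⊢
      intro j k
      rw [← k2 j k, hEt, hEt, h2.inner_sum]
      conv_rhs => rw [hf.starProjection_eq_sum hD hχt.2 hχI (k3 j),
        hf.starProjection_eq_sum hD hχt.2 hχI (k3 k)]
      rw [l2.inner_sum]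
    · rw [hEt]
      exact Submodule.sum_mem _ fun i _ => Submodule.smul_mem _ _ (h3 i)
    · rw [hEt, ← h4, Finset.sum_eq_single ⟨0, hm⟩]
      · simp only [A, k4, ← l4]
        rw [real_inner_self_eq_norm_sq, l2.1]
        simp
      · intro i _ hi
        simp only [A, k4, ← l4]
        rw [l2.2 hi, zero_smul]
      · simp

theorem CauchyData.exists_frameOn_nhds (h : CauchyData m I γ D) (hm : 0 < m)
    (hu : ∀ t ∈ I, ‖covDeriv I γ t‖ = 1) {t : ℝ} (ht : t ∈ I) :
    ∃ O : Set ℝ, IsOpen O ∧ t ∈ O ∧ ∃ f, FrameOn hm I γ D (I ∩ O) f := by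
  obtain ⟨F, hF, hev⟩ := h.distribution.exists_frame_of_unit_section hm ht
    (h.smoothNear_velocity ht) h.velocity_mem hu
  obtain ⟨O, hO, htO, hsub⟩ := mem_nhdsWithin.1 hev
  refine ⟨O, hO, htO, F, fun s hs => ?_⟩
  obtain ⟨h1, h2, h3⟩ := hsub ⟨hs.2, hs.1⟩
  exact ⟨fun i => ⟨F i, hF i, EventuallyEq.rfl⟩, h1,
    fun i => h2 ▸ Submodule.subset_span ⟨i, rfl⟩, h3⟩

/-- The frame is continued from left to right through a finite subdivision of the interval, each
piece of which carries a local frame. -/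
theorem CauchyData.exists_adaptedFrame {a b : ℝ} (hab : a < b) (h : CauchyData m (Icc a b) γ D)
    (hm : 0 < m) (hu : ∀ t ∈ Icc a b, ‖covDeriv (Icc a b) γ t‖ = 1) :
    ∃ E : Fin m → ℝ → Euc d, IsAdaptedFrame (Icc a b) γ D E := by
  choose O hO htO f hf using fun t : Icc a b => h.exists_frameOn_nhds hm hu t.2
  obtain ⟨τ, hτ0, hτ, ⟨n, hn⟩, hcov⟩ := exists_monotone_Icc_subset_open_cover_Icc hab.le
    (c := fun t : Icc a b => Subtype.val ⁻¹' O t)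
    (fun t => (hO t).preimage continuous_subtype_val)
    (fun t _ => mem_iUnion.2 ⟨t, htO t⟩)
  have key : ∀ k, ∃ e, FrameOn hm (Icc a b) γ D (Icc a (τ k : ℝ)) e := by
    intro k
    induction k with
    | zero =>
      obtain ⟨i, hi⟩ := hcov 0
      refine ⟨f i, (hf i).mono fun s hs => ?_⟩
      rw [hτ0] at hs
      have : s = a := le_antisymm hs.2 hs.1
      subst this
      refine ⟨left_mem_Icc.2 hab.le, ?_⟩
      have h2 := hi (left_mem_Icc.2 (hτ (Nat.le_succ 0)))
      rw [mem_preimage, hτ0] at h2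
      exact h2
    | succ k ih =>
      obtain ⟨e, he⟩ := ih
      obtain ⟨i, hi⟩ := hcov k
      have hle : (τ k : ℝ) ≤ τ (k + 1) := hτ (Nat.le_succ k)
      have hsub : ∀ s : ℝ, (τ k : ℝ) ≤ s → s ≤ τ (k + 1) → s ∈ Icc a b ∩ O i := fun s h1 h2 => by
        have hs : s ∈ Icc a b := ⟨(τ k).2.1.trans h1, h2.trans (τ (k + 1)).2.2⟩
        exact ⟨hs, hi (show (⟨s, hs⟩ : Icc a b) ∈ Icc (τ k) (τ (k + 1)) from ⟨h1, h2⟩)⟩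
      -- When `τ k = a` there is no room for an overlap on the left, and the local frame is taken
      -- alone.
      rcases eq_or_lt_of_le (τ k).2.1 with hak | hak
      · exact ⟨f i, (hf i).mono fun s hs => hsub s (hak ▸ hs.1) hs.2⟩
      · have hx := hsub _ le_rfl hle
        obtain ⟨ε, hε, hball⟩ := Metric.isOpen_iff.1 (hO i) _ hx.2
        -- The overlap must lie in `O i` and must not extend to the left of `a`.
        set δ := min (ε / 2) ((τ k : ℝ) - a) with hδ
        have hδ0 : 0 < δ := lt_min (by positivity) (by linarith)
        have hδ1 : δ ≤ ε / 2 := min_le_left _ _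
        have hδ2 : δ ≤ (τ k : ℝ) - a := min_le_right _ _
        obtain ⟨E, hE⟩ := he.glue h.distribution hδ0 (by linarith)
          (J := Icc a b ∩ O i) inter_subset_left
          (fun s hs => ⟨⟨by linarith [hs.1], hs.2.trans (τ k).2.2⟩, hball (by
            rw [Metric.mem_ball, Real.dist_eq, abs_lt]
            constructor <;> linarith [hs.1, hs.2])⟩) (hf i)
        refine ⟨E, hE.mono fun s hs => ?_⟩
        rcases le_total s (τ k) with hsk | hsk
        · exact Or.inl ⟨hs.1, hsk⟩
        · exact Or.inr ⟨hsub s hsk hs.2, hsk⟩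
  obtain ⟨E, hE⟩ := key n
  rw [hn n le_rfl] at hE
  refine ⟨E, fun i => smoothAlong_Icc_of_smoothNear hab fun t ht => (hE t ht).1 i, fun t ht => ?_⟩
  obtain ⟨-, h2, h3, h4⟩ := hE t ht
  refine ⟨h2, span_range_eq_of_orthonormal (h.distribution.finrank_eq ht) h2 h3, fun i hi => ?_⟩
  rw [← h4]
  congr 1
  exact Fin.ext hi

/-- The normal part of the acceleration qualifies: the tangential part of its derivative is
`conormal`. -/
theorem CauchyData.exists_admissibleNormal {a b : ℝ} (hab : a < b)
    (h : CauchyData m (Icc a b) γ D) : ∃ N, IsAdmissibleNormal (Icc a b) D N :=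
  ⟨normalAcc (Icc a b) γ D, ⟨smoothAlong_Icc_of_smoothNear hab fun _ ht => h.smoothNear_normalAcc ht,
    fun t _ => normalAcc_mem t⟩, fun _ ht => h.conormal_ne_zero ht⟩

theorem exists_eq_Icc_of_isCompact (hI : I.OrdConnected) (hI' : (interior I).Nonempty)
    (hc : IsCompact I) : ∃ a b, a < b ∧ I = Icc a b := by
  have hne : I.Nonempty := hI'.mono interior_subset
  have hI2 := eq_Icc_of_connected_compact ⟨hne, hI.isPreconnected⟩ hc
  refine ⟨sInf I, sSup I, ?_, hI2⟩
  by_contra hlt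
  obtain ⟨t, ht⟩ := hI'
  rw [hI2, interior_Icc] at ht
  exact hlt (ht.1.trans ht.2)

end DevCauchy

namespace DevCauchy

open Set Filter Topology

/-! ### The explicit parametrization -/

variable {d m : ℕ} {I : Set ℝ} {γ : ℝ → Euc d} {D : ℝ → Submodule ℝ (Euc d)} {M : Set (Euc d)}
  {E : Fin m → ℝ → Euc d} {N : ℝ → Euc d} {t : ℝ}

/-- The component `D_t E_1 · N` of the acceleration. -/
noncomputable def accComponent (hm : 0 < m) (I : Set ℝ) (E : Fin m → ℝ → Euc d) (N : ℝ → Euc d)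
    (t : ℝ) : ℝ :=
  inner ℝ (covDeriv I (E ⟨0, hm⟩) t) (N t)

/-- The coordinates of a vector `x` of the ruling with respect to the ruling fields. -/
noncomputable def rulingCoord (hm : 0 < m) (I : Set ℝ) (E : Fin m → ℝ → Euc d) (N : ℝ → Euc d)
    (z : ℝ × Euc d) (j : Fin (m - 1)) : ℝ :=
  -(accComponent hm I E N z.1)⁻¹ * inner ℝ (E ⟨j.val + 1, by have := j.isLt; omega⟩ z.1) z.2

theorem rulingField_eq (hm : 0 < m) (j : Fin (m - 1)) (t : ℝ) :
    rulingField I E N j t =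
      (inner ℝ (covDeriv I (E ⟨j.val + 1, by have := j.isLt; omega⟩) t) (N t)) • E ⟨0, hm⟩ t -
        accComponent hm I E N t • E ⟨j.val + 1, by have := j.isLt; omega⟩ t := rfl

/-- The derivative of `⟨N, E i⟩ = 0`. These are the coordinates of the generator of `Im ρ`, and the
coefficients of `rulingField` are chosen to make it orthogonal to that generator. -/
theorem IsAdaptedFrame.inner_conormal (h : CauchyData m I γ D) (hE : IsAdaptedFrame I γ D E)
    (hN : IsAdmissibleNormal I D N) (ht : t ∈ I) (i : Fin m) :
    inner ℝ ((D t).starProjection (covDeriv I N t)) (E i t) =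
      - inner ℝ (covDeriv I (E i) t) (N t) := by
  have hEt : ∀ s ∈ I, E i s ∈ D s := fun s hs => by
    rw [← (hE.2 s hs).2.1]; exact Submodule.subset_span ⟨i, rfl⟩
  have h1 := ((hN.1.1.differentiableWithinAt ht).hasDerivWithinAt.inner ℝ
    ((hE.1 i).differentiableWithinAt ht).hasDerivWithinAt).derivWithin (h.uniqueDiffOn t ht)
  have h2 : EqOn (fun s => inner ℝ (N s) (E i s)) (fun _ => (0 : ℝ)) I := fun s hs =>
    Submodule.inner_left_of_mem_orthogonal (hEt s hs) (hN.1.2 s hs)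
  rw [derivWithin_congr h2 (h2 ht), derivWithin_fun_const] at h1
  simp only [Pi.zero_apply] at h1
  rw [Submodule.inner_starProjection_left_eq_right,
    Submodule.starProjection_eq_self_iff.2 (hEt t ht),
    real_inner_comm (N t) (covDeriv I (E i) t)]
  unfold covDeriv
  linarith

theorem IsAdaptedFrame.mem_ruling_iff (h : CauchyData m I γ D)
    (hN : IsAdmissibleNormal I D N) (ht : t ∈ I) (hr : rhoRank I D t = 1) {x : Euc d} :
    x ∈ ruling I D t ↔ x ∈ D t ∧ inner ℝ ((D t).starProjection (covDeriv I N t)) x = 0 := by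
  refine CauchyData.mem_ruling_iff_inner hr ?_ (hN.2 t ht)
  rw [← rho_apply_eq_of_differentiableWithinAt h.uniqueDiffOn h.distribution ht
    (hN.1.1.differentiableWithinAt ht) hN.1.2]
  exact ⟨_, ⟨_, rfl⟩, rfl⟩

/-- The data of the explicit parametrization. -/
structure ParamData (m : ℕ) (I : Set ℝ) (γ : ℝ → Euc d) (D : ℝ → Submodule ℝ (Euc d))
    (E : Fin m → ℝ → Euc d) (N : ℝ → Euc d) : Prop where
  cauchy : CauchyData m I γ D
  rank : ∀ t ∈ I, rhoRank I D t = 1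
  frame : IsAdaptedFrame I γ D E
  normal : IsAdmissibleNormal I D N

namespace ParamData

theorem frame_mem (h : ParamData m I γ D E N) (ht : t ∈ I) (i : Fin m) : E i t ∈ D t := by
  rw [← (h.frame.2 t ht).2.1]
  exact Submodule.subset_span ⟨i, rfl⟩

theorem rulingField_mem (h : ParamData m I γ D E N) (hm : 0 < m) (ht : t ∈ I)
    (j : Fin (m - 1)) : rulingField I E N j t ∈ ruling I D t := by
  rw [IsAdaptedFrame.mem_ruling_iff h.cauchy h.normal ht (h.rank t ht), rulingField_eq hm]
  refine ⟨sub_mem (Submodule.smul_mem _ _ (h.frame_mem ht _))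
    (Submodule.smul_mem _ _ (h.frame_mem ht _)), ?_⟩
  rw [inner_sub_right, inner_smul_right, inner_smul_right,
    h.frame.inner_conormal h.cauchy h.normal ht, h.frame.inner_conormal h.cauchy h.normal ht,
    accComponent]
  ring

theorem frame_zero_notMem (h : ParamData m I γ D E N) (hm : 0 < m) (ht : t ∈ I) :
    E ⟨0, hm⟩ t ∉ ruling I D t := by
  rw [(h.frame.2 t ht).2.2 ⟨0, hm⟩ rfl]
  exact h.cauchy.velocity_notMem_ruling ht

/-- Otherwise `E_1`, the velocity, would be orthogonal to `Im ρ` and hence a ruling direction. -/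
theorem accComponent_ne_zero (h : ParamData m I γ D E N) (hm : 0 < m) (ht : t ∈ I) :
    accComponent hm I E N t ≠ 0 := by
  intro h0
  apply h.frame_zero_notMem hm ht
  rw [IsAdaptedFrame.mem_ruling_iff h.cauchy h.normal ht (h.rank t ht)]
  refine ⟨h.frame_mem ht _, ?_⟩
  rw [h.frame.inner_conormal h.cauchy h.normal ht]
  unfold accComponent at h0
  rw [h0, neg_zero]

/-- `E_{j+1}` occurs in `X_j` alone, with a nonzero coefficient. This gives the independence of the
ruling fields and the formula for `rulingCoord`. -/
theorem inner_frame_sum (h : ParamData m I γ D E N) (hm : 0 < m) (ht : t ∈ I)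
    (u : Fin (m - 1) → ℝ) (j : Fin (m - 1)) :
    inner ℝ (E ⟨j.val + 1, by have := j.isLt; omega⟩ t) (∑ i, u i • rulingField I E N i t) =
      - accComponent hm I E N t * u j := by
  have ho := (h.frame.2 t ht).1
  rw [inner_sum, Finset.sum_eq_single j]
  · rw [inner_smul_right, rulingField_eq hm, inner_sub_right, inner_smul_right, inner_smul_right,
      ho.2 (by simp [Fin.ext_iff]), real_inner_self_eq_norm_sq, ho.1]
    ring
  · intro i _ hij
    have hji : j.val ≠ i.val := fun h0 => hij (Fin.ext h0.symm)
    rw [inner_smul_right, rulingField_eq hm, inner_sub_right, inner_smul_right, inner_smul_right,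
      ho.2 (by simp [Fin.ext_iff]), ho.2 (by simpa [Fin.ext_iff] using hji)]
    ring
  · simp

theorem rulingCoord_sum (h : ParamData m I γ D E N) (hm : 0 < m) (ht : t ∈ I)
    (u : Fin (m - 1) → ℝ) :
    rulingCoord hm I E N (t, ∑ i, u i • rulingField I E N i t) = u := by
  funext j
  have h0 := h.accComponent_ne_zero hm ht
  rw [rulingCoord]
  simp only
  rw [h.inner_frame_sum hm ht, neg_mul, neg_mul, mul_neg, neg_neg, inv_mul_cancel_left₀ h0]

/-- The difference `y` of the two sides is a ruling vector orthogonal to all frame members except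
`E_1`. It is then a multiple of `E_1`, which is not a ruling direction, so it vanishes. -/
theorem sum_rulingCoord (h : ParamData m I γ D E N) (hm : 0 < m) {z : ℝ × Euc d}
    (hz : z ∈ ruledDomain I D) :
    ∑ j, rulingCoord hm I E N z j • rulingField I E N j z.1 = z.2 := by
  have h0 := h.accComponent_ne_zero hm hz.1
  obtain ⟨ho, hspan, -⟩ := h.frame.2 z.1 hz.1
  set y := z.2 - ∑ j, rulingCoord hm I E N z j • rulingField I E N j z.1 with hy
  have hyr : y ∈ ruling I D z.1 := sub_mem hz.2 (Submodule.sum_mem _ fun j _ =>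
    Submodule.smul_mem _ _ (h.rulingField_mem hm hz.1 j))
  have hyE : ∀ j : Fin (m - 1), inner ℝ (E ⟨j.val + 1, by have := j.isLt; omega⟩ z.1) y = 0 := by
    intro j
    rw [hy, inner_sub_right, h.inner_frame_sum hm hz.1, rulingCoord, neg_mul, neg_mul,
      mul_neg, neg_neg, mul_inv_cancel_left₀ h0, sub_self]
  have hsum := starProjection_eq_sum ho hspan y
  rw [Submodule.starProjection_eq_self_iff.2 (ruling_le hyr), Finset.sum_eq_single ⟨0, hm⟩] at hsum
  · have h1 : inner ℝ (E ⟨0, hm⟩ z.1) y = 0 := by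
      by_contra hne
      refine h.frame_zero_notMem hm hz.1 ?_
      rw [hsum] at hyr
      exact (Submodule.smul_mem_iff _ hne).1 hyr
    rw [h1, zero_smul] at hsum
    exact (sub_eq_zero.1 hsum).symm
  · intro i _ hi
    have hi0 : i.val ≠ 0 := fun h0 => hi (Fin.ext h0)
    have := hyE ⟨i.val - 1, by omega⟩
    have hi' : (⟨i.val - 1 + 1, by omega⟩ : Fin m) = i := Fin.ext (by simp; omega)
    simp only [hi'] at this
    rw [this, zero_smul]
  · simp

theorem smoothNear_accComponent (h : ParamData m I γ D E N) (hm : 0 < m) (ht : t ∈ I) :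
    SmoothNear I (accComponent hm I E N) t :=
  (((h.frame.1 _).smoothNear ht).covDeriv h.cauchy.uniqueDiffOn).inner
    (h.normal.1.1.smoothNear ht)

theorem smoothNear_rulingField (h : ParamData m I γ D E N) (ht : t ∈ I) (j : Fin (m - 1)) :
    SmoothNear I (rulingField I E N j) t := by
  have hm : 0 < m := by have := j.isLt; omega
  have hN := h.normal.1.1.smoothNear ht
  exact ((((h.frame.1 _).smoothNear ht).covDeriv h.cauchy.uniqueDiffOn |>.inner hN).smul
    ((h.frame.1 _).smoothNear ht)).sub
    ((h.smoothNear_accComponent hm ht).smul ((h.frame.1 _).smoothNear ht))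

theorem continuousWithinAt_rulingCoord (h : ParamData m I γ D E N) (hm : 0 < m) {z : ℝ × Euc d}
    (hz : z ∈ ruledDomain I D) :
    ContinuousWithinAt (rulingCoord hm I E N) (ruledDomain I D) z := by
  have hfst : Tendsto (fun z : ℝ × Euc d => z.1) (𝓝[ruledDomain I D] z) (𝓝[I] z.1) :=
    continuous_fst.continuousWithinAt.tendsto_nhdsWithin fun z hz => hz.1
  have hsnd : Tendsto (fun z : ℝ × Euc d => z.2) (𝓝[ruledDomain I D] z) (𝓝 z.2) :=
    continuous_snd.continuousWithinAt
  refine tendsto_pi_nhds.2 fun j => ?_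
  have h1 := ((h.smoothNear_accComponent hm hz.1).continuousWithinAt hz.1).tendsto.comp hfst
  have h2 := ((((h.frame.1 ⟨j.val + 1, by have := j.isLt; omega⟩).smoothNear
    hz.1).continuousWithinAt hz.1).tendsto.comp hfst).inner (𝕜 := ℝ) hsnd
  exact ((h1.inv₀ (h.accComponent_ne_zero hm hz.1)).neg).mul h2

/-- The neighbourhood of the zero section of the ruling bundle that corresponds to the box. -/
def boxPatch (hm : 0 < m) (I : Set ℝ) (D : ℝ → Submodule ℝ (Euc d)) (E : Fin m → ℝ → Euc d)
    (N : ℝ → Euc d) (ε : ℝ) : Set (ℝ × Euc d) :=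
  {z | z ∈ ruledDomain I D ∧ ∀ j, |rulingCoord hm I E N z j| < ε}

theorem boxPatch_of_box (h : ParamData m I γ D E N) (hm : 0 < m) {ε : ℝ}
    {z : ℝ × (Fin (m - 1) → ℝ)} (hz : z ∈ box (m - 1) I ε) :
    (z.1, ∑ j, z.2 j • rulingField I E N j z.1) ∈ boxPatch hm I D E N ε := by
  have hmem : ∑ j, z.2 j • rulingField I E N j z.1 ∈ ruling I D z.1 :=
    Submodule.sum_mem _ fun j _ => Submodule.smul_mem _ _ (h.rulingField_mem hm hz.1 j)
  refine ⟨⟨hz.1, hmem⟩, fun j => ?_⟩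
  rw [h.rulingCoord_sum hm hz.1]
  exact abs_lt.2 (hz.2 j)

theorem image_box (h : ParamData m I γ D E N) (hm : 0 < m) (ε : ℝ) :
    sigma γ (rulingField I E N) '' box (m - 1) I ε = ruledMap γ '' boxPatch hm I D E N ε := by
  ext p
  constructor
  · rintro ⟨z, hz, rfl⟩
    exact ⟨_, h.boxPatch_of_box hm hz, rfl⟩
  · rintro ⟨z, hz, rfl⟩
    refine ⟨(z.1, rulingCoord hm I E N z), ⟨hz.1.1, fun j => abs_lt.1 (hz.2 j)⟩, ?_⟩
    rw [sigma, ruledMap, h.sum_rulingCoord hm hz.1]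

theorem isRuledPatch_boxPatch (h : ParamData m I γ D E N) (hm : 0 < m) {ε : ℝ} (hε : 0 < ε)
    {r : ℝ → ℝ} (hsub : boxPatch hm I D E N ε ⊆ ruledTube I D r)
    (hemb : EmbeddedOn γ (ruledTube I D r))
    (himm : ∀ z ∈ ruledTube I D r, ImmersedAt I γ D z.1 z.2) :
    IsRuledPatch I γ D (boxPatch hm I D E N ε) where
  subset _ hz := hz.1
  relOpen z hz := by
    have h1 := h.continuousWithinAt_rulingCoord hm hz.1
    have h2 : ∀ᶠ z' in 𝓝[ruledDomain I D] z, ∀ j, |rulingCoord hm I E N z' j| < ε :=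
      eventually_all.2 fun j =>
        (((continuous_apply j).continuousAt.tendsto.comp h1).abs).eventually_lt_const (hz.2 j)
    filter_upwards [eventually_nhdsWithin_iff.1 h2] with z' hz' hd using ⟨hd, hz' hd⟩
  zero_mem t ht := ⟨⟨ht, zero_mem _⟩, fun j => by simpa [rulingCoord] using hε⟩
  star z hz s hs := by
    refine ⟨⟨hz.1.1, Submodule.smul_mem _ _ hz.1.2⟩, fun j => lt_of_le_of_lt ?_ (hz.2 j)⟩
    have : rulingCoord hm I E N (z.1, s • z.2) j = s * rulingCoord hm I E N z j := by
      simp only [rulingCoord, inner_smul_right]; ring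
    rw [this, abs_mul, abs_of_nonneg hs.1]
    exact mul_le_of_le_one_left (abs_nonneg _) hs.2
  immersed z hz := himm z (hsub hz)
  embedded := hemb.mono hsub

theorem exists_boxPatch_subset (h : ParamData m I γ D E N) (hm : 0 < m) (hc : IsCompact I)
    {r : ℝ → ℝ} (hr : ContinuousOn r I) (hpos : ∀ t ∈ I, 0 < r t) :
    ∃ ε₀ > 0, ∀ ε, ε < ε₀ → boxPatch hm I D E N ε ⊆ ruledTube I D r := by
  obtain ⟨t₀, ht₀⟩ := h.cauchy.interior_nonempty.mono interior_subset
  obtain ⟨tm, htm, hmin⟩ := hc.exists_isMinOn ⟨t₀, ht₀⟩ hr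
  have hB : ContinuousOn (fun t => ∑ j, ‖rulingField I E N j t‖) I :=
    continuousOn_finsetSum _ fun j _ t ht =>
      ((h.smoothNear_rulingField ht j).continuousWithinAt ht).norm
  obtain ⟨tM, htM, hmax⟩ := hc.exists_isMaxOn ⟨t₀, ht₀⟩ hB
  set C := ∑ j, ‖rulingField I E N j tM‖ with hC
  have hC0 : 0 ≤ C := Finset.sum_nonneg fun j _ => norm_nonneg _
  -- On the patch `‖x‖ ≤ |ε| ∑ ‖X_j‖ ≤ |ε| C`, with `C` the maximum of the sum over `I`. The
  -- denominator `C + 1` cannot vanish.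
  refine ⟨r tm / (C + 1), div_pos (hpos tm htm) (by linarith), fun ε hε z hz => ⟨hz.1, ?_⟩⟩
  rw [lt_div_iff₀ (by linarith)] at hε
  rw [← h.sum_rulingCoord hm hz.1]
  have h1 : ‖∑ j, rulingCoord hm I E N z j • rulingField I E N j z.1‖ ≤
      |ε| * ∑ j, ‖rulingField I E N j z.1‖ := by
    rw [Finset.mul_sum]
    refine norm_sum_le_of_le _ fun j _ => ?_
    rw [norm_smul, Real.norm_eq_abs]
    exact mul_le_mul_of_nonneg_right ((hz.2 j).le.trans (le_abs_self _)) (norm_nonneg _)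
  have h2 : ∑ j, ‖rulingField I E N j z.1‖ ≤ C := hmax hz.1.1
  have h3 : r tm ≤ r z.1 := hmin hz.1.1
  have h4 := hpos tm htm
  rcases le_or_gt 0 ε with h0 | h0
  · rw [abs_of_nonneg h0] at h1
    nlinarith
  -- For negative `ε` the bound on the coordinates excludes every index `j`, so the sum is empty.
  · have h5 : ∀ j : Fin (m - 1), False := fun j =>
      absurd (hz.2 j) (not_lt.2 (h0.le.trans (abs_nonneg _)))
    have h6 : ∑ j, rulingCoord hm I E N z j • rulingField I E N j z.1 = 0 :=
      Finset.sum_eq_zero fun j _ => (h5 j).elim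
    rw [h6, norm_zero]
    linarith

end ParamData

end DevCauchy

/-! ### The explicit parametrization is an embedding -/

namespace DevCauchy

open Set Filter Topology

variable {d m : ℕ} {I : Set ℝ} {γ : ℝ → Euc d} {D : ℝ → Submodule ℝ (Euc d)} {M : Set (Euc d)}
  {E : Fin m → ℝ → Euc d} {N : ℝ → Euc d} {t : ℝ}

theorem contDiff_sigma {k : ℕ} {g : ℝ → Euc d} {H : Fin k → ℝ → Euc d} (hg : ContDiff ℝ ∞ g)
    (hH : ∀ j, ContDiff ℝ ∞ (H j)) : ContDiff ℝ ∞ (sigma g H) := by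
  refine (hg.comp contDiff_fst).add (ContDiff.sum fun j _ => ContDiff.fun_smul ?_
    ((hH j).comp contDiff_fst))
  exact (contDiff_apply ℝ ℝ j).comp contDiff_snd

theorem fderiv_sigma {k : ℕ} {g : ℝ → Euc d} {H : Fin k → ℝ → Euc d} (hg : ContDiff ℝ ∞ g)
    (hH : ∀ j, ContDiff ℝ ∞ (H j)) (z v : ℝ × (Fin k → ℝ)) :
    fderiv ℝ (sigma g H) z v = v.1 • (deriv g z.1 + ∑ j, z.2 j • deriv (H j) z.1) +
      ∑ j, v.2 j • H j z.1 := by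
  have h1 : HasDerivAt (fun s : ℝ => sigma g H (z + s • v)) (fderiv ℝ (sigma g H) z v) 0 := by
    have h2 : HasDerivAt (fun s : ℝ => z + s • v) v 0 := by
      simpa using ((hasDerivAt_id (0 : ℝ)).smul_const v).const_add z
    have h3 : HasFDerivAt (sigma g H) (fderiv ℝ (sigma g H) z) (z + (0 : ℝ) • v) := by
      rw [zero_smul, add_zero]
      exact ((contDiff_sigma hg hH).differentiable (by simp) z).hasFDerivAt
    exact h3.comp_hasDerivAt (0 : ℝ) h2
  let τ : ℝ → ℝ := fun s => z.1 + s * v.1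
  have hτ : HasDerivAt τ v.1 0 := by
    simpa [τ] using ((hasDerivAt_id (0 : ℝ)).mul_const v.1).const_add z.1
  have hτ0 : τ 0 = z.1 := by simp [τ]
  have hgd : HasDerivAt (fun s => g (τ s)) (v.1 • deriv g z.1) 0 := by
    rw [← hτ0]
    exact HasDerivAt.scomp (0 : ℝ) ((hg.differentiable (by simp)) _).hasDerivAt hτ
  have hHd : ∀ j, HasDerivAt (fun s => (z.2 j + s * v.2 j) • H j (τ s))
      (z.2 j • (v.1 • deriv (H j) z.1) + v.2 j • H j z.1) 0 := by
    intro j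
    have h2 : HasDerivAt (fun s => H j (τ s)) (v.1 • deriv (H j) z.1) 0 := by
      rw [← hτ0]
      exact HasDerivAt.scomp (0 : ℝ) (((hH j).differentiable (by simp)) _).hasDerivAt hτ
    have h3 : HasDerivAt (fun s : ℝ => z.2 j + s * v.2 j) (v.2 j) 0 := by
      simpa using ((hasDerivAt_id (0 : ℝ)).mul_const (v.2 j)).const_add (z.2 j)
    have h4 := h3.smul h2
    simp only [hτ0, zero_mul, add_zero] at h4
    exact h4
  have h5 : HasDerivAt (fun s : ℝ => sigma g H (z + s • v)) _ 0 :=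
    hgd.add (HasDerivAt.fun_sum fun j (_ : j ∈ Finset.univ) => hHd j)
  rw [h1.unique h5, smul_add, Finset.sum_add_distrib, Finset.smul_sum, add_assoc]
  congr 2
  exact Finset.sum_congr rfl fun j _ => smul_comm _ _ _

theorem box_eq_prod (k : ℕ) (I : Set ℝ) (ε : ℝ) :
    box k I ε = I ×ˢ (univ.pi fun _ : Fin k => Ioo (-ε) ε) := by
  ext z
  simp [box]

namespace ParamData

/-- Near a point of the box the parametrization is the restriction of a smooth map. -/
theorem exists_extension_sigma (h : ParamData m I γ D E N) {ε : ℝ}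
    {z : ℝ × (Fin (m - 1) → ℝ)} (ht : z.1 ∈ I) :
    ∃ (g : ℝ → Euc d) (H : Fin (m - 1) → ℝ → Euc d), ContDiff ℝ ∞ g ∧
      (∀ j, ContDiff ℝ ∞ (H j)) ∧ deriv g z.1 = covDeriv I γ z.1 ∧
      (∀ j, H j z.1 = rulingField I E N j z.1 ∧
        inner ℝ (unitConormal I γ D z.1) (deriv (H j) z.1) =
          - inner ℝ (covDeriv I (unitConormal I γ D) z.1) (rulingField I E N j z.1)) ∧
      sigma γ (rulingField I E N) =ᶠ[𝓝[box (m - 1) I ε] z] sigma g H := by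
  have hU := h.cauchy.uniqueDiffOn
  obtain ⟨g, hg, hge⟩ := (h.cauchy.smooth.smoothNear ht).exists_extension hU
  choose H hH hHe using fun j => (h.smoothNear_rulingField ht j).exists_extension hU
  refine ⟨g, H, hg, hH, (hge.self_of_nhdsWithin ht).2.2.symm, fun j => ?_, ?_⟩
  · obtain ⟨h1, h2, -⟩ := (hHe j).self_of_nhdsWithin ht
    have hm : 0 < m := by have := j.isLt; omega
    refine ⟨h1.symm, ?_⟩
    have h3 := ((h.cauchy.smoothNear_unitConormal ht).differentiableWithinAt ht).hasDerivWithinAt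
    have h4 := (h3.inner ℝ h2).derivWithin (hU _ ht)
    have h5 : EqOn (fun s => inner ℝ (unitConormal I γ D s) (rulingField I E N j s))
        (fun _ => (0 : ℝ)) I := fun s hs =>
      ((h.cauchy.mem_ruling_iff_unitConormal hs (h.rank s hs)).1 (h.rulingField_mem hm hs j)).2
    rw [derivWithin_congr h5 (h5 ht), derivWithin_fun_const] at h4
    simp only [Pi.zero_apply] at h4
    unfold covDeriv
    linarith
  · have hfst : Tendsto (fun z : ℝ × (Fin (m - 1) → ℝ) => z.1) (𝓝[box (m - 1) I ε] z)
        (𝓝[I] z.1) := continuous_fst.continuousWithinAt.tendsto_nhdsWithin fun z hz => hz.1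
    filter_upwards [hfst.eventually hge, hfst.eventually (eventually_all.2 hHe)] with z' h1 h2
    rw [sigma, sigma, h1.1]
    congr 1
    exact Finset.sum_congr rfl fun j _ => by rw [(h2 j).1]

/-- The product of the differential with the unit conormal leaves the parameter component times the
nonzero factor of `ImmersedAt`; the other components are recovered by `rulingCoord`. For the
topology, `σ` is the ruled map composed with the change of coordinates `β`, whose continuous inverse
is again given by `rulingCoord`. -/
theorem isSmoothEmbeddingOn (h : ParamData m I γ D E N) (hm : 0 < m) {ε : ℝ}
    (hW : IsRuledPatch I γ D (boxPatch hm I D E N ε)) :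
    IsSmoothEmbeddingOn (sigma γ (rulingField I E N)) (box (m - 1) I ε) := by
  have hcd : ContDiffOn ℝ ∞ (sigma γ (rulingField I E N)) (box (m - 1) I ε) := fun z hz => by
    obtain ⟨g, H, hg, hH, -, -, heq⟩ := h.exists_extension_sigma (ε := ε) hz.1
    exact ((contDiff_sigma hg hH).contDiffAt.contDiffWithinAt).congr_of_eventuallyEq heq
      (heq.self_of_nhdsWithin hz)
  refine ⟨hcd, fun z hz => ?_, ?_⟩
  · obtain ⟨g, H, hg, hH, hg', hH', heq⟩ := h.exists_extension_sigma (ε := ε) hz.1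
    have hu : UniqueDiffWithinAt ℝ (box (m - 1) I ε) z := by
      rw [box_eq_prod] at hz ⊢
      exact (h.cauchy.uniqueDiffOn z.1 hz.1).prod
        ((isOpen_set_pi finite_univ fun _ _ => isOpen_Ioo).uniqueDiffWithinAt hz.2)
    rw [heq.fderivWithin_eq (heq.self_of_nhdsWithin hz),
      ((contDiff_sigma hg hH).differentiable (by simp) z).fderivWithin hu,
      injective_iff_map_eq_zero]
    intro v hv
    rw [fderiv_sigma hg hH, hg'] at hv
    simp only [fun j => (hH' j).1] at hv
    have hmem := h.boxPatch_of_box hm hz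
    have himm : ImmersedAt I γ D z.1 (∑ j, z.2 j • rulingField I E N j z.1) :=
      hW.immersed (z.1, ∑ j, z.2 j • rulingField I E N j z.1) hmem
    have hr := fun x => h.cauchy.mem_ruling_iff_unitConormal hz.1 (h.rank _ hz.1) (x := x)
    have hr0 : ∀ c : Fin (m - 1) → ℝ,
        inner ℝ (unitConormal I γ D z.1) (∑ j, c j • rulingField I E N j z.1) = 0 := fun c =>
      ((hr _).1 (Submodule.sum_mem _ fun j _ =>
        Submodule.smul_mem _ _ (h.rulingField_mem hm hz.1 j))).2
    have hvel : inner ℝ (unitConormal I γ D z.1)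
        (covDeriv I γ z.1 + ∑ j, z.2 j • deriv (H j) z.1) =
        inner ℝ (unitConormal I γ D z.1) (covDeriv I γ z.1) -
          inner ℝ (covDeriv I (unitConormal I γ D) z.1)
            (∑ j, z.2 j • rulingField I E N j z.1) := by
      rw [inner_add_right, inner_sum, inner_sum, sub_eq_add_neg, ← Finset.sum_neg_distrib]
      congr 1
      refine Finset.sum_congr rfl fun j _ => ?_
      rw [inner_smul_right, inner_smul_right, (hH' j).2, mul_neg]
    have h1 := congrArg (fun y => inner ℝ (unitConormal I γ D z.1) y) hv
    simp only [inner_zero_right] at h1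
    rw [inner_add_right, hr0, add_zero, inner_smul_right, hvel] at h1
    have hv1 : v.1 = 0 := (mul_eq_zero.1 h1).resolve_right himm
    rw [hv1, zero_smul, zero_add] at hv
    have hv2 : v.2 = 0 := by
      rw [← h.rulingCoord_sum hm hz.1 v.2, hv]
      funext j
      simp [rulingCoord]
    exact Prod.ext hv1 hv2
  · apply Topology.IsInducing.isEmbedding
    rw [isInducing_iff_nhds]
    rintro ⟨z, hz⟩
    apply le_antisymm
    · exact (hcd.continuousOn.domRestrict.continuousAt (x := ⟨z, hz⟩)).tendsto.le_comap
    · intro S hS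
      rw [nhds_subtype_eq_comap] at hS
      obtain ⟨O, hO, hOS⟩ := hS
      have hmem := h.boxPatch_of_box hm hz
      set β : ℝ × (Fin (m - 1) → ℝ) → ℝ × Euc d := fun z =>
        (z.1, ∑ j, z.2 j • rulingField I E N j z.1) with hβ
      have hinv : ∀ z ∈ box (m - 1) I ε, ((β z).1, rulingCoord hm I E N (β z)) = z := fun z hz => by
        rw [hβ]
        simp only
        rw [h.rulingCoord_sum hm hz.1]
      have hcont : ContinuousWithinAt (fun y : ℝ × Euc d => (y.1, rulingCoord hm I E N y))
          (ruledDomain I D) (β z) :=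
        continuous_fst.continuousWithinAt.prodMk (h.continuousWithinAt_rulingCoord hm hmem.1)
      have hpre : ∀ᶠ y in 𝓝 (β z), y ∈ ruledDomain I D → (y.1, rulingCoord hm I E N y) ∈ O := by
        refine eventually_nhdsWithin_iff.1 (hcont.eventually_mem ?_)
        simp only
        rwa [hinv z hz]
      obtain ⟨V, hV, hVO⟩ := hW.embedded _ hmem _ hpre
      refine ⟨V, hV, fun y hy => hOS ?_⟩
      have hym := h.boxPatch_of_box hm y.2
      have h2 := hVO _ hym hy hym.1
      rw [mem_preimage, ← hinv y.1 y.2]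
      exact h2

end ParamData

/-- Over a compact interval the explicit parametrization describes the solutions near the curve. -/
theorem IsSolution.exists_parametrization (h : CauchyData m I γ D) (hm : 0 < m) (hmd : m ≤ d)
    (hc : IsCompact I) (hE : IsAdaptedFrame I γ D E) (hN : IsAdmissibleNormal I D N)
    (hM : IsSolution m I γ D M) :
    ∃ ε₀ > 0, ∀ ε, 0 < ε → ε < ε₀ →
      IsSmoothEmbeddingOn (sigma γ (rulingField I E N)) (box (m - 1) I ε) ∧
      IsSolution m I γ D (sigma γ (rulingField I E N) '' box (m - 1) I ε) ∧
      ∃ U, IsOpen U ∧ γ '' I ⊆ U ∧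
        M ∩ U = sigma γ (rulingField I E N) '' box (m - 1) I ε := by
  have hr : ∀ t ∈ I, rhoRank I D t = 1 := fun t ht => (hM.rank_and_nullity h hm hmd ht).1
  have hP : ParamData m I γ D E N := ⟨h, hr, hE, hN⟩
  obtain ⟨r, hrc, hpos, hemb, himm, hU⟩ := hM.exists_tube h hm hmd
  obtain ⟨ε₀, hε₀, hsub⟩ := hP.exists_boxPatch_subset hm hc hrc hpos
  refine ⟨ε₀, hε₀, fun ε hε hlt => ?_⟩
  have hW := hP.isRuledPatch_boxPatch hm hε (hsub ε hlt) hemb himm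
  rw [hP.image_box hm]
  obtain ⟨U, hUo, hUs, hUM⟩ := hU _ (hsub ε hlt) hW.relOpen
  exact ⟨hP.isSmoothEmbeddingOn hm hW, hW.isSolution h hm hmd hr, U, hUo,
    (curve_subset_image hW).trans hUs, hUM⟩

end DevCauchy

theorem mainTheorem1 (m n : ℕ) (hm : 2 ≤ m) (hn : 1 ≤ n)
    (I : Set ℝ) (hI : I.OrdConnected) (hI' : (interior I).Nonempty)
    (γ : ℝ → DevCauchy.Euc (m + n)) (hγ : DevCauchy.SmoothAlong I γ)
    (hreg : ∀ t ∈ I, DevCauchy.covDeriv I γ t ≠ 0)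
    (hemb : Topology.IsEmbedding (I.domRestrict γ))
    (D : ℝ → Submodule ℝ (DevCauchy.Euc (m + n)))
    (hD : DevCauchy.IsDistribution m I D)
    (hγD : ∀ t ∈ I, DevCauchy.covDeriv I γ t ∈ D t)
    (hcurv : ∀ t ∈ I,
      (D t)ᗮ.starProjection (DevCauchy.covDeriv I (DevCauchy.covDeriv I γ) t) ≠ 0) :
    -- existence
    ((∃ M, DevCauchy.IsSolution m I γ D M) ↔ ∀ t ∈ I, DevCauchy.rhoRank I D t = 1) ∧
    -- (i) uniqueness near the curve
    (∀ M₁ M₂, DevCauchy.IsSolution m I γ D M₁ → DevCauchy.IsSolution m I γ D M₂ →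
      ∃ U, IsOpen U ∧ γ '' I ⊆ U ∧ M₁ ∩ U = M₂ ∩ U) ∧
    -- (ii) near the curve, the solution is `γ + D ∩ (Im ρ)ᗮ`
    (∀ M, DevCauchy.IsSolution m I γ D M →
      ∃ (U : Set (DevCauchy.Euc (m + n))) (ε : ℝ → ℝ), IsOpen U ∧ γ '' I ⊆ U ∧
        ContinuousOn ε I ∧ (∀ t ∈ I, 0 < ε t) ∧
        M ∩ U = {p | ∃ t ∈ I, ∃ x ∈ D t ⊓ (DevCauchy.rhoImage I D t)ᗮ,
          ‖x‖ < ε t ∧ p = γ t + x}) ∧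
    -- (iii) explicit parametrization over a compact interval
    (IsCompact I → (∀ t ∈ I, ‖DevCauchy.covDeriv I γ t‖ = 1) →
      (∃ E : Fin m → ℝ → DevCauchy.Euc (m + n), DevCauchy.IsAdaptedFrame I γ D E) ∧
      (∃ N, DevCauchy.IsAdmissibleNormal I D N) ∧
      ∀ (E : Fin m → ℝ → DevCauchy.Euc (m + n)) (N : ℝ → DevCauchy.Euc (m + n)),
        DevCauchy.IsAdaptedFrame I γ D E → DevCauchy.IsAdmissibleNormal I D N →
        ∀ M, DevCauchy.IsSolution m I γ D M →
          ∃ ε₀ > 0, ∀ ε, 0 < ε → ε < ε₀ →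
            DevCauchy.IsSmoothEmbeddingOn
              (DevCauchy.sigma γ (DevCauchy.rulingField I E N)) (DevCauchy.box (m - 1) I ε) ∧
            DevCauchy.IsSolution m I γ D
              (DevCauchy.sigma γ (DevCauchy.rulingField I E N) '' DevCauchy.box (m - 1) I ε) ∧
            ∃ U, IsOpen U ∧ γ '' I ⊆ U ∧
              M ∩ U =
                DevCauchy.sigma γ (DevCauchy.rulingField I E N) '' DevCauchy.box (m - 1) I ε) := by
  have h : DevCauchy.CauchyData m I γ D := ⟨hI, hI', hγ, hemb, hD, hγD, hcurv⟩
  have hm0 : 0 < m := by omega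
  have hmd : m ≤ m + n := by omega
  refine ⟨h.exists_solution_iff hm0 hmd, fun M₁ M₂ h₁ h₂ => h₁.eq_near h hm0 hmd h₂,
    fun M hM => hM.eq_rulings_near h hm0 hmd, fun hc hu => ?_⟩
  obtain ⟨a, b, hab, rfl⟩ := DevCauchy.exists_eq_Icc_of_isCompact hI hI' hc
  exact ⟨h.exists_adaptedFrame hab hm0 hu, h.exists_admissibleNormal hab,
    fun E N hE hN M hM => hM.exists_parametrization h hm0 hmd hc hE hN⟩
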